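/- **Setting.** Let $\tau_A: A\to Q$ be a smooth real vector bundle of rank $n$ over a smooth (Hausdorff, $\sigma$-compact) manifold $Q$ of dimension $m$, with $Q$ and $A$ orientable, and let $([\![\cdot,\cdot]\!]_A,\rho_A)$ be a Lie algebroid structure on it: an $\mathbb R$-Lie bracket on $\Gamma(A)$ and a vector bundle morphism $\rho_A:A\to TQ$ with $[\![X,fY]\!]_A=f[\![X,Y]\!]_A+\rho_A(X)(f)Y$. For $f\in C^\infty(Q)$ let $d^Af\in\Gamma(A^*)$ be given by $(d^Af)(X)=\rho_A(X)(f)$. Write $\tau:A^*\to Q$ for the dual bundle and $0:Q\to A^*$ for its zero section, and let $\hat X(\alpha)=\alpha(X(\tau(\alpha)))$ for $X\in\Gamma(A)$. The linear Poisson structure $\Pi_{A^*}$ on $A^*$ is the bivector, with bracket $\{\varphi,\psi\}=\Pi_{A^*}(d\varphi,d\psi)$, characterized by $\{\hat X,\hat Y\}=-\widehat{[\![X,Y]\!]_A}$, $\{f\circ\tau,\hat X\}=\rho_A(X)(f)\circ\tau$, $\{f\circ\tau,g\circ\tau\}=0$. The hamiltonian vector field $\mathcal H_H$ of $H\in C^\infty(A^*)$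 is given by $\mathcal H_H(F)=\{F,H\}$. In a vector bundle, $w^{\mathbf v}$ denotes the vertical lift, $w^{\mathbf v}(a)=\frac{d}{dt}|_{t=0}(a+tw)$ for $a,w$ in the same fibre. A vector field $Z$ preserves a volume form $\Phi$ if $\mathcal L_Z\Phi=0$. Let $\nu$ be a volume form on $Q$ and $\Lambda$ a nowhere vanishing section of $\Lambda^nA$. Then $\nu\wedge\Lambda$ is the volume form on $A^*$ with $(\nu\wedge\Lambda)(Z_1,\dots,Z_m,\beta_1^{\mathbf v},\dots,\beta_n^{\mathbf v})=\nu(T\tau Z_1,\dots,T\tau Z_m)\,\Lambda(\beta_1,\dots,\beta_n)$, and the modular section $\mathcal M^{(\nu,\Lambda)}\in\Gamma(A^*)$ is the unique section such that $(\mathcal M^{(\nu,\Lambda)})^{\mathbf v}(H)$ is the divergence of $\mathcal H_H$ with respect to $\nu\wedge\Lambda$, for all $H\in C^\infty(A^*)$. Its class modulo $\{d^A\sigma:\sigma\in C^\infty(Q)\}$ does not depend on $(\nu,\Lambda)$, and $A$ is unimodular if this class is zero. Let $\mathcal G$ be a (positive definite) bundle metric on $A$, $\flat_{\mathcal G}:A\to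 A^*$ the induced isomorphism, $\Lambda^{\mathcal G}$ the section of $\Lambda^nA$ equal to $1$ on the positively oriented orthonormal bases of the fibres of $A^*$ (for a fixed orientation of $A$), $V\in C^\infty(Q)$, and $H:A^*\to\mathbb R$, $H(\alpha)=\frac12\mathcal G(\alpha,\alpha)+V(\tau(\alpha))$, where $\mathcal G$ also denotes the induced metric on $A^*$. Fix a volume form $\nu$ on $Q$. A volume form on $A^*$ is of basic type if it is $e^{\mu\circ\tau}\,\nu\wedge\Lambda^{\mathcal G}$ with $\mu\in C^\infty(Q)$. For $\tilde\sigma\in C^\infty(A^*)$ let $\mathbb F\tilde\sigma:A^*\to A$ be the fibre-preserving map with $\beta(\mathbb F\tilde\sigma(\alpha))=\frac{d}{dt}|_{t=0}\tilde\sigma(\alpha+t\beta)$ for $\alpha,\beta\in A_q^*$. **Theorem 4.1.** (i) If $A$ is unimodular, then $\mathcal H_H$ preserves a volume form of basic type on $A^*$. In fact, if $\sigma\in C^\infty(Q)$ and $\mathcal M^{(\nu,\Lambda^{\mathcal G})}=-d^A\sigma$, then $\mathcal H_H$ preserves $e^{\sigma\circ\tau}\,\nu\wedge\Lambda^{\mathcal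 G}$. (ii) If $\tilde\sigma\in C^\infty(A^*)$ and $\mathcal H_H$ preserves $e^{\tilde\sigma}\,\nu\wedge\Lambda^{\mathcal G}$, then, with $\sigma=\tilde\sigma\circ 0\in C^\infty(Q)$, for every $q\in Q$ $$T\mathbb F\tilde\sigma\big((d^AV)^{\mathbf v}(0(q))\big)=\big(\flat_{\mathcal G}^{-1}(\mathcal M^{(e^\sigma\nu,\Lambda^{\mathcal G})})\big)^{\mathbf v}\big(\mathbb F\tilde\sigma(0(q))\big)\in T_{\mathbb F\tilde\sigma(0(q))}A .$$ -/

import Mathlib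

open Bundle
open scoped Manifold ContDiff

set_option linter.unusedSectionVars false

noncomputable section

namespace LieAlgebroidMech

/-! ### Forms and Lie derivatives on a manifold -/

section Forms

variable {E : Type*} [NormedAddCommGroup E] [NormedSpace ℝ E]
  {H : Type*} [TopologicalSpace H] (I : ModelWithCorners ℝ E H)
  {M : Type*} [TopologicalSpace M] [ChartedSpace H M]

/-- `X` is a smooth (`C^∞`) vector field on `M`. -/
def IsSmoothVectorField [IsManifold I 1 M] (X : ∀ x : M, TangentSpace I x) : Prop :=
  ContMDiff I I.tangent ∞ (fun x => (⟨x, X x⟩ : TangentBundle I M))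

/-- The differential at `x` of a real function, as a linear form on `T_x M`. -/
def differential (f : M → ℝ) (x : M) : Module.Dual ℝ (TangentSpace I x) :=
  (mfderiv I 𝓘(ℝ, ℝ) f x : TangentSpace I x →L[ℝ] ℝ).toLinearMap

/-- A field of alternating forms, with slots indexed by `ι` (not assumed smooth). -/
abbrev FormField (ι : Type*) : Type _ := ∀ x : M, TangentSpace I x [⋀^ι]→ₗ[ℝ] ℝ

variable {ι : Type*}

/-- `Φ` is a volume form: smooth (smooth on smooth vector fields), and nowhere zero. To be used
when the number of slots `ι` is the dimension of `M`. -/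
def IsVolumeForm [IsManifold I 1 M] (Φ : FormField I (M := M) ι) : Prop :=
  (∀ X : ι → ∀ x : M, TangentSpace I x, (∀ i, IsSmoothVectorField I (X i)) →
    ContMDiff I 𝓘(ℝ, ℝ) ∞ (fun x => Φ x (fun i => X i x))) ∧
  ∀ x, Φ x ≠ 0

/-- The value on the vector fields `X` of the Lie derivative `ℒ_Z Φ`:
`(ℒ_Z Φ)(X₁, …, X_k) = Z(Φ(X₁, …, X_k)) - ∑ᵢ Φ(X₁, …, [Z, Xᵢ], …, X_k)`. -/
def lieDerivativeForm [Fintype ι] [DecidableEq ι] (Z : ∀ x : M, TangentSpace I x)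
    (Φ : FormField I (M := M) ι) (X : ι → ∀ x : M, TangentSpace I x) (x : M) : ℝ :=
  differential I (fun y => Φ y (fun i => X i y)) x (Z x)
    - ∑ i, Φ x (Function.update (fun j => X j x) i (VectorField.mlieBracket I Z (X i) x))

/-- The vector field `Z` preserves `Φ`, that is, `ℒ_Z Φ = 0`. -/
def Preserves [IsManifold I 1 M] [Fintype ι] [DecidableEq ι] (Z : ∀ x : M, TangentSpace I x)
    (Φ : FormField I (M := M) ι) : Prop :=
  ∀ X : ι → ∀ x : M, TangentSpace I x, (∀ i, IsSmoothVectorField I (X i)) →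
    ∀ x, lieDerivativeForm I Z Φ X x = 0

/-- The function `c` is the divergence of `Z` with respect to `Φ`, that is, `ℒ_Z Φ = c Φ`. -/
def IsDivergence [IsManifold I 1 M] [Fintype ι] [DecidableEq ι] (Φ : FormField I (M := M) ι)
    (Z : ∀ x : M, TangentSpace I x) (c : M → ℝ) : Prop :=
  ∀ X : ι → ∀ x : M, TangentSpace I x, (∀ i, IsSmoothVectorField I (X i)) →
    ∀ x, lieDerivativeForm I Z Φ X x = c x * Φ x (fun i => X i x)

/-- The form `e^s Φ`. -/
def expSMul (s : M → ℝ) (Φ : FormField I (M := M) ι) : FormField I (M := M) ι :=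
  fun x => Real.exp (s x) • Φ x

end Forms

/-! ### Vertical lifts in a vector bundle -/

section Vertical

variable {m : ℕ} {Q : Type*} [TopologicalSpace Q] [ChartedSpace (EuclideanSpace ℝ (Fin m)) Q]
  (F : Type*) [NormedAddCommGroup F] [NormedSpace ℝ F]
  {W : Q → Type*} [TopologicalSpace (TotalSpace F W)] [∀ q, TopologicalSpace (W q)]
  [∀ q, AddCommGroup (W q)] [∀ q, Module ℝ (W q)] [FiberBundle F W]

/-- The vertical lift of `w ∈ W_q` to the point `a ∈ W_q`: the velocity at `t = 0` of the curve
`t ↦ a + t w`, a tangent vector at `a` to the total space of `W`. -/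
def verticalLift (a : TotalSpace F W) (w : W a.proj) :
    TangentSpace ((𝓡 m).prod 𝓘(ℝ, F)) a :=
  (mfderiv 𝓘(ℝ, ℝ) ((𝓡 m).prod 𝓘(ℝ, F))
    (fun t : ℝ => (⟨a.proj, a.2 + t • w⟩ : TotalSpace F W)) 0 : ℝ →L[ℝ] EuclideanSpace ℝ (Fin m) × F) 1

end Vertical

section Algebroid

variable {m n : ℕ} {Q : Type*} [TopologicalSpace Q] [ChartedSpace (EuclideanSpace ℝ (Fin m)) Q]

/-- The model fibre `ℝⁿ`. -/
abbrev Fib (n : ℕ) : Type := EuclideanSpace ℝ (Fin n)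

/-- The model fibre `(ℝⁿ)*` of the dual bundle. -/
abbrev DualFib (n : ℕ) : Type := Fib n →L[ℝ] ℝ

variable (n) in
/-- The total space of the dual bundle `A*`. -/
abbrev DualTotal (A : Q → Type*) [∀ q, TopologicalSpace (A q)] [∀ q, AddCommGroup (A q)]
    [∀ q, Module ℝ (A q)] : Type _ :=
  TotalSpace (DualFib n) (fun q => A q →L[ℝ] ℝ)

/-- The model with corners of the manifold `A*`. -/
abbrev dualModel (m n : ℕ) : ModelWithCorners ℝ (EuclideanSpace ℝ (Fin m) × DualFib n)
    (ModelProd (EuclideanSpace ℝ (Fin m)) (DualFib n)) :=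
  (𝓡 m).prod 𝓘(ℝ, DualFib n)

variable [IsManifold (𝓡 m) ∞ Q]
  {A : Q → Type*} [TopologicalSpace (TotalSpace (Fib n) A)]
  [∀ q, TopologicalSpace (A q)] [∀ q, AddCommGroup (A q)] [∀ q, Module ℝ (A q)]
  [∀ q, IsTopologicalAddGroup (A q)] [∀ q, ContinuousSMul ℝ (A q)]
  [FiberBundle (Fib n) A] [VectorBundle ℝ (Fib n) A]

variable (m n A) in
/-- Smooth sections of `A`. -/
abbrev Sec : Type _ := Cₛ^∞⟮𝓡 m; Fib n, A⟯

variable (m n A) in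
/-- Smooth sections of `A*`. -/
abbrev DualSec : Type _ := Cₛ^∞⟮𝓡 m; DualFib n, (fun q => A q →L[ℝ] ℝ)⟯

variable (m Q) in
/-- Smooth functions on `Q`. -/
abbrev SmoothFun : Type _ := C^∞⟮𝓡 m, Q; 𝓘(ℝ, ℝ), ℝ⟯

variable (m n A) in
/-- Smooth functions on `A*`. -/
abbrev DualSmoothFun : Type _ := C^∞⟮dualModel m n, DualTotal n A; 𝓘(ℝ, ℝ), ℝ⟯

instance (α : DualTotal n A) : FiniteDimensional ℝ (TangentSpace (dualModel m n) α) :=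
  inferInstanceAs (FiniteDimensional ℝ (EuclideanSpace ℝ (Fin m) × DualFib n))

/-! ### Lie algebroids -/

variable [ContMDiffVectorBundle ∞ (Fib n) A (𝓡 m)]

variable (m n A) in
/-- A Lie algebroid structure on the vector bundle `A → Q`: a Lie bracket on the smooth sections
and a smooth vector bundle morphism `ρ : A → TQ` satisfying `[X, fY] = f [X, Y] + ρ(X)(f) Y`. -/
structure LieAlgebroid where
  bracket : Sec m n A →ₗ[ℝ] Sec m n A →ₗ[ℝ] Sec m n A
  anchor : ∀ q, A q →L[ℝ] TangentSpace (𝓡 m) q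
  anchor_smooth : ContMDiff ((𝓡 m).prod 𝓘(ℝ, Fib n)) (𝓡 m).tangent ∞
    (fun a : TotalSpace (Fib n) A => (⟨a.proj, anchor a.proj a.2⟩ : TangentBundle (𝓡 m) Q))
  bracket_self : ∀ X, bracket X X = 0
  jacobi : ∀ X Y Z,
    bracket X (bracket Y Z) + bracket Y (bracket Z X) + bracket Z (bracket X Y) = 0
  leibniz : ∀ (X Y fY : Sec m n A) (f : SmoothFun m Q), (∀ q, fY q = f q • Y q) →
    ∀ q, bracket X fY q
      = f q • bracket X Y q + differential (𝓡 m) f q (anchor q (X q)) • Y q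

namespace LieAlgebroid

variable (L : LieAlgebroid m n A)

/-- The differential `d^A f` of a function `f` on `Q`: the section of `A*` with
`(d^A f)(X) = ρ(X)(f)`. -/
def d (f : Q → ℝ) (q : Q) : A q →L[ℝ] ℝ :=
  (mfderiv (𝓡 m) 𝓘(ℝ, ℝ) f q : TangentSpace (𝓡 m) q →L[ℝ] ℝ).comp (L.anchor q)

end LieAlgebroid

/-! ### The linear Poisson structure on `A*` and hamiltonian vector fields -/

/-- The fibrewise linear function `X̂(α) = α(X(τ(α)))` on `A*`. -/
def linearFun (X : Sec m n A) (α : DualTotal n A) : ℝ := α.2 (X α.proj)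

variable (m) in
/-- The differential of a real function on `A*`. -/
def dualDiff (φ : DualTotal n A → ℝ) (α : DualTotal n A) :
    Module.Dual ℝ (TangentSpace (dualModel m n) α) :=
  differential (dualModel m n) φ α

namespace LieAlgebroid

variable (L : LieAlgebroid m n A)

/-- The characterization of the linear Poisson `2`-vector at the point `α ∈ A*`: a skew-symmetric
bilinear form `Π` on `T*_α A*` with `Π(dX̂, dŶ) = -[X, Y]^`, `Π(d(f ∘ τ), dX̂) = ρ(X)(f) ∘ τ`
and `Π(d(f ∘ τ), d(g ∘ τ)) = 0`. Since the differentials at `α` of the functions `X̂` and `f ∘ τ`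
span `T*_α A*`, there is at most one such form. -/
structure IsLinearPoissonAt (α : DualTotal n A)
    (P : Module.Dual ℝ (TangentSpace (dualModel m n) α) →ₗ[ℝ]
      Module.Dual ℝ (TangentSpace (dualModel m n) α) →ₗ[ℝ] ℝ) : Prop where
  skew : ∀ φ ψ, P φ ψ = -P ψ φ
  linear_linear : ∀ X Y : Sec m n A,
    P (dualDiff m (linearFun X) α) (dualDiff m (linearFun Y) α) = -linearFun (L.bracket X Y) α
  basic_linear : ∀ (f : SmoothFun m Q) (X : Sec m n A),
    P (dualDiff m (fun γ => f γ.proj) α) (dualDiff m (linearFun X) α)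
      = L.d f α.proj (X α.proj)
  basic_basic : ∀ f g : SmoothFun m Q,
    P (dualDiff m (fun γ => f γ.proj) α) (dualDiff m (fun γ => g γ.proj) α) = 0

/-- The linear Poisson `2`-vector `Π_{A*}` at `α`: the unique bilinear form with the properties
of `IsLinearPoissonAt`. -/
def linearPoisson (α : DualTotal n A) :
    Module.Dual ℝ (TangentSpace (dualModel m n) α) →ₗ[ℝ]
      Module.Dual ℝ (TangentSpace (dualModel m n) α) →ₗ[ℝ] ℝ :=
  Classical.epsilon (L.IsLinearPoissonAt α)

/-- The hamiltonian vector field of `H` on `A*`: the vector field with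
`φ(ℋ_H(α)) = Π(φ, dH(α))` for every covector `φ` at `α`, so that `ℋ_H(F) = {F, H}`. -/
def hamiltonianVectorField (H : DualTotal n A → ℝ) (α : DualTotal n A) :
    TangentSpace (dualModel m n) α :=
  (Module.evalEquiv ℝ (TangentSpace (dualModel m n) α)).symm
    ((L.linearPoisson α).flip (dualDiff m H α))

end LieAlgebroid

/-! ### Volumes and modular sections -/

variable (A) in
/-- A field of elements of `Λⁿ A_q`, viewed as alternating `n`-forms on `A*_q`. -/
abbrev MultivectorField : Type _ := ∀ q, (A q →L[ℝ] ℝ) [⋀^Fin n]→ₗ[ℝ] ℝ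

variable (m) in
/-- `Λ` is a smooth nowhere vanishing section of `Λⁿ A`. -/
def IsVolumeSection (Λ : MultivectorField (n := n) A) : Prop :=
  (∀ β : Fin n → DualSec m n A, ContMDiff (𝓡 m) 𝓘(ℝ, ℝ) ∞ (fun q => Λ q (fun a => β a q))) ∧
  ∀ q, Λ q ≠ 0

variable (m) in
/-- The characterization of the value of `ν ∧ Λ` at `α ∈ A*_q`:
`(ν ∧ Λ)(Z₁, …, Z_m, β₁ᵛ, …, β_nᵛ) = ν(Tτ Z₁, …, Tτ Z_m) Λ(β₁, …, β_n)` for tangent vectors `Zᵢ`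
at `α` and `β_a ∈ A*_q`. -/
def IsWedgeAt (ν : FormField (𝓡 m) (M := Q) (Fin m)) (Λ : MultivectorField (n := n) A)
    (α : DualTotal n A) (Φ : TangentSpace (dualModel m n) α [⋀^Fin m ⊕ Fin n]→ₗ[ℝ] ℝ) : Prop :=
  ∀ (Z : Fin m → TangentSpace (dualModel m n) α) (β : Fin n → (A α.proj →L[ℝ] ℝ)),
    Φ (Sum.elim Z (fun a => verticalLift (m := m) (DualFib n) α (β a)))
      = ν α.proj (fun i => mfderiv (dualModel m n) (𝓡 m) (TotalSpace.proj : DualTotal n A → Q) α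
          (Z i)) * Λ α.proj β

/-- The vertical lift in the charts of `A*`. -/
theorem verticalLift_eq (α : DualTotal n A) (β : A α.proj →L[ℝ] ℝ) :
    verticalLift (m := m) (DualFib n) α β = ((0,
      (trivializationAt (DualFib n) (fun q => A q →L[ℝ] ℝ) α.proj).continuousLinearMapAt ℝ
        α.proj β) : EuclideanSpace ℝ (Fin m) × DualFib n) := by
  set e := trivializationAt (DualFib n) (fun q => A q →L[ℝ] ℝ) α.proj with he
  have hq : α.proj ∈ e.baseSet := mem_baseSet_trivializationAt _ _ _
  have key : ∀ γ : A α.proj →L[ℝ] ℝ, e ⟨α.proj, γ⟩ = (α.proj, e.continuousLinearMapAt ℝ α.proj γ) := by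
    intro γ
    ext1
    · exact e.coe_fst' hq
    · simp [hq]
  have hc : MDifferentiableAt 𝓘(ℝ, ℝ) (dualModel m n)
      (fun t : ℝ => (⟨α.proj, α.2 + t • β⟩ : DualTotal n A)) 0 := by
    rw [mdifferentiableAt_totalSpace]
    refine ⟨mdifferentiableAt_const, ?_⟩
    rw [mdifferentiableAt_iff_differentiableAt]
    simp only
    rw [← he]
    simp only [key, map_add, map_smul]
    fun_prop
  have hw : writtenInExtChartAt 𝓘(ℝ, ℝ) (dualModel m n) 0
      (fun t : ℝ => (⟨α.proj, α.2 + t • β⟩ : DualTotal n A)) =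
      fun t : ℝ => (extChartAt (𝓡 m) α.proj α.proj,
        e.continuousLinearMapAt ℝ α.proj α.2 + t • e.continuousLinearMapAt ℝ α.proj β) := by
    funext t
    simp only [writtenInExtChartAt, FiberBundle.extChartAt, extChartAt_model_space_eq_id, Function.comp]
    simp only [PartialEquiv.coe_trans, Function.comp, PartialEquiv.refl_symm, PartialEquiv.refl_coe, id]
    rw [← he]
    have h2 : (e.toPartialEquiv ⟨α.proj, α.snd + t • β⟩ : Q × DualFib n) = _ := key (α.2 + t • β)
    rw [h2]
    simp
  have hd : HasFDerivAt (fun t : ℝ => (extChartAt (𝓡 m) α.proj α.proj,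
        e.continuousLinearMapAt ℝ α.proj α.2 + t • e.continuousLinearMapAt ℝ α.proj β))
      ((0 : ℝ →L[ℝ] EuclideanSpace ℝ (Fin m)).prod
        (ContinuousLinearMap.toSpanSingleton ℝ (e.continuousLinearMapAt ℝ α.proj β))) (0 : ℝ) := by
    refine (hasFDerivAt_const _ _).prodMk ?_
    refine HasFDerivAt.const_add _ ?_
    exact (ContinuousLinearMap.toSpanSingleton ℝ (e.continuousLinearMapAt ℝ α.proj β)).hasFDerivAt
  unfold verticalLift
  rw [hc.mfderiv, hw]
  simp only [modelWithCornersSelf_coe, Set.range_id, extChartAt_model_space_eq_id, PartialEquiv.refl_coe, id, fderivWithin_univ]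
  erw [hd.fderiv]
  exact Prod.ext rfl (one_smul ℝ _)

/-- The tangent map of the projection `τ : A* → Q` in the charts of `A*`. -/
theorem mfderiv_proj (α : DualTotal n A) (Z : TangentSpace (dualModel m n) α) :
    mfderiv (dualModel m n) (𝓡 m) (TotalSpace.proj : DualTotal n A → Q) α Z =
      (Z : EuclideanSpace ℝ (Fin m) × DualFib n).1 := by
  have hc : MDifferentiableAt (dualModel m n) (𝓡 m) (TotalSpace.proj : DualTotal n A → Q) α :=
    mdifferentiableAt_proj _
  set p : EuclideanSpace ℝ (Fin m) × DualFib n := extChartAt (dualModel m n) α α with hp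
  have hw : writtenInExtChartAt (dualModel m n) (𝓡 m) α (TotalSpace.proj : DualTotal n A → Q)
      =ᶠ[nhds p] Prod.fst := by
    filter_upwards [extChartAt_target_mem_nhds (I := dualModel m n) α] with z hz
    have h1 : (extChartAt (dualModel m n) α) ((extChartAt (dualModel m n) α).symm z) = z :=
      (extChartAt (dualModel m n) α).right_inv hz
    have hs := (extChartAt (dualModel m n) α).map_target hz
    set w := (extChartAt (dualModel m n) α).symm z
    show extChartAt (𝓡 m) α.proj w.proj = z.1
    rw [← h1]
    simp only [FiberBundle.extChartAt, PartialEquiv.trans_source, Set.mem_inter_iff] at hs ⊢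
    exact congrArg (extChartAt (𝓡 m) α.proj) ((Trivialization.coe_fst _ hs.1).symm)
  rw [hc.mfderiv]
  simp only [dualModel, ModelWithCorners.range_eq_univ, fderivWithin_univ]
  erw [hw.fderiv_eq, fderiv_fst]
  rfl

/-- The wedge of `ν` and `Λ` at `α` exists. (It is unique since its value on a basis of `T_α A*`
adapted to the vertical subspace is prescribed.) -/
theorem exists_isWedgeAt (ν : FormField (𝓡 m) (M := Q) (Fin m)) (Λ : MultivectorField (n := n) A)
    (α : DualTotal n A) : ∃ Φ, IsWedgeAt m ν Λ α Φ := by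
  let bE : Module.Basis (Fin m) ℝ (EuclideanSpace ℝ (Fin m)) :=
    (EuclideanSpace.basisFun (Fin m) ℝ).toBasis
  let bF : Module.Basis (Fin n) ℝ (DualFib n) :=
    (Module.finBasis ℝ (DualFib n)).reindex (finCongr (by
      rw [← (LinearMap.toContinuousLinearMap (𝕜 := ℝ) (E := Fib n) (F' := ℝ)).finrank_eq]
      simp))
  set e := trivializationAt (DualFib n) (fun q => A q →L[ℝ] ℝ) α.proj with he
  have hq : α.proj ∈ e.baseSet := mem_baseSet_trivializationAt _ _ _
  let K : (A α.proj →L[ℝ] ℝ) ≃ₗ[ℝ] DualFib n := (e.continuousLinearEquivAt ℝ α.proj hq).toLinearEquiv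
  let νE : EuclideanSpace ℝ (Fin m) [⋀^Fin m]→ₗ[ℝ] ℝ := ν α.proj
  let ΛF : DualFib n [⋀^Fin n]→ₗ[ℝ] ℝ := (Λ α.proj).compLinearMap K.symm.toLinearMap
  let Φ : (EuclideanSpace ℝ (Fin m) × DualFib n) [⋀^Fin m ⊕ Fin n]→ₗ[ℝ] ℝ :=
    (νE bE * ΛF bF) • (bE.prod bF).det
  refine ⟨Φ, fun Z β => ?_⟩
  have h1 : ∀ i, mfderiv (dualModel m n) (𝓡 m) (TotalSpace.proj : DualTotal n A → Q) α (Z i) =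
      (Z i : EuclideanSpace ℝ (Fin m) × DualFib n).1 := fun i => mfderiv_proj α (Z i)
  have h2 : ∀ a, verticalLift (m := m) (DualFib n) α (β a) =
      ((0, K (β a)) : EuclideanSpace ℝ (Fin m) × DualFib n) := by
    intro a
    rw [verticalLift_eq]
    exact Prod.ext rfl (congrFun (e.coe_continuousLinearEquivAt_eq hq) (β a)).symm
  let Z' : Fin m → EuclideanSpace ℝ (Fin m) × DualFib n := Z
  have h3 : (bE.prod bF).toMatrix (Sum.elim Z' (fun a => (0, K (β a)))) =
      Matrix.fromBlocks (bE.toMatrix (fun i => (Z' i).1)) 0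
        (bF.toMatrix (fun i => (Z' i).2)) (bF.toMatrix (fun a => K (β a))) := by
    ext i j
    rcases i with i | i <;> rcases j with j | j <;>
      simp [Module.Basis.toMatrix_apply, Module.Basis.prod_repr_inl]
  have h4 : νE (fun i => (Z' i).1) = νE bE * (bE.toMatrix (fun i => (Z' i).1)).det := by
    conv_lhs => rw [νE.eq_smul_basis_det bE]
    rfl
  have h5 : Λ α.proj β = ΛF bF * (bF.toMatrix (fun a => K (β a))).det := by
    have : Λ α.proj β = ΛF (fun a => K (β a)) := by simp [ΛF]
    rw [this]
    conv_lhs => rw [ΛF.eq_smul_basis_det bF]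
    rfl
  simp only [h1, h2, h5]
  show (νE bE * ΛF bF) * ((bE.prod bF).toMatrix (Sum.elim Z' (fun a => (0, K (β a))))).det =
    νE (fun i => (Z' i).1) * _
  rw [h3, h4, Matrix.det_fromBlocks_zero₁₂]
  ring

/-- The volume form `ν ∧ Λ` on `A*`: its value at `α` is the unique alternating form with the
property of `IsWedgeAt`. -/
def wedge (ν : FormField (𝓡 m) (M := Q) (Fin m)) (Λ : MultivectorField (n := n) A) :
    FormField (dualModel m n) (M := DualTotal n A) (Fin m ⊕ Fin n) :=
  fun α => Classical.choose (exists_isWedgeAt ν Λ α)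

namespace LieAlgebroid

variable (L : LieAlgebroid m n A)

/-- `M` is the modular section of `A` with respect to `ν` and `Λ`: its vertical lift is the modular
vector field of the linear Poisson structure with respect to `ν ∧ Λ`, that is,
`Mᵛ(H)` is the divergence of the hamiltonian vector field of `H` for every `H ∈ C^∞(A*)`. -/
def IsModularSection (ν : FormField (𝓡 m) (M := Q) (Fin m)) (Λ : MultivectorField (n := n) A)
    (M : ∀ q, A q →L[ℝ] ℝ) : Prop :=
  ∀ H : DualSmoothFun m n A,
    IsDivergence (dualModel m n) (wedge ν Λ) (L.hamiltonianVectorField H)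
      (fun α => dualDiff m H α (verticalLift (DualFib n) α (M α.proj)))

/-- The modular section `ℳ^{(ν, Λ)}` of `A`: the unique section of `A*` with the property of
`IsModularSection` (for a volume form `ν` and a volume section `Λ`). -/
def modularSection (ν : FormField (𝓡 m) (M := Q) (Fin m)) (Λ : MultivectorField (n := n) A) :
    ∀ q, A q →L[ℝ] ℝ :=
  Classical.epsilon (L.IsModularSection ν Λ)

/-- `A` is unimodular: its modular class, the class of `ℳ^{(ν, Λ)}` modulo the differentials `d^A σ`
of smooth functions (which does not depend on `ν` and `Λ`), vanishes. -/
def IsUnimodular : Prop :=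
  ∃ (ν : FormField (𝓡 m) (M := Q) (Fin m)) (Λ : MultivectorField (n := n) A),
    IsVolumeForm (𝓡 m) ν ∧ IsVolumeSection m Λ ∧
      ∃ σ : SmoothFun m Q, L.modularSection ν Λ = fun q => -L.d σ q

end LieAlgebroid

/-! ### Bundle metrics and mechanical hamiltonians -/

variable (m n A) in
/-- Bundle metrics on `A`. -/
abbrev BundleMetric : Type _ := ContMDiffRiemannianMetric (𝓡 m) ∞ (Fib n) A

namespace BundleMetric

variable (𝒢 : BundleMetric m n A)

/-- The isomorphism `♭⁻¹ : A*_q → A_q`, inverse of `♭(a) = 𝒢(a, ·)`. -/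
def sharp (q : Q) : (A q →L[ℝ] ℝ) →L[ℝ] A q := (𝒢.inner q).inverse

/-- The metric induced on `A*`. -/
def dualInner (q : Q) (α β : A q →L[ℝ] ℝ) : ℝ := 𝒢.inner q (sharp 𝒢 q α) (sharp 𝒢 q β)

/-- The mechanical hamiltonian `H(α) = ½ 𝒢(α, α) + V(τ(α))` on `A*`. -/
def hamiltonian (V : Q → ℝ) (α : DualTotal n A) : ℝ :=
  1 / 2 * dualInner 𝒢 α.proj α.2 α.2 + V α.proj

/-- `ε` is an orthonormal basis of `A*_q`. -/
def IsOrthonormalCoframe (q : Q) (ε : Fin n → (A q →L[ℝ] ℝ)) : Prop :=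
  ∀ a b, dualInner 𝒢 q (ε a) (ε b) = if a = b then 1 else 0

/-- The volume `Λ^𝒢` induced by the metric and by the orientation of `A` given by the nowhere
vanishing section `Λ₀` of `Λⁿ A` (a basis of `A*_q` being positive when `Λ₀` is positive on it):
the positive multiple of `Λ₀` that takes the value `1` on the positive orthonormal bases
(all orthonormal bases give the same `|Λ₀(ε)|`). -/
def volume (Λ₀ : MultivectorField (n := n) A) : MultivectorField (n := n) A :=
  fun q => |Λ₀ q (Classical.epsilon (IsOrthonormalCoframe 𝒢 q))|⁻¹ • Λ₀ q

end BundleMetric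

/-! ### The vertical derivative -/

/-- The vertical derivative `𝔽s : A* → A` of a function `s` on `A*`: `𝔽s(α)` is the unique element
of `A_q` with `β(𝔽s(α)) = d/dt|₀ s(α + tβ)` for all `β ∈ A*_q`, where `α ∈ A*_q`. -/
def fiberDeriv (s : DualTotal n A → ℝ) (α : DualTotal n A) : TotalSpace (Fib n) A :=
  ⟨α.proj, Classical.epsilon fun a : A α.proj =>
    ∀ β : A α.proj →L[ℝ] ℝ, β a = deriv (fun t : ℝ => s ⟨α.proj, α.2 + t • β⟩) 0⟩

variable (n A) in
/-- The zero section of `A*`. -/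
def zeroSection (q : Q) : DualTotal n A := ⟨q, 0⟩

end Algebroid
end LieAlgebroidMech
end

open LieAlgebroidMech

open Bundle
open scoped Manifold ContDiff Topology

set_option linter.unusedSectionVars false

noncomputable section

namespace LieAlgebroidMech

/-! ### Differentials, Lie brackets and Lie derivatives of top-degree forms in coordinates -/

section Calculus
variable {E : Type*} [NormedAddCommGroup E] [NormedSpace ℝ E] [FiniteDimensional ℝ E]
  {H : Type*} [TopologicalSpace H] {I : ModelWithCorners ℝ E H} [I.Boundaryless]
  {M : Type*} [TopologicalSpace M] [ChartedSpace H M] [IsManifold I ∞ M]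

/-! Near a point of A*, the base coordinates and the momenta X̂_a of a frame of A form coordinates
y_k. Write π_kl = {y_k, y_l} and ∂_k for the dual vector fields. Then ν ∧ Λ = (v∘τ) dy_1 ∧ … ∧ dy_N
for a function v on Q, and the divergence of ℋ_H is ℋ_H(v∘τ)/v plus the trace Σ_k ∂_k(Σ_l π_kl ∂_l
H). In the trace the second derivatives of H cancel, being a symmetric array contracted with a skew
one. The sums Σ_k ∂_k π_kl vanish when y_l is a base coordinate and depend only on the base point
when y_l is a momentum. Moreover ℋ_H(v∘τ) is the derivative of H along the vertical lift of d^A v.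
Hence the divergence is M^v(H) with M independent of H, which gives the modular section
(`lieDerivativeForm_hamiltonianVectorField`, `isModularSection_modularSection`). It follows that e^s
ν∧Λ is preserved if and only if {s,H} + M^v(H) = 0 (`preserves_expSMul_iff`).

For s = σ∘τ this expression is (d^A σ + M)^v(H), which is zero when M = -d^A σ. Another choice of
(ν, Λ) multiplies ν∧Λ by a nowhere zero basic function h and adds d^A log|h| to M
(`exists_modularSection_eq_add_d`), so unimodularity tested on any pair applies to the given one.
This is (i).

For (ii), evaluate the condition at tβ, where β ∈ A*_q. As H is quadratic in the momenta up to V,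
every term other than the derivative of s along (d^A V)^v has a factor t. So that derivative equals
t g(t), with g continuous at 0. Along the zero section, the hamiltonian vector field of X̂ is the
image of ρ(X) under T0 (`hamiltonianVectorField_linearFun_zeroSection`), whence g(0) = (M + d^A
σ)(♯β) with σ = s∘0. Differentiating at t = 0 computes the fibre Hessian of s at 0(q) on (β, d^A V)
(`hasDerivAt_dualDiff_verticalLift_d`). By symmetry of the Hessian this is also β applied to the
derivative of 𝔽s in the direction d^A V (`mfderiv_fiberDeriv_verticalLift`). Finally ♯ is symmetric
and M + d^A σ is the modular section of (e^σ ν, Λ) (`modularSection_expSMul`).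

The Poisson tensor, the modular section, 𝔽s and the coframe inside Λ^𝒢 are chosen by
`Classical.epsilon`, so the existence of each is part of the proof, as is the smoothness of what is
built from them. -/

theorem differential_congr {f g : M → ℝ} {x : M} (h : f =ᶠ[𝓝 x] g) :
    differential I f x = differential I g x := by
  unfold differential
  rw [h.mfderiv_eq]

theorem differential_const (c : ℝ) (x : M) : differential I (fun _ : M => c) x = 0 := by
  unfold differential
  rw [mfderiv_const]; rfl

theorem differential_add {f g : M → ℝ} {x : M} (hf : MDifferentiableAt I 𝓘(ℝ, ℝ) f x)
    (hg : MDifferentiableAt I 𝓘(ℝ, ℝ) g x) :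
    differential I (fun y => f y + g y) x = differential I f x + differential I g x := by
  ext v
  have := mfderiv_add hf hg
  exact congrArg (fun L => L v) this

theorem differential_mul {f g : M → ℝ} {x : M} (hf : MDifferentiableAt I 𝓘(ℝ, ℝ) f x)
    (hg : MDifferentiableAt I 𝓘(ℝ, ℝ) g x) :
    differential I (fun y => f y * g y) x = f x • differential I g x + g x • differential I f x := by
  ext v
  have := (hf.hasMFDerivAt.mul hg.hasMFDerivAt).mfderiv
  exact congrArg (fun L => L v) this

theorem differential_comp_real {f : M → ℝ} {x : M} {h : ℝ → ℝ} {h' : ℝ}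
    (hh : HasDerivAt h h' (f x)) (hf : MDifferentiableAt I 𝓘(ℝ, ℝ) f x) :
    differential I (fun y => h (f y)) x = h' • differential I f x := by
  ext v
  have := (hh.hasFDerivAt.hasMFDerivAt.comp x hf.hasMFDerivAt).mfderiv
  refine (congrArg (fun L => L v) this).trans ?_
  show (show ℝ from mfderiv I 𝓘(ℝ, ℝ) f x v) * h' = _
  exact mul_comm _ _

/-- Read in the chart at x₀, both iterated derivatives expand by the product rule. The second
derivative of y contributes symmetrically and drops out, leaving dy on the bracket of the local
representatives. -/
theorem differential_mlieBracket {V W : ∀ x : M, TangentSpace I x} {y : M → ℝ} {x₀ : M}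
    (hV : MDifferentiableAt I I.tangent (fun x => (⟨x, V x⟩ : TangentBundle I M)) x₀)
    (hW : MDifferentiableAt I I.tangent (fun x => (⟨x, W x⟩ : TangentBundle I M)) x₀)
    (hy : ContMDiffAt I 𝓘(ℝ, ℝ) 2 y x₀) :
    differential I y x₀ (VectorField.mlieBracket I V W x₀) =
      differential I (fun x => differential I y x (W x)) x₀ (V x₀) -
      differential I (fun x => differential I y x (V x)) x₀ (W x₀) := by
  set φ := extChartAt I x₀ with hφ
  set yh : E → ℝ := y ∘ φ.symm with hyh
  -- The local representative of a vector field in the chart at x₀; `mlieBracket` is defined through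
  -- the same pullback.
  set hat : (∀ x : M, TangentSpace I x) → E → E := fun U z =>
    VectorField.mpullbackWithin 𝓘(ℝ, E) I φ.symm U (Set.range I) z with hhat
  have hz0 : φ x₀ ∈ φ.target := mem_extChartAt_target x₀
  have hdiff : ∀ U : ∀ x : M, TangentSpace I x,
      MDifferentiableAt I I.tangent (fun x => (⟨x, U x⟩ : TangentBundle I M)) x₀ →
      DifferentiableAt ℝ (hat U) (φ x₀) := by
    intro U hU
    have := MDifferentiableWithinAt.differentiableWithinAt_mpullbackWithin_vectorField
      hU.mdifferentiableWithinAt (s := Set.univ)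
    rw [← differentiableWithinAt_univ]
    rw [Set.preimage_univ, Set.univ_inter, I.range_eq_univ] at this
    simp only [hhat, I.range_eq_univ]
    exact this
  have hyC : ContDiffAt ℝ 2 yh (φ x₀) := by
    have := (contMDiffAt_iff.1 hy).2
    rw [I.range_eq_univ, contDiffWithinAt_univ] at this
    exact this
  have key : ∀ (U : ∀ x : M, TangentSpace I x), ∀ᶠ x in 𝓝 x₀,
      differential I y x (U x) = fderiv ℝ yh (φ x) (hat U (φ x)) := by
    intro U
    have h2 : ∀ᶠ x in 𝓝 x₀, ContMDiffAt I 𝓘(ℝ, ℝ) 2 y x :=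
      haveI : IsManifold I 2 M := IsManifold.of_le (n := ∞) (by exact WithTop.coe_le_coe.2 le_top)
      (contMDiffAt_iff_contMDiffAt_nhds (by simp)).1 hy
    filter_upwards [h2, extChartAt_source_mem_nhds (I := I) x₀] with x hx hxs
    have hxt : φ x ∈ φ.target := φ.map_source hxs
    have hl : φ.symm (φ x) = x := φ.left_inv hxs
    have hI := isInvertible_mfderivWithin_extChartAt_symm hxt
    have hmy : MDifferentiableAt I 𝓘(ℝ, ℝ) y (φ.symm (φ x)) := by
      rw [hl]; exact hx.mdifferentiableAt two_ne_zero
    have hms : MDifferentiableWithinAt 𝓘(ℝ, E) I φ.symm (Set.range I) (φ x) :=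
      mdifferentiableWithinAt_extChartAt_symm hxt
    have hc := mfderivWithin_comp (I := 𝓘(ℝ, E)) (φ x) hmy.mdifferentiableWithinAt hms
      (Set.subset_univ _) (by rw [I.range_eq_univ]; exact uniqueMDiffWithinAt_univ _) (s := Set.range I) (u := Set.univ)
    rw [mfderivWithin_univ] at hc
    have hf : fderiv ℝ yh (φ x) = mfderivWithin 𝓘(ℝ, E) 𝓘(ℝ, ℝ) (y ∘ φ.symm) (Set.range I) (φ x) := by
      rw [I.range_eq_univ, mfderivWithin_univ, mfderiv_eq_fderiv]
    rw [hf, hc]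
    simp only [hhat, VectorField.mpullbackWithin_apply]
    show _ = (mfderiv I 𝓘(ℝ, ℝ) y (φ.symm (φ x))) (mfderivWithin 𝓘(ℝ, E) I φ.symm (Set.range I) (φ x) _)
    rw [hI.self_apply_inverse, hl]
    rfl
  have hinv : ∀ U : ∀ x : M, TangentSpace I x, mfderiv I 𝓘(ℝ, E) φ x₀ (U x₀) = hat U (φ x₀) := by
    intro U
    rw [hφ, mfderiv_extChartAt_self]
    simp only [hhat, VectorField.mpullbackWithin_apply]
    have hl : φ.symm (φ x₀) = x₀ := φ.left_inv (mem_extChartAt_source x₀)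
    have h1 := mfderivWithin_extChartAt_symm_inverse_apply (I := I) (x := x₀) (U (φ.symm (φ x₀)))
    refine Eq.trans ?_ h1.symm
    show (U x₀ : E) = U (φ.symm (φ x₀))
    rw [hl]
  have hfd : DifferentiableAt ℝ (fderiv ℝ yh) (φ x₀) :=
    (hyC.fderiv_right (m := 1) le_rfl).differentiableAt one_ne_zero
  have key2 : ∀ U V : ∀ x : M, TangentSpace I x,
      MDifferentiableAt I I.tangent (fun x => (⟨x, U x⟩ : TangentBundle I M)) x₀ →
      differential I (fun x => differential I y x (U x)) x₀ (V x₀) =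
        fderiv ℝ (fun z => fderiv ℝ yh z (hat U z)) (φ x₀) (hat V (φ x₀)) := by
    intro U V hU
    rw [differential_congr (key U)]
    have hd : DifferentiableAt ℝ (fun z => fderiv ℝ yh z (hat U z)) (φ x₀) :=
      DifferentiableAt.clm_apply hfd (hdiff U hU)
    have := hd.hasFDerivAt.hasMFDerivAt.comp x₀
      (mdifferentiableAt_extChartAt (mem_chart_source H x₀)).hasMFDerivAt
    rw [← hinv V]
    unfold differential
    exact congrArg (fun L => L (V x₀)) this.mfderiv
  have hsymm := hyC.isSymmSndFDerivAt (by simp)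
  rw [key2 _ _ hV, key2 _ _ hW]
  have e1 : differential I y x₀ (VectorField.mlieBracket I V W x₀) =
      fderiv ℝ yh (φ x₀) (VectorField.lieBracket ℝ (hat V) (hat W) (φ x₀)) := by
    have hl : φ.symm (φ x₀) = x₀ := φ.left_inv (mem_extChartAt_source x₀)
    have hb : ∀ w : E, (mfderiv I 𝓘(ℝ, E) φ x₀).inverse w = w := fun w => by
      refine ((isInvertible_mfderiv_extChartAt (mem_extChartAt_source x₀)).inverse_apply_eq).2 ?_
      rw [mfderiv_extChartAt_self]
      rfl
    rw [← VectorField.mlieBracketWithin_univ, VectorField.mlieBracketWithin_apply]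
    have hlb : VectorField.lieBracketWithin ℝ (hat V) (hat W)
        (φ.symm ⁻¹' Set.univ ∩ Set.range I) (φ x₀) =
        VectorField.lieBracket ℝ (hat V) (hat W) (φ x₀) := by
      rw [I.range_eq_univ, Set.preimage_univ, Set.inter_univ, VectorField.lieBracketWithin_univ]
    refine (congrArg (differential I y x₀) (hb _)).trans
      ((congrArg (fun w : E => (differential I y x₀ w)) hlb).trans ?_)
    unfold differential
    rw [(hy.mdifferentiableAt two_ne_zero).mfderiv, I.range_eq_univ, fderivWithin_univ]
    rfl
  rw [e1, VectorField.lieBracket_eq]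
  rw [fderiv_clm_apply hfd (hdiff _ hV), fderiv_clm_apply hfd (hdiff _ hW)]
  simp only [map_sub, add_apply, ContinuousLinearMap.comp_apply,
    ContinuousLinearMap.flip_apply]
  rw [hsymm.eq]
  ring


theorem contMDiff_differential_apply {y : M → ℝ} {X : ∀ x : M, TangentSpace I x}
    (hy : ContMDiff I 𝓘(ℝ, ℝ) ∞ y) (hX : IsSmoothVectorField I X) :
    ContMDiff I 𝓘(ℝ, ℝ) ∞ (fun x => differential I y x (X x)) := by
  have h1 : ContMDiff I.tangent 𝓘(ℝ, ℝ).tangent ∞ (tangentMap I 𝓘(ℝ, ℝ) y) :=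
    hy.contMDiff_tangentMap le_rfl
  have h2 := h1.comp hX
  have h3 := (contMDiff_snd_tangentBundle_modelSpace ℝ 𝓘(ℝ, ℝ) (n := ∞)).comp h2
  exact h3

/-- In this form the derivative of a determinant, row by row, is the general formula for continuous
multilinear maps. -/
def detRows (ι : Type*) [Fintype ι] [DecidableEq ι] :
    ContinuousMultilinearMap ℝ (fun _ : ι => ι → ℝ) ℝ :=
  ⟨(Matrix.detRowAlternating (R := ℝ) (n := ι)).toMultilinearMap,
    (Continuous.matrix_det continuous_id)⟩

/-- By Cramer's rule the j-th summand is the j-th diagonal entry of A B adj(A); then use the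
cyclicity of the trace and adj(A) A = det A. This is where a divergence appears as a trace. -/
theorem sum_det_updateRow_mul {ι : Type*} [Fintype ι] [DecidableEq ι] (A B : Matrix ι ι ℝ) :
    ∑ j, (A.updateRow j ((A * B) j)).det = B.trace * A.det := by
  simp only [← Matrix.cramer_transpose_apply]
  have : ∀ j, Matrix.cramer A.transpose ((A * B) j) j = (A * B * A.adjugate) j j := by
    intro j
    rw [Matrix.cramer_eq_adjugate_mulVec, ← Matrix.adjugate_transpose]
    simp [Matrix.mul_apply, Matrix.mulVec, dotProduct, mul_comm]
  simp only [this]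
  show Matrix.trace _ = _
  rw [Matrix.trace_mul_comm, ← Matrix.mul_assoc, Matrix.adjugate_mul]
  simp [mul_comm]

variable {ι : Type*} [Fintype ι] [DecidableEq ι]

theorem differential_det {A : M → ι → ι → ℝ} {x : M}
    (hA : ∀ j k, ContMDiffAt I 𝓘(ℝ, ℝ) 1 (fun x => A x j k) x) :
    MDifferentiableAt I 𝓘(ℝ, ℝ) (fun x => (Matrix.of (A x)).det) x ∧
    ∀ v : TangentSpace I x, differential I (fun x => (Matrix.of (A x)).det) x v =
      ∑ j, ((Matrix.of (A x)).updateRow j (fun k => differential I (fun x => A x j k) x v)).det := by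
  have hA' : MDifferentiableAt I 𝓘(ℝ, ι → ι → ℝ) A x :=
    (contMDiffAt_pi_space.2 fun j => contMDiffAt_pi_space.2 fun k => hA j k).mdifferentiableAt
      one_ne_zero
  have h := ((detRows ι).hasFDerivAt (A x)).hasMFDerivAt.comp x hA'.hasMFDerivAt
  refine ⟨h.mdifferentiableAt, fun v => ?_⟩
  unfold differential
  refine (congrArg (fun L => L v) h.mfderiv).trans ?_
  refine ((detRows ι).linearDeriv_apply _ _).trans ?_
  refine Finset.sum_congr rfl fun j _ => ?_
  show Matrix.det (Function.update (A x) j ((mfderiv I 𝓘(ℝ, ι → ι → ℝ) A x v : ι → ι → ℝ) j)) = _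
  have : (mfderiv I 𝓘(ℝ, ι → ι → ℝ) A x v : ι → ι → ℝ) j =
      (fun k => (mfderiv I 𝓘(ℝ, ℝ) (fun x => A x j k) x v : ℝ)) := by
    funext k
    let p : (ι → ι → ℝ) →L[ℝ] ℝ :=
      (ContinuousLinearMap.proj k).comp (ContinuousLinearMap.proj (R := ℝ) (φ := fun _ : ι => ι → ℝ) j)
    have h2 := (p.hasFDerivAt (x := A x)).hasMFDerivAt.comp x hA'.hasMFDerivAt
    exact (congrArg (fun L => L v) h2.mfderiv).symm
  rw [this]
  rfl

theorem det_updateRow_sub {A : Matrix ι ι ℝ} (j : ι) (u w : ι → ℝ) :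
    (A.updateRow j (u - w)).det = (A.updateRow j u).det - (A.updateRow j w).det :=
  (Matrix.detRowAlternating (R := ℝ) (n := ι)).map_update_sub A j u w

/-- The Lie derivative of a form of top degree, in terms of functions `y` in which the form is
`g dy₁ ∧ ⋯ ∧ dy_N`. -/
theorem lieDerivativeForm_eq_of_coordinates {Z : ∀ x : M, TangentSpace I x}
    {Φ : FormField I (M := M) ι}
    {X : ι → ∀ x : M, TangentSpace I x} {x₀ : M} {y : ι → M → ℝ} {g : M → ℝ} {B : Matrix ι ι ℝ}
    (hΦ : ∀ᶠ x in 𝓝 x₀, ∀ v : ι → TangentSpace I x,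
      Φ x v = g x * (Matrix.of fun j k => differential I (y k) x (v j)).det)
    (hy : ∀ k, ContMDiff I 𝓘(ℝ, ℝ) ∞ (y k))
    (hZ : IsSmoothVectorField I Z) (hX : ∀ j, IsSmoothVectorField I (X j))
    (hg : MDifferentiableAt I 𝓘(ℝ, ℝ) g x₀)
    (hB : ∀ k, differential I (fun x => differential I (y k) x (Z x)) x₀ =
      ∑ l, B l k • differential I (y l) x₀) :
    lieDerivativeForm I Z Φ X x₀ = (differential I g x₀ (Z x₀) + g x₀ * B.trace) *
      (Matrix.of fun j k => differential I (y k) x₀ (X j x₀)).det := by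
  set A : M → ι → ι → ℝ := fun x j k => differential I (y k) x (X j x) with hA
  have hAs : ∀ j k, ContMDiffAt I 𝓘(ℝ, ℝ) 1 (fun x => A x j k) x₀ := fun j k =>
    ((contMDiff_differential_apply (hy k) (hX j)).of_le (by exact WithTop.coe_le_coe.2 le_top)) x₀
  obtain ⟨hd1, hd2⟩ := differential_det hAs
  have h1 : differential I (fun x => Φ x (fun i => X i x)) x₀ (Z x₀) =
      differential I g x₀ (Z x₀) * (Matrix.of (A x₀)).det +
      g x₀ * ∑ j, ((Matrix.of (A x₀)).updateRow j
        (fun k => differential I (fun x => A x j k) x₀ (Z x₀))).det := by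
    have : (fun x => Φ x (fun i => X i x)) =ᶠ[𝓝 x₀] fun x => g x * (Matrix.of (A x)).det := by
      filter_upwards [hΦ] with x hx
      exact hx _
    rw [differential_congr this, differential_mul hg hd1, ← hd2]
    simp only [LinearMap.add_apply, LinearMap.smul_apply, smul_eq_mul]
    ring
  have h2 : ∀ j, Φ x₀ (Function.update (fun j => X j x₀) j (VectorField.mlieBracket I Z (X j) x₀)) =
      g x₀ * (((Matrix.of (A x₀)).updateRow j
        (fun k => differential I (fun x => A x j k) x₀ (Z x₀))).det -
        ((Matrix.of (A x₀)).updateRow j ((Matrix.of (A x₀) * B) j)).det) := by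
    intro j
    rw [hΦ.self_of_nhds, ← det_updateRow_sub]
    congr 2
    ext i k
    by_cases hij : i = j
    · subst hij
      simp only [Matrix.of_apply, Function.update_self, Matrix.updateRow_self, Pi.sub_apply]
      -- The entry [Z, X_j] y_k is Z(X_j y_k) - X_j(Z y_k), and `hB` turns the second term into (A
      -- B)_jk.
      rw [differential_mlieBracket ((hZ x₀).mdifferentiableAt (by simp))
        ((hX i x₀).mdifferentiableAt (by simp))
        ((hy k x₀).of_le (by exact WithTop.coe_le_coe.2 le_top)), hB k]
      congr 1
      simp [Matrix.mul_apply, hA, LinearMap.sum_apply, mul_comm]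
    · simp [Function.update_of_ne hij, Matrix.updateRow_ne hij, hA]
  unfold lieDerivativeForm
  rw [h1]
  simp only [h2]
  rw [← Finset.mul_sum, Finset.sum_sub_distrib, sum_det_updateRow_mul]
  show _ = _ * (Matrix.of (A x₀)).det
  ring
end Calculus

/-! ### Expansions in a basis given with its dual basis -/

section LinearAlgebra

variable {W : Type*} [AddCommGroup W] [Module ℝ W] {ι : Type*} [Fintype ι] [DecidableEq ι]

theorem eq_sum_smul_of_dual {φ : ι → Module.Dual ℝ W} {d : ι → W} [FiniteDimensional ℝ W]
    (hcard : Module.finrank ℝ W = Fintype.card ι)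
    (h : ∀ k l, φ k (d l) = if k = l then 1 else 0) (v : W) : v = ∑ k, φ k v • d k := by
  have hli : LinearIndependent ℝ d := by
    rw [Fintype.linearIndependent_iff]
    intro c hc k
    have := congrArg (φ k) hc
    simpa [h] using this
  obtain ⟨c, hc⟩ : ∃ c : ι → ℝ, ∑ k, c k • d k = v := by
    have := hli.span_eq_top_of_card_eq_finrank' hcard.symm
    have hv : v ∈ Submodule.span ℝ (Set.range d) := this ▸ Submodule.mem_top
    exact (Submodule.mem_span_range_iff_exists_fun ℝ).1 hv
  have : ∀ k, φ k v = c k := by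
    intro k
    rw [← hc]
    simp [h]
  simp only [this, hc]

theorem dual_eq_sum_smul_of_dual {φ : ι → Module.Dual ℝ W} {d : ι → W} [FiniteDimensional ℝ W]
    (hcard : Module.finrank ℝ W = Fintype.card ι)
    (h : ∀ k l, φ k (d l) = if k = l then 1 else 0) (ψ : Module.Dual ℝ W) :
    ψ = ∑ k, ψ (d k) • φ k := by
  ext v
  conv_lhs => rw [eq_sum_smul_of_dual hcard h v]
  simp [mul_comm]

/-- An alternating form of top degree, in terms of a basis of linear forms. -/
theorem alternatingMap_eq_mul_det {φ : ι → Module.Dual ℝ W} {d : ι → W} [FiniteDimensional ℝ W]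
    (hcard : Module.finrank ℝ W = Fintype.card ι)
    (h : ∀ k l, φ k (d l) = if k = l then 1 else 0) (Φ : W [⋀^ι]→ₗ[ℝ] ℝ) (v : ι → W) :
    Φ v = Φ d * (Matrix.of fun j k => φ k (v j)).det := by
  have hli : LinearIndependent ℝ d := by
    rw [Fintype.linearIndependent_iff]
    intro c hc k
    have := congrArg (φ k) hc
    simpa [h] using this
  let b : Module.Basis ι ℝ W := basisOfLinearIndependentOfCardEqFinrank' d hli hcard.symm
  have hb : ⇑b = d := by simp [b]
  have hr : ∀ w k, b.repr w k = φ k w := by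
    intro w k
    have := eq_sum_smul_of_dual hcard h w
    have h2 : ∀ l, b.repr (d l) k = if l = k then 1 else 0 := fun l => by
      rw [← congrFun hb l, b.repr_self, Finsupp.single_apply]
    conv_lhs => rw [this]
    simp [h2]
  conv_lhs => rw [Φ.eq_smul_basis_det b]
  rw [AlternatingMap.smul_apply, smul_eq_mul, Module.Basis.det_apply, hb, ← Matrix.det_transpose]
  congr 2
  ext j k
  simp [Module.Basis.toMatrix_apply, hr]

end LinearAlgebra

/-! ### Cut-off of local objects and coordinate vector fields -/

section Calculus
variable {E : Type*} [NormedAddCommGroup E] [NormedSpace ℝ E] [FiniteDimensional ℝ E]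
  {H : Type*} [TopologicalSpace H] {I : ModelWithCorners ℝ E H} [I.Boundaryless]
  {M : Type*} [TopologicalSpace M] [ChartedSpace H M] [IsManifold I ∞ M]
  {ι : Type*} [Fintype ι] [DecidableEq ι]

instance (x : M) : FiniteDimensional ℝ (TangentSpace I x) :=
  inferInstanceAs (FiniteDimensional ℝ E)

theorem lieDerivativeForm_smul {Z : ∀ x : M, TangentSpace I x} {Φ : FormField I (M := M) ι}
    {X : ι → ∀ x : M, TangentSpace I x} {x : M} {h : M → ℝ}
    (hh : MDifferentiableAt I 𝓘(ℝ, ℝ) h x)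
    (hΦ : MDifferentiableAt I 𝓘(ℝ, ℝ) (fun y => Φ y (fun i => X i y)) x) :
    lieDerivativeForm I Z (fun y => h y • Φ y) X x =
      differential I h x (Z x) * Φ x (fun i => X i x) + h x * lieDerivativeForm I Z Φ X x := by
  unfold lieDerivativeForm
  have := differential_mul hh hΦ
  simp only [AlternatingMap.smul_apply, smul_eq_mul]
  rw [this, ← Finset.mul_sum]
  simp only [LinearMap.add_apply, LinearMap.smul_apply, smul_eq_mul]
  ring

/-- Multiplication by a bump function equal to 1 near x₀. Algebroid brackets and Lie derivatives of
forms are formulated with globally defined sections and fields, so local frames must be extended. -/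
theorem exists_contMDiff_section_eventuallyEq [T2Space M] {F : Type*} [NormedAddCommGroup F]
    [NormedSpace ℝ F] {V : M → Type*} [TopologicalSpace (TotalSpace F V)]
    [∀ x, TopologicalSpace (V x)] [∀ x, AddCommGroup (V x)] [∀ x, Module ℝ (V x)]
    [FiberBundle F V] [VectorBundle ℝ F V] {s : ∀ x, V x} {u : Set M} {x₀ : M} (hu : IsOpen u)
    (hx : x₀ ∈ u)
    (hs : ContMDiffOn I (I.prod 𝓘(ℝ, F)) ∞ (fun x => TotalSpace.mk' F x (s x)) u) :
    ∃ s' : ∀ x, V x, ContMDiff I (I.prod 𝓘(ℝ, F)) ∞ (fun x => TotalSpace.mk' F x (s' x)) ∧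
      ∀ᶠ x in 𝓝 x₀, s' x = s x := by
  obtain ⟨f, -, hf⟩ := (SmoothBumpFunction.nhds_basis_tsupport (I := I) x₀).mem_iff.1
    (hu.mem_nhds hx)
  refine ⟨(f : M → ℝ) • s, ContMDiffOn.smul_section_of_tsupport f.contMDiff.contMDiffOn hu hf hs, ?_⟩
  filter_upwards [f.eventuallyEq_one] with x hx
  simp [hx]

theorem exists_contMDiff_eventuallyEq [T2Space M] {G : Type*} [NormedAddCommGroup G]
    [NormedSpace ℝ G] {s : M → G} {u : Set M} {x₀ : M} (hu : IsOpen u) (hx : x₀ ∈ u)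
    (hs : ContMDiffOn I 𝓘(ℝ, G) ∞ s u) :
    ∃ s' : M → G, ContMDiff I 𝓘(ℝ, G) ∞ s' ∧ s' =ᶠ[𝓝 x₀] s := by
  obtain ⟨f, -, hf⟩ := (SmoothBumpFunction.nhds_basis_tsupport (I := I) x₀).mem_iff.1
    (hu.mem_nhds hx)
  refine ⟨fun x => f x • s x, contMDiff_of_tsupport fun x hx => ?_, ?_⟩
  · have : x ∈ u := hf (tsupport_smul_subset_left _ _ hx)
    exact f.contMDiffAt.smul ((hs x this).contMDiffAt (hu.mem_nhds this))
  · filter_upwards [f.eventuallyEq_one] with x hx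
    simp [hx]

/-- The trivialization of TM at x₀ is the derivative of the chart at x₀, so the local frame that it
makes out of b is dual to the differentials of the chart coordinates, on a whole neighbourhood. -/
theorem exists_dual_frame [T2Space M] (b : Module.Basis ι ℝ E) {y : ι → M → ℝ} {x₀ : M}
    (hy : ∀ k, y k =ᶠ[𝓝 x₀] fun x => b.coord k (extChartAt I x₀ x)) :
    ∃ D : ι → ∀ x : M, TangentSpace I x, (∀ k, IsSmoothVectorField I (D k)) ∧
      ∀ᶠ x in 𝓝 x₀, ∀ k l, differential I (y k) x (D l x) = if k = l then 1 else 0 := by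
  set e := trivializationAt E (TangentSpace I : M → Type _) x₀ with he
  have h0 : x₀ ∈ e.baseSet := mem_baseSet_trivializationAt E _ x₀
  have h1 : ∀ l, ∃ s' : ∀ x : M, TangentSpace I x, IsSmoothVectorField I s' ∧
      ∀ᶠ x in 𝓝 x₀, s' x = e.localFrame b l x := fun l =>
    exists_contMDiff_section_eventuallyEq e.open_baseSet h0
      (e.contMDiffOn_localFrame_baseSet (I := I) ∞ b l)
  choose D hD hDe using h1
  refine ⟨D, hD, ?_⟩
  have h2 : ∀ᶠ x in 𝓝 x₀, ∀ l, D l x = e.localFrame b l x := Filter.eventually_all.2 hDe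
  have h3 : ∀ᶠ x in 𝓝 x₀, ∀ k, y k =ᶠ[𝓝 x] fun x => b.coord k (extChartAt I x₀ x) :=
    Filter.eventually_all.2 fun k => (hy k).eventuallyEq_nhds
  filter_upwards [h2, h3, e.open_baseSet.mem_nhds h0,
    (chartAt H x₀).open_source.mem_nhds (mem_chart_source H x₀)] with x hx2 hx3 hxb hxs k l
  rw [hx2, e.localFrame_apply_of_mem_baseSet b hxb, differential_congr (hx3 k)]
  have hm := (b.coord k).toContinuousLinearMap.hasFDerivAt (x := extChartAt I x₀ x)
  have hm2 := hm.hasMFDerivAt.comp x (mdifferentiableAt_extChartAt hxs).hasMFDerivAt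
  unfold differential
  change (mfderiv I 𝓘(ℝ, ℝ) ((b.coord k).toContinuousLinearMap ∘ extChartAt I x₀) x)
    (e.basisAt b hxb l) = _
  rw [hm2.mfderiv, ← TangentBundle.continuousLinearMapAt_trivializationAt hxs]
  show b.coord k (e.continuousLinearMapAt ℝ x (e.basisAt b hxb l)) = _
  have : e.continuousLinearMapAt ℝ x (e.basisAt b hxb l) = b l := by
    simp [Bundle.Trivialization.basisAt, hxb]
  rw [this]
  simp [Finsupp.single_apply, eq_comm]

end Calculus

/-! ### Curves in a fibre and vertical lifts -/

section FiberCurves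

/-- Bump functions on A* need a Hausdorff total space. Points over different base points are
separated in the base, points of one fibre in a trivialization. -/
theorem t2Space_totalSpace {B F : Type*} [TopologicalSpace B] [T2Space B] [TopologicalSpace F]
    [T2Space F] {W : B → Type*} [TopologicalSpace (TotalSpace F W)] [∀ b, TopologicalSpace (W b)]
    [FiberBundle F W] : T2Space (TotalSpace F W) := by
  refine ⟨fun x y hxy => ?_⟩
  by_cases hp : x.proj = y.proj
  · set e := trivializationAt F W x.proj
    have hx : x ∈ e.source := e.mem_source.2 (mem_baseSet_trivializationAt F W x.proj)
    have hy : y ∈ e.source := e.mem_source.2 (hp ▸ mem_baseSet_trivializationAt F W x.proj)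
    have hne : e x ≠ e y := fun h => hxy (e.injOn hx hy h)
    obtain ⟨u, v, hu, hv, hxu, hyv, huv⟩ := t2_separation hne
    refine ⟨e.source ∩ e ⁻¹' u, e.source ∩ e ⁻¹' v,
      e.continuousOn_toFun.isOpen_inter_preimage e.open_source hu,
      e.continuousOn_toFun.isOpen_inter_preimage e.open_source hv, ⟨hx, hxu⟩, ⟨hy, hyv⟩, ?_⟩
    exact (huv.preimage e).mono Set.inter_subset_right Set.inter_subset_right
  · obtain ⟨u, v, hu, hv, hxu, hyv, huv⟩ := t2_separation hp
    have hc : Continuous (TotalSpace.proj : TotalSpace F W → B) := FiberBundle.continuous_proj F W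
    exact ⟨_, _, hu.preimage hc, hv.preimage hc, hxu, hyv, huv.preimage _⟩

variable {m : ℕ} {Q : Type*} [TopologicalSpace Q] [ChartedSpace (EuclideanSpace ℝ (Fin m)) Q]
  [IsManifold (𝓡 m) ∞ Q]
  {F : Type*} [NormedAddCommGroup F] [NormedSpace ℝ F]
  {W : Q → Type*} [TopologicalSpace (TotalSpace F W)] [∀ q, TopologicalSpace (W q)]
  [∀ q, AddCommGroup (W q)] [∀ q, Module ℝ (W q)] [FiberBundle F W] [VectorBundle ℝ F W]
  [ContMDiffVectorBundle ∞ F W (𝓡 m)]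

/-- The velocity of a curve in a fibre. -/
theorem hasMFDerivAt_fiber_curve {q : Q} {c : ℝ → W q} {t₀ : ℝ} {c' : F}
    (hc : HasDerivAt (fun t => (trivializationAt F W q).continuousLinearMapAt ℝ q (c t)) c' t₀) :
    HasMFDerivAt 𝓘(ℝ, ℝ) ((𝓡 m).prod 𝓘(ℝ, F)) (fun t => (⟨q, c t⟩ : TotalSpace F W)) t₀
      (ContinuousLinearMap.toSpanSingleton ℝ ((0, c') : EuclideanSpace ℝ (Fin m) × F) :
        ℝ →L[ℝ] EuclideanSpace ℝ (Fin m) × F) := by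
  set e := trivializationAt F W q with he
  have hq : q ∈ e.baseSet := mem_baseSet_trivializationAt _ _ _
  have key : ∀ w : W q, e ⟨q, w⟩ = (q, e.continuousLinearMapAt ℝ q w) := by
    intro w
    ext1
    · exact e.coe_fst' hq
    · simp [hq]
  have hm : MDifferentiableAt 𝓘(ℝ, ℝ) ((𝓡 m).prod 𝓘(ℝ, F))
      (fun t => (⟨q, c t⟩ : TotalSpace F W)) t₀ := by
    rw [mdifferentiableAt_totalSpace]
    refine ⟨mdifferentiableAt_const, ?_⟩
    rw [mdifferentiableAt_iff_differentiableAt]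
    simp only
    rw [← he]
    simp only [key]
    exact hc.differentiableAt
  have hw : writtenInExtChartAt 𝓘(ℝ, ℝ) ((𝓡 m).prod 𝓘(ℝ, F)) t₀
      (fun t => (⟨q, c t⟩ : TotalSpace F W)) =
      fun t => (extChartAt (𝓡 m) q q, e.continuousLinearMapAt ℝ q (c t)) := by
    funext t
    simp only [writtenInExtChartAt, FiberBundle.extChartAt, extChartAt_model_space_eq_id,
      Function.comp, PartialEquiv.coe_trans, PartialEquiv.refl_symm, PartialEquiv.refl_coe, id]
    rw [← he]
    have h2 : (e.toPartialEquiv ⟨q, c t⟩ : Q × F) = _ := key (c t)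
    rw [h2]
    simp
  have hd : HasFDerivAt (fun t => (extChartAt (𝓡 m) q q, e.continuousLinearMapAt ℝ q (c t)))
      (ContinuousLinearMap.toSpanSingleton ℝ ((0, c') : EuclideanSpace ℝ (Fin m) × F)) t₀ :=
    ((hasDerivAt_const t₀ _).prodMk hc).hasFDerivAt
  have := hm.hasMFDerivAt
  rw [hm.mfderiv, hw] at this
  simp only [modelWithCornersSelf_coe, Set.range_id, extChartAt_model_space_eq_id,
    PartialEquiv.refl_coe, id, fderivWithin_univ] at this
  exact (congrArg (fun L : ℝ →L[ℝ] EuclideanSpace ℝ (Fin m) × F =>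
    HasMFDerivAt 𝓘(ℝ, ℝ) ((𝓡 m).prod 𝓘(ℝ, F)) (fun t => (⟨q, c t⟩ : TotalSpace F W)) t₀ L)
    hd.fderiv).mp this

variable [∀ q, IsTopologicalAddGroup (W q)] [∀ q, ContinuousSMul ℝ (W q)]

theorem verticalLift_eq_trivialization (a : TotalSpace F W) (w : W a.proj) :
    verticalLift (m := m) F a w =
      ((0, (trivializationAt F W a.proj).continuousLinearMapAt ℝ a.proj w) :
        EuclideanSpace ℝ (Fin m) × F) := by
  set e := trivializationAt F W a.proj with he
  have hd : HasDerivAt (fun t : ℝ => e.continuousLinearMapAt ℝ a.proj (a.2 + t • w))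
      (e.continuousLinearMapAt ℝ a.proj w) 0 := by
    simp only [map_add, map_smul]
    simpa using ((hasDerivAt_id (0 : ℝ)).smul_const (e.continuousLinearMapAt ℝ a.proj w)).const_add
      (e.continuousLinearMapAt ℝ a.proj a.2)
  have h := hasMFDerivAt_fiber_curve (m := m) hd
  unfold verticalLift
  rw [h.mfderiv]
  exact one_smul ℝ _

theorem mdifferentiableAt_fiber_line (a : TotalSpace F W) (w : W a.proj) :
    MDifferentiableAt 𝓘(ℝ, ℝ) ((𝓡 m).prod 𝓘(ℝ, F))
      (fun t : ℝ => (⟨a.proj, a.2 + t • w⟩ : TotalSpace F W)) 0 := by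
  set e := trivializationAt F W a.proj with he
  have hd : HasDerivAt (fun t : ℝ => e.continuousLinearMapAt ℝ a.proj (a.2 + t • w))
      (e.continuousLinearMapAt ℝ a.proj w) 0 := by
    simp only [map_add, map_smul]
    simpa using ((hasDerivAt_id (0 : ℝ)).smul_const (e.continuousLinearMapAt ℝ a.proj w)).const_add
      (e.continuousLinearMapAt ℝ a.proj a.2)
  exact (hasMFDerivAt_fiber_curve (m := m) hd).mdifferentiableAt

theorem differential_verticalLift {f : TotalSpace F W → ℝ} {a : TotalSpace F W}
    (hf : MDifferentiableAt ((𝓡 m).prod 𝓘(ℝ, F)) 𝓘(ℝ, ℝ) f a) (w : W a.proj) :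
    HasDerivAt (fun t : ℝ => f ⟨a.proj, a.2 + t • w⟩)
      (differential ((𝓡 m).prod 𝓘(ℝ, F)) f a (verticalLift F a w)) 0 := by
  have hl := mdifferentiableAt_fiber_line (m := m) a w
  have ha : (fun t : ℝ => (⟨a.proj, a.2 + t • w⟩ : TotalSpace F W)) 0 = a := by simp
  let L : EuclideanSpace ℝ (Fin m) × F →L[ℝ] ℝ := mfderiv ((𝓡 m).prod 𝓘(ℝ, F)) 𝓘(ℝ, ℝ) f a
  have hf' : ∀ b : TotalSpace F W, b = a → HasMFDerivAt ((𝓡 m).prod 𝓘(ℝ, F)) 𝓘(ℝ, ℝ) f b L := by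
    rintro b rfl
    exact hf.hasMFDerivAt
  have h := (hf' _ ha).comp 0 hl.hasMFDerivAt
  let L' : ℝ →L[ℝ] EuclideanSpace ℝ (Fin m) × F := mfderiv 𝓘(ℝ, ℝ) ((𝓡 m).prod 𝓘(ℝ, F))
    (fun t : ℝ => (⟨a.proj, a.2 + t • w⟩ : TotalSpace F W)) 0
  have h2 : HasFDerivAt (fun t : ℝ => f ⟨a.proj, a.2 + t • w⟩) (L.comp L') 0 := h.hasFDerivAt
  exact h2.hasDerivAt
end FiberCurves

/-! ### Adapted frames of TQ, A and A*, and the coordinates they give on A* -/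

section Frames

variable {m n : ℕ} {Q : Type*} [TopologicalSpace Q] [ChartedSpace (EuclideanSpace ℝ (Fin m)) Q]
  [IsManifold (𝓡 m) ∞ Q]
  {A : Q → Type*} [TopologicalSpace (TotalSpace (Fib n) A)]
  [∀ q, TopologicalSpace (A q)] [∀ q, AddCommGroup (A q)] [∀ q, Module ℝ (A q)]
  [∀ q, IsTopologicalAddGroup (A q)] [∀ q, ContinuousSMul ℝ (A q)]
  [FiberBundle (Fib n) A] [VectorBundle ℝ (Fib n) A] [ContMDiffVectorBundle ∞ (Fib n) A (𝓡 m)]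

variable (n) in
/-- The basis of `(ℝⁿ)*` dual to the standard basis. -/
def dualFibBasis : Module.Basis (Fin n) ℝ (DualFib n) :=
  (EuclideanSpace.basisFun (Fin n) ℝ).toBasis.dualBasis.map LinearMap.toContinuousLinearMap

theorem dualFibBasis_coord (a : Fin n) (p : DualFib n) :
    (dualFibBasis n).coord a p = p (EuclideanSpace.single a 1) := by
  simp [dualFibBasis]

theorem dualFibBasis_apply_single (a b : Fin n) :
    dualFibBasis n a (EuclideanSpace.single b 1) = if a = b then 1 else 0 := by
  rw [← dualFibBasis_coord]
  simp [Finsupp.single_apply]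

/-- A* is trivialized by the inverse transpose of the trivialization of A; hence the fibre
coordinates of α in its chart are the momenta α(X_a). -/
theorem dual_trivialization_apply (q₀ : Q) (α : DualTotal n A)
    (v : Fib n) :
    (trivializationAt (DualFib n) (fun q => A q →L[ℝ] ℝ) q₀ α).2 v =
      α.2 ((trivializationAt (Fib n) A q₀).symmL ℝ α.proj v) := by
  rw [hom_trivializationAt_apply]
  simp [ContinuousLinearMap.inCoordinates]

theorem contMDiffAt_dual_apply {EN HN N : Type*} [NormedAddCommGroup EN] [NormedSpace ℝ EN]
    [TopologicalSpace HN] {IN : ModelWithCorners ℝ EN HN} [TopologicalSpace N] [ChartedSpace HN N]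
    {b : N → Q} {φ : ∀ x, A (b x) →L[ℝ] ℝ} {v : ∀ x, A (b x)} {x : N}
    (hφ : ContMDiffAt IN (dualModel m n) ∞ (fun x => (⟨b x, φ x⟩ : DualTotal n A)) x)
    (hv : ContMDiffAt IN ((𝓡 m).prod 𝓘(ℝ, Fib n)) ∞
      (fun x => (⟨b x, v x⟩ : TotalSpace (Fib n) A)) x) :
    ContMDiffAt IN 𝓘(ℝ, ℝ) ∞ (fun x => φ x (v x)) x := by
  have h := ContMDiffAt.clm_bundle_apply (E₁ := A) (E₂ := fun _ : Q => ℝ) (F₁ := Fib n) (F₂ := ℝ)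
    (b := b) (ϕ := φ) (v := v) hφ hv
  exact (contMDiffAt_totalSpace.1 h).2

theorem contMDiff_section_apply (β : DualSec m n A) (X : Sec m n A) :
    ContMDiff (𝓡 m) 𝓘(ℝ, ℝ) ∞ (fun q => β q (X q)) := fun q =>
  contMDiffAt_dual_apply (b := id) (φ := fun q => β q) (v := fun q => X q)
    (β.contMDiff q) (X.contMDiff q)

theorem contMDiff_linearFun (X : Sec m n A) :
    ContMDiff (dualModel m n) 𝓘(ℝ, ℝ) ∞ (linearFun X) := fun α =>
  contMDiffAt_dual_apply (b := fun α : DualTotal n A => α.proj) (φ := fun α => α.2)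
    (v := fun α => X α.proj) contMDiffAt_id ((X.contMDiff.comp (contMDiff_proj _)) α)

theorem contMDiff_comp_proj {f : Q → ℝ} (hf : ContMDiff (𝓡 m) 𝓘(ℝ, ℝ) ∞ f) :
    ContMDiff (dualModel m n) 𝓘(ℝ, ℝ) ∞ (fun α : DualTotal n A => f α.proj) :=
  hf.comp (contMDiff_proj _)

theorem differential_comp_proj {f : Q → ℝ} {α : DualTotal n A}
    (hf : MDifferentiableAt (𝓡 m) 𝓘(ℝ, ℝ) f α.proj) (v : TangentSpace (dualModel m n) α) :
    differential (dualModel m n) (fun γ : DualTotal n A => f γ.proj) α v =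
      differential (𝓡 m) f α.proj (mfderiv (dualModel m n) (𝓡 m) TotalSpace.proj α v) := by
  have h1 : MDifferentiableAt (dualModel m n) (𝓡 m) (TotalSpace.proj : DualTotal n A → Q) α :=
    mdifferentiableAt_proj _
  unfold differential
  exact congrArg (fun L => L v) (hf.hasMFDerivAt.comp α h1.hasMFDerivAt).mfderiv

theorem differential_comp_proj_verticalLift {f : Q → ℝ} {α : DualTotal n A}
    (hf : MDifferentiableAt (𝓡 m) 𝓘(ℝ, ℝ) f α.proj) (β : A α.proj →L[ℝ] ℝ) :
    differential (dualModel m n) (fun γ : DualTotal n A => f γ.proj) α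
      (verticalLift (DualFib n) α β) = 0 := by
  rw [differential_comp_proj hf, mfderiv_proj, verticalLift_eq]
  exact map_zero _

theorem differential_linearFun_verticalLift (X : Sec m n A) (α : DualTotal n A)
    (β : A α.proj →L[ℝ] ℝ) :
    differential (dualModel m n) (linearFun X) α (verticalLift (DualFib n) α β) = β (X α.proj) := by
  have h := differential_verticalLift (F := DualFib n) (W := fun q => A q →L[ℝ] ℝ)
    ((contMDiff_linearFun X α).mdifferentiableAt (by simp)) β
  refine h.unique ?_
  show HasDerivAt (fun t : ℝ => (α.2 + t • β) (X α.proj)) _ 0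
  simp only [add_apply, smul_apply]
  simpa using ((hasDerivAt_id (0 : ℝ)).smul_const (β (X α.proj))).const_add (α.2 (X α.proj))

variable (m n A) in
/-- Functions, sections and vector fields, defined globally, that form mutually dual frames
of `TQ`, `A` and `A*` near `q₀`. -/
structure AdaptedFrame (q₀ : Q) where
  f : Fin m → SmoothFun m Q
  V : Fin m → ∀ q : Q, TangentSpace (𝓡 m) q
  X : Fin n → Sec m n A
  β : Fin n → DualSec m n A
  V_smooth : ∀ i, IsSmoothVectorField (𝓡 m) (V i)
  f_eq : ∀ i, f i =ᶠ[𝓝 q₀] fun q => (extChartAt (𝓡 m) q₀ q) i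
  X_eq : ∀ᶠ q in 𝓝 q₀, ∀ a, X a q =
    (trivializationAt (Fib n) A q₀).symmL ℝ q (EuclideanSpace.single a 1)
  f_V : ∀ᶠ q in 𝓝 q₀, ∀ i j, differential (𝓡 m) (f i) q (V j q) = if i = j then 1 else 0
  β_X : ∀ᶠ q in 𝓝 q₀, ∀ a b, β a q (X b q) = if a = b then 1 else 0

theorem finrank_fiber (q : Q) : FiniteDimensional ℝ (A q) ∧ Module.finrank ℝ (A q) = n := by
  have e := ((trivializationAt (Fib n) A q).continuousLinearEquivAt ℝ q
    (mem_baseSet_trivializationAt _ _ _)).toLinearEquiv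
  exact ⟨e.symm.finiteDimensional, by rw [e.finrank_eq]; simp⟩

theorem nonempty_adaptedFrame [T2Space Q] (q₀ : Q) : Nonempty (AdaptedFrame m n A q₀) := by
  have h1 : ∀ i : Fin m, ∃ f : Q → ℝ, ContMDiff (𝓡 m) 𝓘(ℝ, ℝ) ∞ f ∧
      f =ᶠ[𝓝 q₀] fun q => (extChartAt (𝓡 m) q₀ q) i := by
    intro i
    refine exists_contMDiff_eventuallyEq (I := 𝓡 m) (chartAt (EuclideanSpace ℝ (Fin m)) q₀).open_source
      (mem_chart_source _ q₀) ?_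
    have h2 : ContMDiffOn (𝓡 m) 𝓘(ℝ, EuclideanSpace ℝ (Fin m)) ∞ (extChartAt (𝓡 m) q₀)
      (chartAt (EuclideanSpace ℝ (Fin m)) q₀).source := contMDiffOn_extChartAt
    exact (EuclideanSpace.proj (𝕜 := ℝ) i).contDiff.contMDiff.comp_contMDiffOn h2
  choose f hf hfe using h1
  obtain ⟨V, hV, hfV⟩ := exists_dual_frame (I := 𝓡 m) (EuclideanSpace.basisFun (Fin m) ℝ).toBasis
    (y := f) (x₀ := q₀) (by intro k; simpa using hfe k)
  set e := trivializationAt (Fib n) A q₀ with he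
  have hq : q₀ ∈ e.baseSet := mem_baseSet_trivializationAt _ _ _
  set e' := trivializationAt (DualFib n) (fun q => A q →L[ℝ] ℝ) q₀ with he'
  have hq' : q₀ ∈ e'.baseSet := mem_baseSet_trivializationAt _ _ _
  have h3 : ∀ a : Fin n, ∃ s : ∀ q, A q, ContMDiff (𝓡 m) ((𝓡 m).prod 𝓘(ℝ, Fib n)) ∞
      (fun q => TotalSpace.mk' (Fib n) q (s q)) ∧ ∀ᶠ q in 𝓝 q₀, s q =
        e.localFrame (EuclideanSpace.basisFun (Fin n) ℝ).toBasis a q := fun a =>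
    exists_contMDiff_section_eventuallyEq e.open_baseSet hq
      (e.contMDiffOn_localFrame_baseSet (I := 𝓡 m) ∞ _ a)
  have h4 : ∀ a : Fin n, ∃ s : ∀ q, A q →L[ℝ] ℝ, ContMDiff (𝓡 m) (dualModel m n) ∞
      (fun q => TotalSpace.mk' (DualFib n) q (s q)) ∧ ∀ᶠ q in 𝓝 q₀, s q =
        e'.localFrame (dualFibBasis n) a q := fun a =>
    exists_contMDiff_section_eventuallyEq (V := fun q => A q →L[ℝ] ℝ) e'.open_baseSet hq'
      (e'.contMDiffOn_localFrame_baseSet (I := 𝓡 m) ∞ _ a)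
  choose X hX hXe using h3
  choose β hβ hβe using h4
  have hX' : ∀ᶠ q in 𝓝 q₀, ∀ a, X a q = e.symmL ℝ q (EuclideanSpace.single a 1) := by
    filter_upwards [Filter.eventually_all.2 hXe, e.open_baseSet.mem_nhds hq] with q hq1 hq2 a
    rw [hq1, e.localFrame_apply_of_mem_baseSet _ hq2]
    simp [Bundle.Trivialization.basisAt, Bundle.Trivialization.symmL_apply, hq2]

  refine ⟨⟨fun i => ⟨f i, hf i⟩, V, fun a => ⟨X a, hX a⟩, fun a => ⟨β a, hβ a⟩, hV, hfe, hX', hfV, ?_⟩⟩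
  filter_upwards [hX', Filter.eventually_all.2 hβe, e'.open_baseSet.mem_nhds hq'] with q hq1 hq2 hq3 a b
  show β a q (X b q) = _
  -- Moving the trivialization of A across the pairing reduces duality of the two frames to duality
  -- of the model bases.
  rw [hq1, ← dual_trivialization_apply q₀ ⟨q, β a q⟩, hq2, e'.localFrame_apply_of_mem_baseSet _ hq3,
    ← dualFibBasis_apply_single]
  congr 1
  exact (congrArg (fun w : A q →L[ℝ] ℝ => (e' ⟨q, w⟩).2)
    (by simp [Bundle.Trivialization.basisAt])).trans
    (congrArg Prod.snd (e'.apply_mk_symm hq3 (dualFibBasis n a)))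

namespace AdaptedFrame

variable {q₀ : Q} (S : AdaptedFrame m n A q₀)

/-- The coordinate functions on `A*` given by an adapted frame. -/
def coord : Fin m ⊕ Fin n → DualTotal n A → ℝ :=
  Sum.elim (fun i α => S.f i α.proj) (fun a => linearFun (S.X a))

theorem contMDiff_coord (k : Fin m ⊕ Fin n) :
    ContMDiff (dualModel m n) 𝓘(ℝ, ℝ) ∞ (S.coord k) := by
  rcases k with i | a
  · exact contMDiff_comp_proj (S.f i).contMDiff
  · exact contMDiff_linearFun (S.X a)

/-- Near a point over q₀ the functions `S.coord` are the components of the chart of A* in a product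
basis, so the general construction of coordinate fields applies. -/
theorem exists_dual_frame [T2Space Q] {α₀ : DualTotal n A} (h : α₀.proj = q₀) :
    ∃ D : Fin m ⊕ Fin n → ∀ α : DualTotal n A, TangentSpace (dualModel m n) α,
      (∀ k, IsSmoothVectorField (dualModel m n) (D k)) ∧
      ∀ᶠ α in 𝓝 α₀, ∀ k l, differential (dualModel m n) (S.coord k) α (D l α) =
        if k = l then 1 else 0 := by
  subst h
  have : T2Space (DualTotal n A) := t2Space_totalSpace
  refine LieAlgebroidMech.exists_dual_frame (I := dualModel m n)
    ((EuclideanSpace.basisFun (Fin m) ℝ).toBasis.prod (dualFibBasis n)) ?_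
  have hc : Filter.Tendsto (TotalSpace.proj : DualTotal n A → Q) (𝓝 α₀) (𝓝 α₀.proj) :=
    (FiberBundle.continuous_proj _ _).tendsto _
  rintro (i | a)
  · filter_upwards [hc.eventually (S.f_eq i)] with α hα
    simp only [coord, Sum.elim_inl, FiberBundle.extChartAt]
    rw [hα]
    simp
    rw [hom_trivializationAt_apply]
  · filter_upwards [hc.eventually S.X_eq] with α hα
    simp only [coord, Sum.elim_inr, FiberBundle.extChartAt, linearFun]
    rw [hα, ← dual_trivialization_apply]
    simp
    exact (dualFibBasis_coord a _).symm

end AdaptedFrame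
end Frames

section Calculus
variable {E : Type*} [NormedAddCommGroup E] [NormedSpace ℝ E]
  {H : Type*} [TopologicalSpace H] {I : ModelWithCorners ℝ E H}
  {M : Type*} [TopologicalSpace M] [ChartedSpace H M]

theorem differential_sum {ι : Type*} (s : Finset ι) {f : ι → M → ℝ} {x : M}
    (hf : ∀ i ∈ s, MDifferentiableAt I 𝓘(ℝ, ℝ) (f i) x) :
    MDifferentiableAt I 𝓘(ℝ, ℝ) (fun y => ∑ i ∈ s, f i y) x ∧
    differential I (fun y => ∑ i ∈ s, f i y) x = ∑ i ∈ s, differential I (f i) x := by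
  classical
  induction s using Finset.induction_on with
  | empty =>
    simp only [Finset.sum_empty]
    exact ⟨mdifferentiableAt_const, by unfold differential; rw [mfderiv_const]; rfl⟩
  | insert i s hi ih =>
    obtain ⟨h1, h2⟩ := ih fun j hj => hf j (Finset.mem_insert_of_mem hj)
    have h3 := hf i (Finset.mem_insert_self i s)
    simp only [Finset.sum_insert hi]
    refine ⟨(h3.hasMFDerivAt.add h1.hasMFDerivAt).mdifferentiableAt, ?_⟩
    rw [← h2]
    ext v
    exact congrArg (fun L => L v) (h3.hasMFDerivAt.add h1.hasMFDerivAt).mfderiv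

end Calculus

/-! ### Existence of the linear Poisson tensor -/

section Poisson

variable {m n : ℕ} {Q : Type*} [TopologicalSpace Q] [ChartedSpace (EuclideanSpace ℝ (Fin m)) Q]
  [IsManifold (𝓡 m) ∞ Q]
  {A : Q → Type*} [TopologicalSpace (TotalSpace (Fib n) A)]
  [∀ q, TopologicalSpace (A q)] [∀ q, AddCommGroup (A q)] [∀ q, Module ℝ (A q)]
  [∀ q, IsTopologicalAddGroup (A q)] [∀ q, ContinuousSMul ℝ (A q)]
  [FiberBundle (Fib n) A] [VectorBundle ℝ (Fib n) A] [ContMDiffVectorBundle ∞ (Fib n) A (𝓡 m)]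

/-- The coefficient of a section in an adapted frame, as a smooth function. -/
def pairing (β : DualSec m n A) (X : Sec m n A) : SmoothFun m Q :=
  ⟨fun q => β q (X q), contMDiff_section_apply β X⟩

/-- The product of a smooth function and a smooth section. -/
def smulSec (f : SmoothFun m Q) (X : Sec m n A) : Sec m n A :=
  ⟨fun q => f q • X q, ContMDiff.smul_section f.contMDiff X.contMDiff⟩

theorem coe_sum_sec {ι : Type*} (s : Finset ι) (X : ι → Sec m n A) (q : Q) :
    (∑ i ∈ s, X i) q = ∑ i ∈ s, X i q := by
  classical
  induction s using Finset.induction_on with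
  | empty => simp
  | insert i s hi ih => simp [Finset.sum_insert hi, ih]

namespace AdaptedFrame

variable {q₀ : Q} (S : AdaptedFrame m n A q₀)

theorem eq_sum_sec {q : Q} (hq : ∀ a b, S.β a q (S.X b q) = if a = b then 1 else 0) (w : A q) :
    w = ∑ a, S.β a q w • S.X a q := by
  have := (finrank_fiber (n := n) (A := A) q).1
  exact eq_sum_smul_of_dual (φ := fun a => (S.β a q).toLinearMap) (d := fun a => S.X a q)
    (by rw [(finrank_fiber (n := n) (A := A) q).2]; simp) hq w

theorem eq_sum_field {q : Q}
    (hq : ∀ i j, differential (𝓡 m) (S.f i) q (S.V j q) = if i = j then 1 else 0)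
    (w : TangentSpace (𝓡 m) q) :
    w = ∑ i, differential (𝓡 m) (S.f i) q w • S.V i q :=
  eq_sum_smul_of_dual (φ := fun i => differential (𝓡 m) (S.f i) q) (d := fun i => S.V i q)
    ((finrank_euclideanSpace_fin (𝕜 := ℝ)).trans (by simp)) hq w

theorem finrank_tangentSpace (α : DualTotal n A) :
    Module.finrank ℝ (TangentSpace (dualModel m n) α) = Fintype.card (Fin m ⊕ Fin n) := by
  have : Module.finrank ℝ (DualFib n) = n := by
    rw [← (LinearMap.toContinuousLinearMap (𝕜 := ℝ) (E := Fib n) (F' := ℝ)).finrank_eq]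
    simp
  refine (Module.finrank_prod (R := ℝ) (M := EuclideanSpace ℝ (Fin m)) (M' := DualFib n)).trans ?_
  simp [this]

end AdaptedFrame

namespace LieAlgebroid

variable (L : LieAlgebroid m n A)

theorem bracket_skew (X Y : Sec m n A) : L.bracket X Y = -L.bracket Y X := by
  have h := L.bracket_self (X + Y)
  simp only [map_add, LinearMap.add_apply, L.bracket_self, zero_add, add_zero] at h
  rwa [add_comm, ← eq_neg_iff_add_eq_zero] at h

/-- Locality of the bracket: if χ is a bump function supported where X = X', then χ(X - X') = 0. The
Leibniz rule at q, where χ = 1 and X - X' vanishes, gives [Y, X - X'](q) = 0. -/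
theorem bracket_congr [T2Space Q] {X X' : Sec m n A} (Y : Sec m n A) {q : Q}
    (h : ∀ᶠ p in 𝓝 q, X p = X' p) : L.bracket Y X q = L.bracket Y X' q := by
  obtain ⟨χ, -, hχ⟩ := (SmoothBumpFunction.nhds_basis_tsupport (I := 𝓡 m) q).mem_iff.1 h
  have h1 := L.leibniz Y (X - X') 0 ⟨χ, χ.contMDiff⟩ (fun p => by
    by_cases hp : p ∈ tsupport χ
    · have : X p = X' p := hχ hp
      simp [this]
    · have : χ p = 0 := image_eq_zero_of_notMem_tsupport hp
      simp [this]) q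
  have h2 : X q = X' q := h.self_of_nhds
  rw [← sub_eq_zero]
  simpa [h2, χ.eq_one] using h1.symm

theorem bracket_smulSec (X Y : Sec m n A) (f : SmoothFun m Q) (q : Q) :
    L.bracket X (smulSec f Y) q = f q • L.bracket X Y q + L.d f q (X q) • Y q :=
  L.leibniz X Y (smulSec f Y) f (fun _ => rfl) q

theorem bracket_eq_sum_right [T2Space Q] {q : Q} (S : AdaptedFrame m n A q) (X Y : Sec m n A) :
    L.bracket X Y q = ∑ b, (S.β b q (Y q) • L.bracket X (S.X b) q +
      L.d (pairing (S.β b) Y) q (X q) • S.X b q) := by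
  have h : ∀ᶠ p in 𝓝 q, Y p = (∑ b, smulSec (pairing (S.β b) Y) (S.X b)) p := by
    filter_upwards [S.β_X] with p hp
    rw [coe_sum_sec]
    exact S.eq_sum_sec hp _
  rw [L.bracket_congr X h, map_sum, coe_sum_sec]
  simp only [bracket_smulSec]
  rfl

/-- The Leibniz rule in both slots, the left one through skew-symmetry. The bracket is not
tensorial, so derivatives of the components of X and Y remain. -/
theorem bracket_eq_sum [T2Space Q] {q : Q} (S : AdaptedFrame m n A q) (X Y : Sec m n A) :
    L.bracket X Y q = ∑ a, ∑ b, (S.β a q (X q) * S.β b q (Y q)) • L.bracket (S.X a) (S.X b) q +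
      ∑ b, L.d (pairing (S.β b) Y) q (X q) • S.X b q -
      ∑ a, L.d (pairing (S.β a) X) q (Y q) • S.X a q := by
  have hY : ∑ b, S.β b q (Y q) • S.X b q = Y q := (S.eq_sum_sec S.β_X.self_of_nhds (Y q)).symm
  have h1 : ∀ b, L.bracket X (S.X b) q = ∑ a, (S.β a q (X q) • L.bracket (S.X a) (S.X b) q -
      L.d (pairing (S.β a) X) q (S.X b q) • S.X a q) := by
    intro b
    rw [L.bracket_skew]
    show -(L.bracket (S.X b) X q) = _
    rw [L.bracket_eq_sum_right S (S.X b) X, ← Finset.sum_neg_distrib]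
    refine Finset.sum_congr rfl fun a _ => ?_
    rw [L.bracket_skew (S.X b)]
    show -(_ • -(L.bracket (S.X a) (S.X b) q) + _) = _
    rw [smul_neg]
    abel
  rw [L.bracket_eq_sum_right S X Y, Finset.sum_add_distrib]
  simp only [h1, Finset.smul_sum, smul_sub, Finset.sum_sub_distrib, smul_smul]
  rw [Finset.sum_comm (f := fun b a => (S.β b q (Y q) * S.β a q (X q)) • L.bracket (S.X a) (S.X b) q)]
  rw [Finset.sum_comm (f := fun b a => (S.β b q (Y q) * L.d (pairing (S.β a) X) q (S.X b q)) • S.X a q)]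
  have h2 : ∀ a, ∑ b, (S.β b q (Y q) * L.d (pairing (S.β a) X) q (S.X b q)) • S.X a q =
      L.d (pairing (S.β a) X) q (Y q) • S.X a q := by
    intro a
    conv_rhs => rw [← hY]
    rw [map_sum, Finset.sum_smul]
    simp
  simp only [h2]
  simp only [mul_comm (S.β _ q (Y q))]
  abel

theorem contMDiff_d_apply (f : SmoothFun m Q) (X : Sec m n A) :
    ContMDiff (𝓡 m) 𝓘(ℝ, ℝ) ∞ (fun q => L.d f q (X q)) :=
  contMDiff_differential_apply (X := fun q => L.anchor q (X q)) f.contMDiff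
    (L.anchor_smooth.comp X.contMDiff)

end LieAlgebroid

namespace AdaptedFrame

variable {q₀ : Q} (S : AdaptedFrame m n A q₀) (L : LieAlgebroid m n A)

/-- The brackets of the coordinate functions on `A*` given by an adapted frame. -/
def poisson : Fin m ⊕ Fin n → Fin m ⊕ Fin n → DualTotal n A → ℝ
  | .inl _, .inl _, _ => 0
  | .inl i, .inr a, α => L.d (S.f i) α.proj (S.X a α.proj)
  | .inr a, .inl i, α => -L.d (S.f i) α.proj (S.X a α.proj)
  | .inr a, .inr b, α => -linearFun (L.bracket (S.X a) (S.X b)) α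

theorem poisson_skew (k l : Fin m ⊕ Fin n) (α : DualTotal n A) :
    S.poisson L k l α = -S.poisson L l k α := by
  rcases k with i | a <;> rcases l with j | b <;> simp only [poisson, neg_neg, neg_zero]
  rw [L.bracket_skew]
  simp [linearFun]

theorem contMDiff_poisson (k l : Fin m ⊕ Fin n) :
    ContMDiff (dualModel m n) 𝓘(ℝ, ℝ) ∞ (S.poisson L k l) := by
  rcases k with i | a <;> rcases l with j | b
  · exact contMDiff_const
  · exact contMDiff_comp_proj (L.contMDiff_d_apply _ _)
  · exact (contMDiff_comp_proj (L.contMDiff_d_apply _ _)).neg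
  · exact (contMDiff_linearFun _).neg

theorem differential_comp_proj_eq_sum {α : DualTotal n A}
    (hα : ∀ i j, differential (𝓡 m) (S.f i) α.proj (S.V j α.proj) = if i = j then 1 else 0)
    {g : Q → ℝ} (hg : MDifferentiableAt (𝓡 m) 𝓘(ℝ, ℝ) g α.proj) :
    dualDiff m (fun γ : DualTotal n A => g γ.proj) α =
      ∑ i, differential (𝓡 m) g α.proj (S.V i α.proj) • dualDiff m (S.coord (.inl i)) α := by
  ext v
  refine (differential_comp_proj hg v).trans ?_
  rw [S.eq_sum_field hα (mfderiv (dualModel m n) (𝓡 m) TotalSpace.proj α v), map_sum,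
    LinearMap.sum_apply]
  refine Finset.sum_congr rfl fun i _ => ?_
  rw [map_smul, LinearMap.smul_apply, smul_eq_mul, smul_eq_mul, mul_comm]
  congr 1
  exact (differential_comp_proj ((S.f i).contMDiff.mdifferentiable (by simp) _) v).symm

/-- The product rule applied to X̂ = Σ (β_a(X)∘τ) X̂_a. This equality is needed on a neighbourhood
in order to be differentiated, so α must lie over the centre of the frame. -/
theorem differential_linearFun_eq_sum {α : DualTotal n A} (hα : α.proj = q₀) (X : Sec m n A) :
    dualDiff m (linearFun X) α =
      ∑ a, (S.β a α.proj (X α.proj) • dualDiff m (S.coord (.inr a)) α +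
        α.2 (S.X a α.proj) • dualDiff m (fun γ : DualTotal n A => pairing (S.β a) X γ.proj) α) := by
  have hc : Filter.Tendsto (TotalSpace.proj : DualTotal n A → Q) (𝓝 α) (𝓝 q₀) :=
    hα ▸ (FiberBundle.continuous_proj _ _).tendsto _
  have h : linearFun X =ᶠ[𝓝 α] fun γ => ∑ a, pairing (S.β a) X γ.proj * S.coord (.inr a) γ := by
    filter_upwards [hc.eventually S.β_X] with γ hγ
    unfold linearFun
    conv_lhs => rw [S.eq_sum_sec hγ (X γ.proj), map_sum]
    simp [pairing, coord, linearFun]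
  unfold dualDiff
  have hd : ∀ a, MDifferentiableAt (dualModel m n) 𝓘(ℝ, ℝ)
      (fun γ : DualTotal n A => pairing (S.β a) X γ.proj) α := fun a =>
    (contMDiff_comp_proj (pairing (S.β a) X).contMDiff).mdifferentiable (by simp) _
  have hd2 : ∀ a, MDifferentiableAt (dualModel m n) 𝓘(ℝ, ℝ) (S.coord (.inr a)) α := fun a =>
    (S.contMDiff_coord _).mdifferentiable (by simp) _
  rw [differential_congr h, (differential_sum (f := fun a (γ : DualTotal n A) =>
    pairing (S.β a) X γ.proj * S.coord (.inr a) γ) _ fun a _ =>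
    ((hd a).hasMFDerivAt.mul (hd2 a).hasMFDerivAt).mdifferentiableAt).2]
  refine Finset.sum_congr rfl fun a _ => ?_
  exact differential_mul (hd a) (hd2 a)

end AdaptedFrame

namespace LieAlgebroid

variable [T2Space Q] (L : LieAlgebroid m n A)

theorem exists_bilinear_coord {α : DualTotal n A} (S : AdaptedFrame m n A α.proj) :
    ∃ P : Module.Dual ℝ (TangentSpace (dualModel m n) α) →ₗ[ℝ]
      Module.Dual ℝ (TangentSpace (dualModel m n) α) →ₗ[ℝ] ℝ,
      (∀ φ ψ, P φ ψ = -P ψ φ) ∧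
      ∀ k l, P (dualDiff m (S.coord k) α) (dualDiff m (S.coord l) α) = S.poisson L k l α := by
  obtain ⟨D, -, hD⟩ := S.exists_dual_frame (α₀ := α) rfl
  have hD := hD.self_of_nhds
  -- The coordinate expression Σ π_kl ∂_k ⊗ ∂_l of a bivector.
  refine ⟨LinearMap.mk₂ ℝ (fun φ ψ => ∑ k, ∑ l, S.poisson L k l α * (φ (D k α) * ψ (D l α)))
      ?_ ?_ ?_ ?_, fun φ ψ => ?_, fun k l => ?_⟩
  · intro φ φ' ψ
    simp only [LinearMap.add_apply, add_mul, mul_add, Finset.sum_add_distrib]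
  · intro c φ ψ
    simp only [LinearMap.smul_apply, smul_eq_mul, Finset.mul_sum]
    exact Finset.sum_congr rfl fun k _ => Finset.sum_congr rfl fun l _ => by ring
  · intro φ ψ ψ'
    simp only [LinearMap.add_apply, mul_add, Finset.sum_add_distrib]
  · intro c φ ψ
    simp only [LinearMap.smul_apply, smul_eq_mul, Finset.mul_sum]
    exact Finset.sum_congr rfl fun k _ => Finset.sum_congr rfl fun l _ => by ring
  · simp only [LinearMap.mk₂_apply]
    rw [Finset.sum_comm]
    simp only [← Finset.sum_neg_distrib]
    refine Finset.sum_congr rfl fun k _ => Finset.sum_congr rfl fun l _ => ?_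
    rw [S.poisson_skew]
    ring
  · have hD' : ∀ k l, dualDiff m (S.coord k) α (D l α) = if k = l then 1 else 0 := hD
    simp only [LinearMap.mk₂_apply, hD']
    simp

theorem sum_field_mul_d {q : Q} (S : AdaptedFrame m n A q) (f : Q → ℝ) (w : A q) :
    ∑ i, differential (𝓡 m) f q (S.V i q) * L.d (S.f i) q w = L.d f q w := by
  show _ = differential (𝓡 m) f q (L.anchor q w)
  conv_rhs => rw [S.eq_sum_field S.f_V.self_of_nhds (L.anchor q w), map_sum]
  refine Finset.sum_congr rfl fun i _ => ?_
  rw [map_smul, smul_eq_mul, mul_comm]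
  rfl

/-- The index computation behind {X̂, Ŷ} = -[X,Y]^: ξ and η are the components of X and Y, u the
momenta, c the values of the linear functions of the frame brackets, and d, e, dY are derivatives of
components along the anchor. -/
theorem sum_bracket_identity (ξ η u e dY : Fin n → ℝ) (c d : Fin n → Fin n → ℝ)
    (h : ∀ a, dY a = ∑ b, η b * d a b) :
    ∑ b, (η b * ∑ a, (ξ a * -c a b + u a * d a b) + u b * -e b) =
      -(∑ a, ∑ b, ξ a * η b * c a b + ∑ b, e b * u b - ∑ a, dY a * u a) := by
  simp only [h, Finset.sum_add_distrib, Finset.mul_sum, Finset.sum_mul, mul_add]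
  rw [Finset.sum_comm (f := fun b a => η b * (ξ a * -c a b)),
    Finset.sum_comm (f := fun b a => η b * (u a * d a b))]
  have h1 : ∀ a b, η b * (ξ a * -c a b) = -(ξ a * η b * c a b) := fun a b => by ring
  have h2 : ∀ a b, η b * (u a * d a b) = η b * d a b * u a := fun a b => by ring
  have h3 : ∀ b, u b * -e b = -(e b * u b) := fun b => by ring
  simp only [h1, h2, h3, Finset.sum_neg_distrib]
  ring

/-- The values on coordinates already force the conditions for all functions and sections:
differentiating the components of X and Y produces exactly the derivative terms in the Leibniz
expansion of [X, Y]. -/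
theorem isLinearPoissonAt_of_coord {α : DualTotal n A} (S : AdaptedFrame m n A α.proj)
    {P : Module.Dual ℝ (TangentSpace (dualModel m n) α) →ₗ[ℝ]
      Module.Dual ℝ (TangentSpace (dualModel m n) α) →ₗ[ℝ] ℝ} (skew : ∀ φ ψ, P φ ψ = -P ψ φ)
    (hP : ∀ k l, P (dualDiff m (S.coord k) α) (dualDiff m (S.coord l) α) = S.poisson L k l α) :
    L.IsLinearPoissonAt α P := by
  have hbase := fun f : SmoothFun m Q => S.differential_comp_proj_eq_sum S.f_V.self_of_nhds
    (f.contMDiff.mdifferentiable (by simp) α.proj)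
  have bb : ∀ f g : SmoothFun m Q, P (dualDiff m (fun γ : DualTotal n A => f γ.proj) α)
      (dualDiff m (fun γ => g γ.proj) α) = 0 := by
    intro f g
    rw [hbase, hbase]
    simp only [map_sum, map_smul, LinearMap.sum_apply, LinearMap.smul_apply, hP,
      AdaptedFrame.poisson, smul_zero, Finset.sum_const_zero]
  have b_coord : ∀ (f : SmoothFun m Q) (b : Fin n),
      P (dualDiff m (fun γ : DualTotal n A => f γ.proj) α)
      (dualDiff m (S.coord (.inr b)) α) = L.d f α.proj (S.X b α.proj) := by
    intro f b
    rw [hbase, ← L.sum_field_mul_d S]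
    simp only [map_sum, map_smul, LinearMap.sum_apply, LinearMap.smul_apply, hP,
      AdaptedFrame.poisson, smul_eq_mul]
  have hX : ∀ (X : Sec m n A) (φ : A α.proj →L[ℝ] ℝ),
      φ (X α.proj) = ∑ a, S.β a α.proj (X α.proj) * φ (S.X a α.proj) := fun X φ => by
    conv_lhs => rw [S.eq_sum_sec S.β_X.self_of_nhds (X α.proj), map_sum]
    simp only [map_smul, smul_eq_mul]
  have bl : ∀ (f : SmoothFun m Q) (X : Sec m n A),
    P (dualDiff m (fun γ => f γ.proj) α) (dualDiff m (linearFun X) α)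
      = L.d f α.proj (X α.proj) := by
    intro f X
    rw [S.differential_linearFun_eq_sum rfl X, hX X]
    simp only [map_sum, map_add, map_smul, bb, b_coord, mul_zero, add_zero, smul_eq_mul]
  refine ⟨skew, fun X Y => ?_, bl, bb⟩
  have hlin : ∀ (X : Sec m n A) (f : SmoothFun m Q), P (dualDiff m (linearFun X) α)
      (dualDiff m (fun γ => f γ.proj) α) = -L.d f α.proj (X α.proj) := fun X f => by
    rw [skew, bl]
  have h1 : ∀ b, P (dualDiff m (linearFun X) α) (dualDiff m (S.coord (.inr b)) α) =
      ∑ a, (S.β a α.proj (X α.proj) * -linearFun (L.bracket (S.X a) (S.X b)) α +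
        α.2 (S.X a α.proj) * L.d (pairing (S.β a) X) α.proj (S.X b α.proj)) := by
    intro b
    rw [S.differential_linearFun_eq_sum rfl X]
    simp only [map_sum, map_add, map_smul, LinearMap.sum_apply, LinearMap.add_apply,
      LinearMap.smul_apply, hP, b_coord, smul_eq_mul, AdaptedFrame.poisson]
  rw [S.differential_linearFun_eq_sum rfl Y]
  simp only [map_sum, map_add, map_smul, h1, hlin, smul_eq_mul]
  have h2 : linearFun (L.bracket X Y) α = α.2 (L.bracket X Y α.proj) := rfl
  rw [h2, L.bracket_eq_sum S X Y]
  simp only [map_sum, map_add, map_sub, map_smul, smul_eq_mul]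
  exact sum_bracket_identity _ _ _ _ _ _ _ fun a => hX Y _

theorem isLinearPoissonAt (α : DualTotal n A) : L.IsLinearPoissonAt α (L.linearPoisson α) := by
  obtain ⟨S⟩ := nonempty_adaptedFrame (m := m) (n := n) (A := A) α.proj
  obtain ⟨P, hs, hP⟩ := L.exists_bilinear_coord S
  exact Classical.epsilon_spec ⟨P, L.isLinearPoissonAt_of_coord S hs hP⟩

end LieAlgebroid

end Poisson

/-! ### Hamiltonian vector fields and their divergence with respect to ν ∧ Λ -/

section Hamiltonian

variable {m n : ℕ} {Q : Type*} [TopologicalSpace Q] [ChartedSpace (EuclideanSpace ℝ (Fin m)) Q]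
  [IsManifold (𝓡 m) ∞ Q]
  {A : Q → Type*} [TopologicalSpace (TotalSpace (Fib n) A)]
  [∀ q, TopologicalSpace (A q)] [∀ q, AddCommGroup (A q)] [∀ q, Module ℝ (A q)]
  [∀ q, IsTopologicalAddGroup (A q)] [∀ q, ContinuousSMul ℝ (A q)]
  [FiberBundle (Fib n) A] [VectorBundle ℝ (Fib n) A] [ContMDiffVectorBundle ∞ (Fib n) A (𝓡 m)]

theorem finrank_dual_fiber (q : Q) : FiniteDimensional ℝ (A q →L[ℝ] ℝ) ∧
    Module.finrank ℝ (A q →L[ℝ] ℝ) = n := by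
  have e := ((trivializationAt (DualFib n) (fun q => A q →L[ℝ] ℝ) q).continuousLinearEquivAt ℝ q
    (mem_baseSet_trivializationAt _ _ _)).toLinearEquiv
  exact ⟨e.symm.finiteDimensional, by
    rw [e.finrank_eq, Module.finrank_eq_card_basis (dualFibBasis n)]; simp⟩

/-- Evaluation at a vector, as a linear form on covectors. -/
def evalDual {q : Q} (w : A q) : Module.Dual ℝ (A q →L[ℝ] ℝ) where
  toFun β := β w
  map_add' _ _ := rfl
  map_smul' _ _ := rfl

theorem verticalLift_linear (α : DualTotal n A) :
    ∃ l : (A α.proj →L[ℝ] ℝ) →ₗ[ℝ] TangentSpace (dualModel m n) α,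
      ∀ β, l β = verticalLift (DualFib n) α β := by
  set e := trivializationAt (DualFib n) (fun q => A q →L[ℝ] ℝ) α.proj with he
  refine ⟨(LinearMap.inr ℝ (EuclideanSpace ℝ (Fin m)) (DualFib n)).comp
    (e.continuousLinearMapAt ℝ α.proj).toLinearMap, fun β => ?_⟩
  rw [verticalLift_eq]
  rfl

namespace LieAlgebroid

variable (L : LieAlgebroid m n A)

theorem apply_hamiltonianVectorField (H : DualTotal n A → ℝ) (α : DualTotal n A)
    (φ : Module.Dual ℝ (TangentSpace (dualModel m n) α)) :
    φ (L.hamiltonianVectorField H α) = L.linearPoisson α φ (dualDiff m H α) := by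
  unfold hamiltonianVectorField
  rw [Module.apply_evalEquiv_symm_apply]
  rfl

variable [T2Space Q]

/-- Valid at every α, not only over q₀, since the coordinates are built from global functions and
sections. Thus one frame describes the tensor on a neighbourhood, as differentiation requires. -/
theorem linearPoisson_coord {q₀ : Q} (S : AdaptedFrame m n A q₀) (α : DualTotal n A)
    (k l : Fin m ⊕ Fin n) :
    L.linearPoisson α (dualDiff m (S.coord k) α) (dualDiff m (S.coord l) α) =
      S.poisson L k l α := by
  have h := L.isLinearPoissonAt α
  rcases k with i | a <;> rcases l with j | b
  · exact h.basic_basic (S.f i) (S.f j)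
  · exact h.basic_linear (S.f i) (S.X b)
  · rw [h.skew]
    exact congrArg Neg.neg (h.basic_linear (S.f j) (S.X a))
  · exact h.linear_linear (S.X a) (S.X b)

theorem linearPoisson_coord_left {q₀ : Q} (S : AdaptedFrame m n A q₀) {α : DualTotal n A}
    {d : Fin m ⊕ Fin n → TangentSpace (dualModel m n) α}
    (hd : ∀ k l, differential (dualModel m n) (S.coord k) α (d l) = if k = l then 1 else 0)
    (k : Fin m ⊕ Fin n) (ψ : Module.Dual ℝ (TangentSpace (dualModel m n) α)) :
    L.linearPoisson α (dualDiff m (S.coord k) α) ψ = ∑ l, S.poisson L k l α * ψ (d l) := by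
  conv_lhs => rw [dual_eq_sum_smul_of_dual (φ := fun k => dualDiff m (S.coord k) α) (d := d)
    (AdaptedFrame.finrank_tangentSpace α) hd ψ]
  rw [map_sum]
  refine Finset.sum_congr rfl fun l _ => ?_
  rw [map_smul, L.linearPoisson_coord S, smul_eq_mul, mul_comm]

/-- Basic functions generate vertical vector fields. -/
theorem linearPoisson_basic {g : Q → ℝ} {α : DualTotal n A}
    (hg : MDifferentiableAt (𝓡 m) 𝓘(ℝ, ℝ) g α.proj)
    (ψ : Module.Dual ℝ (TangentSpace (dualModel m n) α)) :
    L.linearPoisson α (dualDiff m (fun γ : DualTotal n A => g γ.proj) α) ψ =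
      ψ (verticalLift (DualFib n) α (L.d g α.proj)) := by
  obtain ⟨S⟩ := nonempty_adaptedFrame (m := m) (n := n) (A := A) α.proj
  obtain ⟨D, -, hD⟩ := S.exists_dual_frame (α₀ := α) rfl
  have hD := hD.self_of_nhds
  conv_lhs => rw [dual_eq_sum_smul_of_dual (φ := fun k => dualDiff m (S.coord k) α)
    (d := fun k => D k α) (AdaptedFrame.finrank_tangentSpace α) hD ψ]
  conv_rhs => rw [dual_eq_sum_smul_of_dual (φ := fun k => dualDiff m (S.coord k) α)
    (d := fun k => D k α) (AdaptedFrame.finrank_tangentSpace α) hD ψ]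
  rw [map_sum, LinearMap.sum_apply]
  refine Finset.sum_congr rfl fun k _ => ?_
  rw [map_smul, LinearMap.smul_apply]
  congr 1
  rw [S.differential_comp_proj_eq_sum S.f_V.self_of_nhds hg]
  simp only [map_sum, map_smul, LinearMap.sum_apply, LinearMap.smul_apply, L.linearPoisson_coord S]
  rcases k with j | b
  · simp only [AdaptedFrame.poisson, smul_zero, Finset.sum_const_zero]
    exact (differential_comp_proj_verticalLift
      ((S.f j).contMDiff.mdifferentiable (by simp) _) _).symm
  · simp only [AdaptedFrame.poisson, smul_eq_mul]
    rw [L.sum_field_mul_d S]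
    exact (differential_linearFun_verticalLift (S.X b) α _).symm

theorem differential_comp_proj_hamiltonianVectorField {g : Q → ℝ} {α : DualTotal n A}
    (hg : MDifferentiableAt (𝓡 m) 𝓘(ℝ, ℝ) g α.proj) (H : DualTotal n A → ℝ) :
    differential (dualModel m n) (fun γ : DualTotal n A => g γ.proj) α
      (L.hamiltonianVectorField H α) =
      dualDiff m H α (verticalLift (DualFib n) α (L.d g α.proj)) := by
  rw [← L.linearPoisson_basic hg]
  exact L.apply_hamiltonianVectorField H α (dualDiff m (fun γ : DualTotal n A => g γ.proj) α)

theorem differential_coord_hamiltonianVectorField {q₀ : Q} (S : AdaptedFrame m n A q₀)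
    (H : DualTotal n A → ℝ) {α : DualTotal n A}
    {d : Fin m ⊕ Fin n → TangentSpace (dualModel m n) α}
    (hd : ∀ k l, differential (dualModel m n) (S.coord k) α (d l) = if k = l then 1 else 0)
    (k : Fin m ⊕ Fin n) :
    differential (dualModel m n) (S.coord k) α (L.hamiltonianVectorField H α) =
      ∑ l, S.poisson L k l α * differential (dualModel m n) H α (d l) := by
  have := L.apply_hamiltonianVectorField H α (dualDiff m (S.coord k) α)
  rw [L.linearPoisson_coord_left S hd] at this
  exact this

/-- The field is defined pointwise through a chosen tensor; near any point it coincides with Σ_k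
(Σ_l π_kl ∂_l H) ∂_k, whose coefficients are smooth. -/
theorem isSmoothVectorField_hamiltonianVectorField {H : DualTotal n A → ℝ}
    (hH : ContMDiff (dualModel m n) 𝓘(ℝ, ℝ) ∞ H) :
    IsSmoothVectorField (dualModel m n) (L.hamiltonianVectorField H) := by
  intro α₀
  obtain ⟨S⟩ := nonempty_adaptedFrame (m := m) (n := n) (A := A) α₀.proj
  obtain ⟨D, hDs, hD⟩ := S.exists_dual_frame (α₀ := α₀) rfl
  have h1 : IsSmoothVectorField (dualModel m n) (fun α => ∑ k, (∑ l, S.poisson L k l α *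
      differential (dualModel m n) H α (D l α)) • D k α) := by
    refine ContMDiff.sum_section fun k _ => ?_
    refine ContMDiff.smul_section ?_ (hDs k)
    exact contMDiff_finsetSum fun l _ =>
      (S.contMDiff_poisson L k l).mul (contMDiff_differential_apply hH (hDs l))
  refine (h1 α₀).congr_of_eventuallyEq ?_
  filter_upwards [hD] with α hα
  congr 1
  conv_lhs => rw [eq_sum_smul_of_dual (φ := fun k => differential (dualModel m n) (S.coord k) α)
    (d := fun k => D k α) (AdaptedFrame.finrank_tangentSpace α) hα (L.hamiltonianVectorField H α)]
  simp only [L.differential_coord_hamiltonianVectorField S H hα]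

end LieAlgebroid

namespace AdaptedFrame

variable {q₀ : Q} (S : AdaptedFrame m n A q₀)

theorem differential_coord_verticalLift {α : DualTotal n A}
    (h : ∀ a b, S.β a α.proj (S.X b α.proj) = if a = b then 1 else 0)
    (k : Fin m ⊕ Fin n) (a : Fin n) :
    differential (dualModel m n) (S.coord k) α (verticalLift (DualFib n) α (S.β a α.proj)) =
      if k = Sum.inr a then 1 else 0 := by
  rcases k with i | b
  · simpa using! differential_comp_proj_verticalLift
      ((S.f i).contMDiff.mdifferentiable (by simp) α.proj) (S.β a α.proj)
  · refine (differential_linearFun_verticalLift (S.X b) α (S.β a α.proj)).trans ?_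
    simp [h, eq_comm]

theorem dual_frame_inr {α : DualTotal n A}
    (h : ∀ a b, S.β a α.proj (S.X b α.proj) = if a = b then 1 else 0)
    {d : Fin m ⊕ Fin n → TangentSpace (dualModel m n) α}
    (hd : ∀ k l, differential (dualModel m n) (S.coord k) α (d l) = if k = l then 1 else 0)
    (a : Fin n) : d (.inr a) = verticalLift (DualFib n) α (S.β a α.proj) := by
  rw [eq_sum_smul_of_dual (φ := fun k => differential (dualModel m n) (S.coord k) α)
    (AdaptedFrame.finrank_tangentSpace α) hd (verticalLift (DualFib n) α (S.β a α.proj))]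
  simp [S.differential_coord_verticalLift h]

theorem mfderiv_proj_dual_frame {α : DualTotal n A}
    (h : ∀ i j, differential (𝓡 m) (S.f i) α.proj (S.V j α.proj) = if i = j then 1 else 0)
    {d : Fin m ⊕ Fin n → TangentSpace (dualModel m n) α}
    (hd : ∀ k l, differential (dualModel m n) (S.coord k) α (d l) = if k = l then 1 else 0)
    (i : Fin m) :
    mfderiv (dualModel m n) (𝓡 m) TotalSpace.proj α (d (.inl i)) = S.V i α.proj := by
  rw [S.eq_sum_field h (mfderiv (dualModel m n) (𝓡 m) TotalSpace.proj α (d (.inl i)))]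
  have : ∀ j, differential (𝓡 m) (S.f j) α.proj
      (mfderiv (dualModel m n) (𝓡 m) TotalSpace.proj α (d (.inl i))) = if j = i then 1 else 0 := by
    intro j
    rw [← differential_comp_proj ((S.f j).contMDiff.mdifferentiable (by simp) α.proj)]
    simpa using! hd (.inl j) (.inl i)
  simp [this]

/-- The component of `ν ∧ Λ` in an adapted frame. -/
def vol (ν : FormField (𝓡 m) (M := Q) (Fin m)) (Λ : MultivectorField (n := n) A) (q : Q) : ℝ :=
  ν q (fun i => S.V i q) * Λ q (fun a => S.β a q)

theorem contMDiff_vol {ν : FormField (𝓡 m) (M := Q) (Fin m)} {Λ : MultivectorField (n := n) A}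
    (hν : IsVolumeForm (𝓡 m) ν) (hΛ : IsVolumeSection m Λ) :
    ContMDiff (𝓡 m) 𝓘(ℝ, ℝ) ∞ (S.vol ν Λ) :=
  (hν.1 S.V S.V_smooth).mul (hΛ.1 S.β)

theorem wedge_eq {α : DualTotal n A} (ν : FormField (𝓡 m) (M := Q) (Fin m))
    (Λ : MultivectorField (n := n) A)
    (h₁ : ∀ i j, differential (𝓡 m) (S.f i) α.proj (S.V j α.proj) = if i = j then 1 else 0)
    (h₂ : ∀ a b, S.β a α.proj (S.X b α.proj) = if a = b then 1 else 0)
    {d : Fin m ⊕ Fin n → TangentSpace (dualModel m n) α}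
    (hd : ∀ k l, differential (dualModel m n) (S.coord k) α (d l) = if k = l then 1 else 0)
    (v : Fin m ⊕ Fin n → TangentSpace (dualModel m n) α) :
    wedge ν Λ α v = S.vol ν Λ α.proj *
      (Matrix.of fun j k => differential (dualModel m n) (S.coord k) α (v j)).det := by
  rw [alternatingMap_eq_mul_det (φ := fun k => differential (dualModel m n) (S.coord k) α)
    (AdaptedFrame.finrank_tangentSpace α) hd]
  congr 1
  have hw : IsWedgeAt m ν Λ α (wedge ν Λ α) := Classical.choose_spec (exists_isWedgeAt ν Λ α)
  have h3 : d = Sum.elim (fun i => d (.inl i))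
      (fun a => verticalLift (DualFib n) α (S.β a α.proj)) := by
    funext k
    rcases k with i | a
    · rfl
    · exact S.dual_frame_inr h₂ hd a
  rw [h3, hw]
  simp only [S.mfderiv_proj_dual_frame h₁ hd]
  rfl

theorem vol_ne_zero {q : Q} {ν : FormField (𝓡 m) (M := Q) (Fin m)}
    {Λ : MultivectorField (n := n) A} (hν : ν q ≠ 0) (hΛ : Λ q ≠ 0)
    (h₁ : ∀ i j, differential (𝓡 m) (S.f i) q (S.V j q) = if i = j then 1 else 0)
    (h₂ : ∀ a b, S.β a q (S.X b q) = if a = b then 1 else 0) : S.vol ν Λ q ≠ 0 := by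
  refine mul_ne_zero (fun h => hν ?_) (fun h => hΛ ?_)
  · ext v
    rw [alternatingMap_eq_mul_det (φ := fun i => differential (𝓡 m) (S.f i) q)
      (d := fun i => S.V i q) ((finrank_euclideanSpace_fin (𝕜 := ℝ)).trans (by simp)) h₁, h]
    simp
  · ext v
    have hf := finrank_dual_fiber (n := n) (A := A) q
    have := hf.1
    rw [alternatingMap_eq_mul_det (W := A q →L[ℝ] ℝ) (φ := fun a => evalDual (S.X a q))
      (d := fun a => S.β a q) (by rw [hf.2]; simp) (fun a b => by simp [evalDual, h₂, eq_comm]), h]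
    simp

end AdaptedFrame

namespace LieAlgebroid

variable [T2Space Q] (L : LieAlgebroid m n A)

/-- Coordinate fields commute: the functions ∂_l y_j are locally constant, so the bracket
annihilates all coordinates. -/
theorem mlieBracket_dual_frame {q₀ : Q} (S : AdaptedFrame m n A q₀) {α₀ : DualTotal n A}
    {D : Fin m ⊕ Fin n → ∀ α : DualTotal n A, TangentSpace (dualModel m n) α}
    (hDs : ∀ k, IsSmoothVectorField (dualModel m n) (D k))
    (hD : ∀ᶠ α in 𝓝 α₀, ∀ k l, differential (dualModel m n) (S.coord k) α (D l α) =
        if k = l then 1 else 0) (k l : Fin m ⊕ Fin n) :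
    VectorField.mlieBracket (dualModel m n) (D k) (D l) α₀ = 0 := by
  rw [eq_sum_smul_of_dual (φ := fun k => differential (dualModel m n) (S.coord k) α₀)
    (AdaptedFrame.finrank_tangentSpace α₀) hD.self_of_nhds
    (VectorField.mlieBracket (dualModel m n) (D k) (D l) α₀)]
  refine Finset.sum_eq_zero fun j _ => ?_
  have h : ∀ l, (fun α => differential (dualModel m n) (S.coord j) α (D l α)) =ᶠ[𝓝 α₀]
      fun _ => if j = l then 1 else 0 := fun l => by
    filter_upwards [hD] with α hα
    exact hα j l
  rw [differential_mlieBracket ((hDs k α₀).mdifferentiableAt (by simp))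
    ((hDs l α₀).mdifferentiableAt (by simp))
    ((S.contMDiff_coord j α₀).of_le (by exact WithTop.coe_le_coe.2 le_top)),
    differential_congr (h k), differential_congr (h l), differential_const, differential_const]
  simp

theorem differential_differential_comm {q₀ : Q} (S : AdaptedFrame m n A q₀) {α₀ : DualTotal n A}
    {D : Fin m ⊕ Fin n → ∀ α : DualTotal n A, TangentSpace (dualModel m n) α}
    (hDs : ∀ k, IsSmoothVectorField (dualModel m n) (D k))
    (hD : ∀ᶠ α in 𝓝 α₀, ∀ k l, differential (dualModel m n) (S.coord k) α (D l α) =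
        if k = l then 1 else 0) {H : DualTotal n A → ℝ}
    (hH : ContMDiff (dualModel m n) 𝓘(ℝ, ℝ) ∞ H) (k l : Fin m ⊕ Fin n) :
    differential (dualModel m n) (fun α => differential (dualModel m n) H α (D l α)) α₀ (D k α₀) =
    differential (dualModel m n) (fun α => differential (dualModel m n) H α (D k α)) α₀ (D l α₀) := by
  have h := differential_mlieBracket ((hDs k α₀).mdifferentiableAt (by simp))
    ((hDs l α₀).mdifferentiableAt (by simp))
    ((hH α₀).of_le (by exact WithTop.coe_le_coe.2 le_top))
  rw [mlieBracket_dual_frame S hDs hD, map_zero] at h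
  exact (sub_eq_zero.1 h.symm)

/-- The component of the modular section in an adapted frame that comes from the structure
functions of the algebroid. -/
def structureTrace {q₀ : Q} (S : AdaptedFrame m n A q₀) (b : Fin n) : ℝ :=
  ∑ j, differential (𝓡 m) (fun q => L.d (S.f j) q (S.X b q)) q₀ (S.V j q₀) -
    ∑ a, S.β a q₀ (L.bracket (S.X a) (S.X b) q₀)

/-- Here linearity of the Poisson structure enters: brackets of base coordinates are zero, anchor
components are constant along the fibres, and the bracket components are linear in the momenta, so
their fibre derivatives depend on the base point alone. -/
theorem sum_differential_poisson {α : DualTotal n A} (S : AdaptedFrame m n A α.proj)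
    {d : Fin m ⊕ Fin n → TangentSpace (dualModel m n) α}
    (hd : ∀ k l, differential (dualModel m n) (S.coord k) α (d l) = if k = l then 1 else 0)
    (l : Fin m ⊕ Fin n) :
    ∑ k, differential (dualModel m n) (S.poisson L k l) α (d k) =
      Sum.elim (fun _ => 0) (L.structureTrace S) l := by
  have hr : ∀ a, d (.inr a) = _ := S.dual_frame_inr S.β_X.self_of_nhds hd
  have hl := S.mfderiv_proj_dual_frame S.f_V.self_of_nhds hd
  have hs : ∀ i b, MDifferentiableAt (𝓡 m) 𝓘(ℝ, ℝ) (fun q => L.d (S.f i) q (S.X b q)) α.proj :=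
    fun i b => (L.contMDiff_d_apply (S.f i) (S.X b)).mdifferentiable (by simp) _
  rw [Fintype.sum_sum_type]
  rcases l with i | b
  · have h1 : ∀ j, differential (dualModel m n) (S.poisson L (.inl j) (.inl i)) α = 0 := fun j =>
      differential_const 0 α
    have h2 : ∀ a, differential (dualModel m n) (S.poisson L (.inr a) (.inl i)) α (d (.inr a)) = 0 := by
      intro a
      rw [hr]
      exact differential_comp_proj_verticalLift (hs i a).neg _
    simp [h1, h2]
  · have h1 : ∀ j, differential (dualModel m n) (S.poisson L (.inl j) (.inr b)) α (d (.inl j)) =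
        differential (𝓡 m) (fun q => L.d (S.f j) q (S.X b q)) α.proj (S.V j α.proj) := by
      intro j
      rw [← hl]
      exact differential_comp_proj (hs j b) _
    have h2 : ∀ a, differential (dualModel m n) (S.poisson L (.inr a) (.inr b)) α (d (.inr a)) =
        -S.β a α.proj (L.bracket (S.X a) (S.X b) α.proj) := by
      intro a
      rw [hr]
      have : S.poisson L (.inr a) (.inr b) = linearFun (-L.bracket (S.X a) (S.X b)) := by
        funext γ
        simp [AdaptedFrame.poisson, linearFun]
      rw [this, differential_linearFun_verticalLift]
      simp
    simp only [h1, h2, Finset.sum_neg_distrib, structureTrace, Sum.elim_inr]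
    ring

/-- The divergence of a hamiltonian vector field, in an adapted frame. -/
theorem lieDerivativeForm_hamiltonianVectorField {α : DualTotal n A}
    (S : AdaptedFrame m n A α.proj)
    {ν : FormField (𝓡 m) (M := Q) (Fin m)} {Λ : MultivectorField (n := n) A}
    (hν : IsVolumeForm (𝓡 m) ν) (hΛ : IsVolumeSection m Λ) {H : DualTotal n A → ℝ}
    (hH : ContMDiff (dualModel m n) 𝓘(ℝ, ℝ) ∞ H)
    {X : Fin m ⊕ Fin n → ∀ α : DualTotal n A, TangentSpace (dualModel m n) α}
    (hX : ∀ k, IsSmoothVectorField (dualModel m n) (X k)) :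
    lieDerivativeForm (dualModel m n) (L.hamiltonianVectorField H) (wedge ν Λ) X α =
      dualDiff m H α (verticalLift (DualFib n) α ((S.vol ν Λ α.proj)⁻¹ • L.d (S.vol ν Λ) α.proj +
        ∑ b, L.structureTrace S b • S.β b α.proj)) * wedge ν Λ α (fun k => X k α) := by
  obtain ⟨D, hDs, hD⟩ := S.exists_dual_frame (α₀ := α) rfl
  have hD0 := hD.self_of_nhds
  have hc : Filter.Tendsto (TotalSpace.proj : DualTotal n A → Q) (𝓝 α) (𝓝 α.proj) :=
    (FiberBundle.continuous_proj _ _).tendsto _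
  have hvol := S.contMDiff_vol hν hΛ
  set z : Fin m ⊕ Fin n → DualTotal n A → ℝ := fun k α => ∑ l, S.poisson L k l α *
      differential (dualModel m n) H α (D l α) with hz
  have hzd : ∀ k, differential (dualModel m n)
      (fun α => differential (dualModel m n) (S.coord k) α (L.hamiltonianVectorField H α)) α =
      differential (dualModel m n) (z k) α := by
    intro k
    apply differential_congr
    filter_upwards [hD] with γ hγ
    exact L.differential_coord_hamiltonianVectorField S H hγ k
  have hdH : ∀ l, ContMDiff (dualModel m n) 𝓘(ℝ, ℝ) ∞
      (fun α => differential (dualModel m n) H α (D l α)) := fun l =>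
    contMDiff_differential_apply hH (hDs l)
  have hmd : ∀ k l, MDifferentiableAt (dualModel m n) 𝓘(ℝ, ℝ) (S.poisson L k l) α := fun k l =>
    (S.contMDiff_poisson L k l).mdifferentiable (by simp) _
  have hmd' : ∀ l, MDifferentiableAt (dualModel m n) 𝓘(ℝ, ℝ)
      (fun α => differential (dualModel m n) H α (D l α)) α := fun l =>
    (hdH l).mdifferentiable (by simp) _
  have hdz : ∀ k, differential (dualModel m n) (z k) α = ∑ l,
      (S.poisson L k l α • differential (dualModel m n)
        (fun α => differential (dualModel m n) H α (D l α)) α +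
      differential (dualModel m n) H α (D l α) • differential (dualModel m n) (S.poisson L k l) α) := by
    intro k
    rw [hz, (differential_sum (f := fun l α => S.poisson L k l α *
      differential (dualModel m n) H α (D l α)) _ fun l _ =>
      ((hmd k l).hasMFDerivAt.mul (hmd' l).hasMFDerivAt).mdifferentiableAt).2]
    exact Finset.sum_congr rfl fun l _ => differential_mul (hmd k l) (hmd' l)
  -- The matrix is B_lk = ∂_l z_k with z_k = ℋ_H(y_k), so its trace is the coordinate divergence.
  rw [lieDerivativeForm_eq_of_coordinates (y := S.coord) (g := fun γ => S.vol ν Λ γ.proj)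
    (B := Matrix.of fun l k => differential (dualModel m n) (z k) α (D l α)) ?_ S.contMDiff_coord
    (L.isSmoothVectorField_hamiltonianVectorField hH) hX
    ((contMDiff_comp_proj hvol).mdifferentiable (by simp) _) ?_]
  · rw [S.wedge_eq ν Λ S.f_V.self_of_nhds S.β_X.self_of_nhds hD0, ← mul_assoc]
    congr 1
    have hv0 : S.vol ν Λ α.proj ≠ 0 := S.vol_ne_zero (hν.2 _) (hΛ.2 _) S.f_V.self_of_nhds
      S.β_X.self_of_nhds
    rw [L.differential_comp_proj_hamiltonianVectorField (hvol.mdifferentiable (by simp) _)]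
    obtain ⟨l, hl⟩ := verticalLift_linear (m := m) α
    simp only [← hl, map_add, map_smul, map_sum, smul_eq_mul]
    have htr : Matrix.trace (Matrix.of fun l k => differential (dualModel m n) (z k) α (D l α)) =
        ∑ b, L.structureTrace S b * dualDiff m H α (l (S.β b α.proj)) := by
      set s : Fin m ⊕ Fin n → Fin m ⊕ Fin n → ℝ := fun k l => differential (dualModel m n)
        (fun α => differential (dualModel m n) H α (D l α)) α (D k α) with hs
      have hsym : ∀ k l, s k l = s l k := fun k l => differential_differential_comm S hDs hD hH k l
      -- The second derivatives of H form a symmetric array because the coordinate fields commute;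
      -- contracted with the skew π_kl they vanish.
      have hanti : ∑ k, ∑ l, S.poisson L k l α * s k l = 0 := by
        have h : ∑ k, ∑ l, S.poisson L k l α * s k l = -∑ k, ∑ l, S.poisson L k l α * s k l := by
          conv_lhs => rw [Finset.sum_comm]
          simp only [← Finset.sum_neg_distrib]
          refine Finset.sum_congr rfl fun k _ => Finset.sum_congr rfl fun l _ => ?_
          rw [S.poisson_skew L l k α, hsym l k]
          ring
        linarith
      have h1 : Matrix.trace (Matrix.of fun l k =>
          differential (dualModel m n) (z k) α (D l α)) =
          ∑ k, ∑ l, S.poisson L k l α * s k l + ∑ l, differential (dualModel m n) H α (D l α) *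
            ∑ k, differential (dualModel m n) (S.poisson L k l) α (D k α) := by
        simp only [Finset.mul_sum]
        rw [Finset.sum_comm (f := fun l k => differential (dualModel m n) H α (D l α) *
          differential (dualModel m n) (S.poisson L k l) α (D k α)), ← Finset.sum_add_distrib]
        refine Finset.sum_congr rfl fun k _ => ?_
        simp only [Matrix.diag_apply, Matrix.of_apply, hdz, LinearMap.sum_apply,
          LinearMap.add_apply, LinearMap.smul_apply, smul_eq_mul, Finset.sum_add_distrib, hs]
      rw [h1, hanti, zero_add]
      simp only [L.sum_differential_poisson S hD0, Fintype.sum_sum_type, Sum.elim_inl,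
        Sum.elim_inr, mul_zero, Finset.sum_const_zero, zero_add]
      refine Finset.sum_congr rfl fun b _ => ?_
      rw [mul_comm, hl, ← S.dual_frame_inr S.β_X.self_of_nhds hD0 b]
      rfl
    rw [htr]
    field_simp
  · filter_upwards [hD, hc.eventually S.f_V, hc.eventually S.β_X] with γ h1 h2 h3 v
    exact S.wedge_eq ν Λ h2 h3 h1 v
  · intro k
    rw [hzd]
    exact dual_eq_sum_smul_of_dual (φ := fun k => differential (dualModel m n) (S.coord k) α)
      (AdaptedFrame.finrank_tangentSpace α) hD0 _

end LieAlgebroid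
end Hamiltonian

/-! ### Smoothness of determinants and inverse matrices, and exponential factors -/

section Matrix

variable {E : Type*} [NormedAddCommGroup E] [NormedSpace ℝ E]
  {H : Type*} [TopologicalSpace H] {I : ModelWithCorners ℝ E H}
  {M : Type*} [TopologicalSpace M] [ChartedSpace H M] {ι : Type*} [Fintype ι] [DecidableEq ι]

theorem contMDiff_det {N : M → Matrix ι ι ℝ}
    (hN : ∀ i j, ContMDiff I 𝓘(ℝ, ℝ) ∞ (fun x => N x i j)) :
    ContMDiff I 𝓘(ℝ, ℝ) ∞ (fun x => (N x).det) := by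
  simp only [Matrix.det_apply']
  exact contMDiff_finsetSum fun σ _ => contMDiff_const.mul (contMDiff_finsetProd fun i _ => hN _ _)

/-- The entries of the adjugate are themselves determinants of smooth matrices. -/
theorem contMDiffAt_inv_apply {N : M → Matrix ι ι ℝ}
    (hN : ∀ i j, ContMDiff I 𝓘(ℝ, ℝ) ∞ (fun x => N x i j)) {x : M} (hx : (N x).det ≠ 0) (i j : ι) :
    ContMDiffAt I 𝓘(ℝ, ℝ) ∞ (fun x => (N x)⁻¹ i j) x := by
  simp only [Matrix.inv_def, Matrix.smul_apply, Ring.inverse_eq_inv', Matrix.adjugate_apply,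
    smul_eq_mul]
  refine ((contMDiff_det hN x).inv₀ hx).mul (contMDiff_det (fun k l => ?_) x)
  simp only [Matrix.updateRow_apply]
  split_ifs
  · exact contMDiff_const
  · exact hN k l

end Matrix

section Exp

variable {E : Type*} [NormedAddCommGroup E] [NormedSpace ℝ E]
  {H : Type*} [TopologicalSpace H] {I : ModelWithCorners ℝ E H}
  {M : Type*} [TopologicalSpace M] [ChartedSpace H M] [IsManifold I 1 M] {ι : Type*}

theorem contMDiff_exp {s : M → ℝ} (hs : ContMDiff I 𝓘(ℝ, ℝ) ∞ s) :
    ContMDiff I 𝓘(ℝ, ℝ) ∞ (fun x => Real.exp (s x)) :=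
  Real.contDiff_exp.contMDiff.comp hs

theorem IsVolumeForm.expSMul {Φ : FormField I (M := M) ι} (hΦ : IsVolumeForm I Φ) {s : M → ℝ}
    (hs : ContMDiff I 𝓘(ℝ, ℝ) ∞ s) : IsVolumeForm I (expSMul I s Φ) :=
  ⟨fun X hX => (contMDiff_exp hs).mul (hΦ.1 X hX),
    fun x => smul_ne_zero (Real.exp_pos _).ne' (hΦ.2 x)⟩

end Exp

/-! ### Modular sections and their dependence on the volume -/

section Modular

variable {m n : ℕ} {Q : Type*} [TopologicalSpace Q] [ChartedSpace (EuclideanSpace ℝ (Fin m)) Q]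
  [IsManifold (𝓡 m) ∞ Q]
  {A : Q → Type*} [TopologicalSpace (TotalSpace (Fib n) A)]
  [∀ q, TopologicalSpace (A q)] [∀ q, AddCommGroup (A q)] [∀ q, Module ℝ (A q)]
  [∀ q, IsTopologicalAddGroup (A q)] [∀ q, ContinuousSMul ℝ (A q)]
  [FiberBundle (Fib n) A] [VectorBundle ℝ (Fib n) A] [ContMDiffVectorBundle ∞ (Fib n) A (𝓡 m)]
  [T2Space Q]
  {ν : FormField (𝓡 m) (M := Q) (Fin m)} {Λ : MultivectorField (n := n) A}

namespace AdaptedFrame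

theorem wedge_dual_frame {q₀ : Q} (S : AdaptedFrame m n A q₀) {α : DualTotal n A}
    (h₁ : ∀ i j, differential (𝓡 m) (S.f i) α.proj (S.V j α.proj) = if i = j then 1 else 0)
    (h₂ : ∀ a b, S.β a α.proj (S.X b α.proj) = if a = b then 1 else 0)
    {d : Fin m ⊕ Fin n → TangentSpace (dualModel m n) α}
    (hd : ∀ k l, differential (dualModel m n) (S.coord k) α (d l) = if k = l then 1 else 0) :
    wedge ν Λ α d = S.vol ν Λ α.proj := by
  rw [S.wedge_eq ν Λ h₁ h₂ hd]
  have : (Matrix.of fun j k => differential (dualModel m n) (S.coord k) α (d j)) = 1 := by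
    ext j k
    simp [hd, Matrix.one_apply, eq_comm]
  rw [this, Matrix.det_one, mul_one]

end AdaptedFrame

/-- Divergences and preservation are tested on global smooth fields; these suffice to cancel ν ∧ Λ
at any given point. -/
theorem exists_wedge_ne_zero (hν : IsVolumeForm (𝓡 m) ν) (hΛ : IsVolumeSection m Λ)
    (α : DualTotal n A) :
    ∃ X : Fin m ⊕ Fin n → ∀ α : DualTotal n A, TangentSpace (dualModel m n) α,
      (∀ k, IsSmoothVectorField (dualModel m n) (X k)) ∧ wedge ν Λ α (fun k => X k α) ≠ 0 := by
  obtain ⟨S⟩ := nonempty_adaptedFrame (m := m) (n := n) (A := A) α.proj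
  obtain ⟨D, hDs, hD⟩ := S.exists_dual_frame (α₀ := α) rfl
  refine ⟨D, hDs, ?_⟩
  rw [S.wedge_dual_frame S.f_V.self_of_nhds S.β_X.self_of_nhds hD.self_of_nhds]
  exact S.vol_ne_zero (hν.2 _) (hΛ.2 _) S.f_V.self_of_nhds S.β_X.self_of_nhds

theorem isVolumeForm_wedge (hν : IsVolumeForm (𝓡 m) ν) (hΛ : IsVolumeSection m Λ) :
    IsVolumeForm (dualModel m n) (wedge ν Λ) := by
  refine ⟨fun X hX α₀ => ?_, fun α h => ?_⟩
  · obtain ⟨S⟩ := nonempty_adaptedFrame (m := m) (n := n) (A := A) α₀.proj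
    obtain ⟨D, hDs, hD⟩ := S.exists_dual_frame (α₀ := α₀) rfl
    have hc : Filter.Tendsto (TotalSpace.proj : DualTotal n A → Q) (𝓝 α₀) (𝓝 α₀.proj) :=
      (FiberBundle.continuous_proj _ _).tendsto _
    have hs : ContMDiff (dualModel m n) 𝓘(ℝ, ℝ) ∞ (fun α : DualTotal n A => S.vol ν Λ α.proj *
        (Matrix.of fun j k => differential (dualModel m n) (S.coord k) α (X j α)).det) := by
      exact (contMDiff_comp_proj (S.contMDiff_vol hν hΛ)).mul (contMDiff_det fun i j =>
        contMDiff_differential_apply (S.contMDiff_coord _) (hX _))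
    refine (hs α₀).congr_of_eventuallyEq ?_
    filter_upwards [hD, hc.eventually S.f_V, hc.eventually S.β_X] with γ h1 h2 h3
    exact S.wedge_eq ν Λ h2 h3 h1 _
  · obtain ⟨X, -, hX⟩ := exists_wedge_ne_zero hν hΛ α
    exact hX (by rw [h]; rfl)

/-- Any two volume forms of the form `ν ∧ Λ` differ by a basic function. -/
theorem exists_wedge_eq_smul {ν' : FormField (𝓡 m) (M := Q) (Fin m)}
    {Λ' : MultivectorField (n := n) A} (hν : IsVolumeForm (𝓡 m) ν) (hΛ : IsVolumeSection m Λ)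
    (hν' : IsVolumeForm (𝓡 m) ν') (hΛ' : IsVolumeSection m Λ') :
    ∃ h : Q → ℝ, ContMDiff (𝓡 m) 𝓘(ℝ, ℝ) ∞ h ∧ (∀ q, h q ≠ 0) ∧
      ∀ α : DualTotal n A, wedge ν' Λ' α = h α.proj • wedge ν Λ α := by
  obtain ⟨S⟩ : Nonempty (∀ q, AdaptedFrame m n A q) := ⟨fun q => (nonempty_adaptedFrame q).some⟩
  have hv : ∀ q, (S q).vol ν Λ q ≠ 0 := fun q =>
    (S q).vol_ne_zero (hν.2 _) (hΛ.2 _) (S q).f_V.self_of_nhds (S q).β_X.self_of_nhds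
  have hv' : ∀ q, (S q).vol ν' Λ' q ≠ 0 := fun q =>
    (S q).vol_ne_zero (hν'.2 _) (hΛ'.2 _) (S q).f_V.self_of_nhds (S q).β_X.self_of_nhds
  have hw : ∀ α : DualTotal n A, wedge ν' Λ' α =
      ((S α.proj).vol ν' Λ' α.proj / (S α.proj).vol ν Λ α.proj) • wedge ν Λ α := by
    intro α
    obtain ⟨D, hDs, hD⟩ := (S α.proj).exists_dual_frame (α₀ := α) rfl
    have hD := hD.self_of_nhds
    ext v
    rw [AlternatingMap.smul_apply,
      (S α.proj).wedge_eq ν Λ (S α.proj).f_V.self_of_nhds (S α.proj).β_X.self_of_nhds hD,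
      (S α.proj).wedge_eq ν' Λ' (S α.proj).f_V.self_of_nhds (S α.proj).β_X.self_of_nhds hD,
      smul_eq_mul, ← mul_assoc, div_mul_cancel₀ _ (hv _)]
  -- At each q the ratio is read in a frame centred at q. It is smooth because, near q₀, it equals
  -- the ratio in the single frame centred at q₀; the zero section brings the coordinate fields of
  -- A* back to Q for this comparison.
  refine ⟨fun q => (S q).vol ν' Λ' q / (S q).vol ν Λ q, fun q₀ => ?_,
    fun q => div_ne_zero (hv' q) (hv q), hw⟩
  have hs : ContMDiffAt (𝓡 m) 𝓘(ℝ, ℝ) ∞ (fun q => (S q₀).vol ν' Λ' q / (S q₀).vol ν Λ q) q₀ :=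
    ((S q₀).contMDiff_vol hν' hΛ' q₀).div₀ ((S q₀).contMDiff_vol hν hΛ q₀) (hv q₀)
  refine hs.congr_of_eventuallyEq ?_
  obtain ⟨D, hDs, hD⟩ := (S q₀).exists_dual_frame (α₀ := zeroSection n A q₀) rfl
  have hc : Filter.Tendsto (zeroSection n A) (𝓝 q₀) (𝓝 (zeroSection n A q₀)) :=
    (Bundle.contMDiff_zeroSection ℝ (fun q => A q →L[ℝ] ℝ)
      (F := DualFib n) (IB := 𝓡 m) (n := ∞)).continuous.tendsto _
  filter_upwards [hc.eventually hD, (S q₀).f_V, (S q₀).β_X] with q h1 h2 h3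
  have h4 : (S q₀).vol ν Λ q ≠ 0 := (S q₀).vol_ne_zero (hν.2 _) (hΛ.2 _) h2 h3
  have h5 := (S q₀).wedge_dual_frame (ν := ν') (Λ := Λ') (α := zeroSection n A q) h2 h3 h1
  rw [hw, AlternatingMap.smul_apply,
    (S q₀).wedge_dual_frame (α := zeroSection n A q) h2 h3 h1] at h5
  rw [eq_div_iff h4]
  exact h5

theorem wedge_expSMul (s : Q → ℝ) (α : DualTotal n A) :
    wedge (expSMul (𝓡 m) s ν) Λ α = Real.exp (s α.proj) • wedge ν Λ α := by
  obtain ⟨S⟩ := nonempty_adaptedFrame (m := m) (n := n) (A := A) α.proj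
  obtain ⟨D, hDs, hD⟩ := S.exists_dual_frame (α₀ := α) rfl
  have hD := hD.self_of_nhds
  ext v
  rw [AlternatingMap.smul_apply, S.wedge_eq _ Λ S.f_V.self_of_nhds S.β_X.self_of_nhds hD,
    S.wedge_eq _ Λ S.f_V.self_of_nhds S.β_X.self_of_nhds hD, smul_eq_mul, ← mul_assoc]
  congr 1
  simp [AdaptedFrame.vol, expSMul, mul_assoc]

theorem covector_ext {q : Q} {β γ : A q →L[ℝ] ℝ} (h : ∀ X : Sec m n A, β (X q) = γ (X q)) :
    β = γ := by
  obtain ⟨S⟩ := nonempty_adaptedFrame (m := m) (n := n) (A := A) q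
  ext w
  rw [S.eq_sum_sec S.β_X.self_of_nhds w]
  simp [h]

namespace LieAlgebroid

variable (L : LieAlgebroid m n A)

theorem isModularSection_modularSection (hν : IsVolumeForm (𝓡 m) ν) (hΛ : IsVolumeSection m Λ) :
    L.IsModularSection ν Λ (L.modularSection ν Λ) := by
  refine Classical.epsilon_spec (p := L.IsModularSection ν Λ) ?_
  obtain ⟨S⟩ : Nonempty (∀ q, AdaptedFrame m n A q) := ⟨fun q => (nonempty_adaptedFrame q).some⟩
  -- The divergence formula at α uses only a frame centred at its base point, so frames may be
  -- chosen independently for each q.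
  exact ⟨fun q => ((S q).vol ν Λ q)⁻¹ • L.d ((S q).vol ν Λ) q +
      ∑ b, L.structureTrace (S q) b • (S q).β b q,
    fun H X hX α => L.lieDerivativeForm_hamiltonianVectorField (S α.proj) hν hΛ H.contMDiff hX⟩

theorem lieDerivativeForm_smul_wedge (hν : IsVolumeForm (𝓡 m) ν) (hΛ : IsVolumeSection m Λ)
    {H h : DualTotal n A → ℝ} (hH : ContMDiff (dualModel m n) 𝓘(ℝ, ℝ) ∞ H)
    (hh : ContMDiff (dualModel m n) 𝓘(ℝ, ℝ) ∞ h)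
    {X : Fin m ⊕ Fin n → ∀ α : DualTotal n A, TangentSpace (dualModel m n) α}
    (hX : ∀ k, IsSmoothVectorField (dualModel m n) (X k)) (α : DualTotal n A) :
    lieDerivativeForm (dualModel m n) (L.hamiltonianVectorField H)
      (fun α => h α • wedge ν Λ α) X α =
      (dualDiff m h α (L.hamiltonianVectorField H α) + h α * dualDiff m H α
        (verticalLift (DualFib n) α (L.modularSection ν Λ α.proj))) *
        wedge ν Λ α (fun k => X k α) := by
  have h1 : lieDerivativeForm (dualModel m n) (L.hamiltonianVectorField H) (wedge ν Λ) X α = _ :=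
    L.isModularSection_modularSection hν hΛ ⟨H, hH⟩ X hX α
  rw [lieDerivativeForm_smul (hh.mdifferentiable (by simp) _)
    (((isVolumeForm_wedge hν hΛ).1 X hX).mdifferentiable (by simp) _),
    h1, add_mul, mul_assoc]
  rfl

/-- The Lie derivative of e^s ν∧Λ is e^s ({s,H} + M^v(H)) ν∧Λ, and ν∧Λ is nowhere zero. -/
theorem preserves_expSMul_iff (hν : IsVolumeForm (𝓡 m) ν) (hΛ : IsVolumeSection m Λ)
    {H s : DualTotal n A → ℝ} (hH : ContMDiff (dualModel m n) 𝓘(ℝ, ℝ) ∞ H)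
    (hs : ContMDiff (dualModel m n) 𝓘(ℝ, ℝ) ∞ s) :
    Preserves (dualModel m n) (L.hamiltonianVectorField H)
      (expSMul (dualModel m n) s (wedge ν Λ)) ↔
    ∀ α, dualDiff m s α (L.hamiltonianVectorField H α) +
      dualDiff m H α (verticalLift (DualFib n) α (L.modularSection ν Λ α.proj)) = 0 := by
  have hd : ∀ α v, dualDiff m (fun α => Real.exp (s α)) α v = Real.exp (s α) * dualDiff m s α v :=
    fun α v => by
      unfold dualDiff
      rw [differential_comp_real (Real.hasDerivAt_exp _) (hs.mdifferentiable (by simp) _)]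
      rfl
  have key : ∀ X : Fin m ⊕ Fin n → ∀ α : DualTotal n A, TangentSpace (dualModel m n) α,
      (∀ k, IsSmoothVectorField (dualModel m n) (X k)) → ∀ α,
      lieDerivativeForm (dualModel m n) (L.hamiltonianVectorField H)
        (LieAlgebroidMech.expSMul (dualModel m n) s (wedge ν Λ)) X α = Real.exp (s α) *
      (dualDiff m s α (L.hamiltonianVectorField H α) +
      dualDiff m H α (verticalLift (DualFib n) α (L.modularSection ν Λ α.proj))) *
        wedge ν Λ α (fun k => X k α) := by
    intro X hX α
    have := L.lieDerivativeForm_smul_wedge hν hΛ hH (contMDiff_exp hs) hX α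
    rw [hd, ← mul_add] at this
    exact this
  constructor
  · intro h α
    obtain ⟨X, hX, hX0⟩ := exists_wedge_ne_zero hν hΛ α
    have := h X hX α
    rw [key X hX α] at this
    simpa [hX0] using this
  · intro h X hX α
    rw [key X hX α, h, mul_zero, zero_mul]

/-- Compare two expressions for the Lie derivative of h ν∧Λ along the hamiltonian field of a linear
function Ŷ: the Leibniz rule, and the defining property of the new modular section. Linear functions
suffice because M^v(Ŷ) = M(Y)∘τ. -/
theorem modularSection_of_wedge_eq_smul {ν' : FormField (𝓡 m) (M := Q) (Fin m)}
    {Λ' : MultivectorField (n := n) A} (hν : IsVolumeForm (𝓡 m) ν) (hΛ : IsVolumeSection m Λ)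
    (hν' : IsVolumeForm (𝓡 m) ν') (hΛ' : IsVolumeSection m Λ')
    {h : Q → ℝ} (hs : ContMDiff (𝓡 m) 𝓘(ℝ, ℝ) ∞ h) (h0 : ∀ q, h q ≠ 0)
    (hw : ∀ α : DualTotal n A, wedge ν' Λ' α = h α.proj • wedge ν Λ α) (q : Q) :
    L.modularSection ν' Λ' q = L.modularSection ν Λ q + (h q)⁻¹ • L.d h q := by
  refine covector_ext (m := m) (n := n) fun Y => ?_
  have hY : ContMDiff (dualModel m n) 𝓘(ℝ, ℝ) ∞ (linearFun Y) := contMDiff_linearFun Y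
  obtain ⟨X, hX, hX0⟩ := exists_wedge_ne_zero hν hΛ (zeroSection n A q)
  have h1 := L.lieDerivativeForm_smul_wedge hν hΛ hY (contMDiff_comp_proj hs) hX
    (zeroSection n A q)
  have h2 := L.isModularSection_modularSection hν' hΛ' ⟨linearFun Y, hY⟩ X hX (zeroSection n A q)
  have hw' : wedge ν' Λ' = fun α : DualTotal n A => h α.proj • wedge ν Λ α := funext hw
  rw [hw'] at h2
  have h3 := h1.symm.trans h2
  rw [AlternatingMap.smul_apply, smul_eq_mul, ← mul_assoc] at h3
  have h4 := mul_right_cancel₀ hX0 h3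
  have h5 := L.differential_comp_proj_hamiltonianVectorField (α := zeroSection n A q)
    (hs.mdifferentiable (by simp) q) (linearFun Y)
  have hv : ∀ β, dualDiff m (linearFun Y) (zeroSection n A q)
      (verticalLift (DualFib n) (zeroSection n A q) β) = β (Y q) := fun β =>
    differential_linearFun_verticalLift Y (zeroSection n A q) β
  unfold dualDiff at h4 h5 hv
  erw [h5, hv, hv] at h4
  have h6 : L.d h q (Y q) + h q * L.modularSection ν Λ q (Y q) =
    L.modularSection ν' Λ' q (Y q) * h q :=
    h4.trans (congrArg (· * h q) (hv (L.modularSection ν' Λ' q)))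
  have := h0 q
  simp only [_root_.add_apply, _root_.smul_apply, smul_eq_mul]
  field_simp
  linarith

theorem d_comp_real {g : ℝ → ℝ} {g' : ℝ} {h : Q → ℝ} {q : Q} (hg : HasDerivAt g g' (h q))
    (hh : MDifferentiableAt (𝓡 m) 𝓘(ℝ, ℝ) h q) :
    L.d (fun q => g (h q)) q = g' • L.d h q := by
  ext w
  exact LinearMap.congr_fun (differential_comp_real hg hh) (L.anchor q w)

/-- The modular class does not depend on the volumes. -/
theorem exists_modularSection_eq_add_d {ν' : FormField (𝓡 m) (M := Q) (Fin m)}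
    {Λ' : MultivectorField (n := n) A} (hν : IsVolumeForm (𝓡 m) ν) (hΛ : IsVolumeSection m Λ)
    (hν' : IsVolumeForm (𝓡 m) ν') (hΛ' : IsVolumeSection m Λ') :
    ∃ s : SmoothFun m Q, ∀ q, L.modularSection ν' Λ' q = L.modularSection ν Λ q + L.d s q := by
  obtain ⟨h, hs, h0, hw⟩ := exists_wedge_eq_smul (m := m) hν hΛ hν' hΛ'
  -- `Real.log` is log|·|, so h may be negative: no compatibility of orientations is needed.
  refine ⟨⟨fun q => Real.log (h q), fun q => ?_⟩, fun q => ?_⟩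
  · exact (Real.contDiffAt_log.2 (h0 q)).contMDiffAt.comp q (hs q)
  · rw [L.modularSection_of_wedge_eq_smul hν hΛ hν' hΛ' hs h0 hw]
    congr 1
    exact (L.d_comp_real (Real.hasDerivAt_log (h0 q)) (hs.mdifferentiable (by simp) q)).symm

theorem modularSection_expSMul (hν : IsVolumeForm (𝓡 m) ν) (hΛ : IsVolumeSection m Λ)
    {s : Q → ℝ} (hs : ContMDiff (𝓡 m) 𝓘(ℝ, ℝ) ∞ s) (q : Q) :
    L.modularSection (expSMul (𝓡 m) s ν) Λ q = L.modularSection ν Λ q + L.d s q := by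
  rw [L.modularSection_of_wedge_eq_smul hν hΛ (hν.expSMul hs) hΛ (contMDiff_exp hs)
    (fun q => (Real.exp_pos _).ne') (wedge_expSMul s),
    L.d_comp_real (Real.hasDerivAt_exp _) (hs.mdifferentiable (by simp) q),
    inv_smul_smul₀ (Real.exp_pos _).ne']

end LieAlgebroid
end Modular

/-! ### Bundle metrics and the volume Λ^𝒢 -/

section Metric

variable {m n : ℕ} {Q : Type*} [TopologicalSpace Q] [ChartedSpace (EuclideanSpace ℝ (Fin m)) Q]
  [IsManifold (𝓡 m) ∞ Q]
  {A : Q → Type*} [TopologicalSpace (TotalSpace (Fib n) A)]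
  [∀ q, TopologicalSpace (A q)] [∀ q, AddCommGroup (A q)] [∀ q, Module ℝ (A q)]
  [∀ q, IsTopologicalAddGroup (A q)] [∀ q, ContinuousSMul ℝ (A q)]
  [FiberBundle (Fib n) A] [VectorBundle ℝ (Fib n) A] [ContMDiffVectorBundle ∞ (Fib n) A (𝓡 m)]

namespace BundleMetric

variable (𝒢 : BundleMetric m n A)

/-- `sharp` uses `ContinuousLinearMap.inverse`, which is zero off the invertible maps. Invertibility
comes from positivity and equal finite dimensions. -/
theorem exists_equiv (q : Q) : ∃ e : A q ≃L[ℝ] (A q →L[ℝ] ℝ), ↑e = 𝒢.inner q := by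
  have h1 := finrank_fiber (n := n) (A := A) q
  have h2 := finrank_dual_fiber (n := n) (A := A) q
  have := h1.1
  have := h2.1
  have : T2Space (A q) := ((trivializationAt (Fib n) A q).continuousLinearEquivAt ℝ q
    (mem_baseSet_trivializationAt _ _ _)).toHomeomorph.symm.t2Space
  have : T2Space (A q →L[ℝ] ℝ) :=
    ((trivializationAt (DualFib n) (fun q => A q →L[ℝ] ℝ) q).continuousLinearEquivAt ℝ q
    (mem_baseSet_trivializationAt _ _ _)).toHomeomorph.symm.t2Space
  have hinj : Function.Injective (𝒢.inner q).toLinearMap := by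
    refine (injective_iff_map_eq_zero _).2 fun w hw => ?_
    by_contra h
    have h3 := 𝒢.pos q w h
    have h4 : 𝒢.inner q w = 0 := hw
    simp [h4] at h3
  refine ⟨(LinearEquiv.ofInjectiveOfFinrankEq (𝒢.inner q).toLinearMap hinj
    (h1.2.trans h2.2.symm)).toContinuousLinearEquiv, ?_⟩
  ext v w
  rfl

theorem inner_sharp (q : Q) (α : A q →L[ℝ] ℝ) : 𝒢.inner q (𝒢.sharp q α) = α := by
  obtain ⟨e, he⟩ := 𝒢.exists_equiv q
  rw [sharp, ← he, ContinuousLinearMap.inverse_equiv]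
  exact e.apply_symm_apply α

theorem sharp_inner (q : Q) (w : A q) : 𝒢.sharp q (𝒢.inner q w) = w := by
  obtain ⟨e, he⟩ := 𝒢.exists_equiv q
  rw [sharp, ← he, ContinuousLinearMap.inverse_equiv]
  exact e.symm_apply_apply w

theorem dualInner_eq (q : Q) (α β : A q →L[ℝ] ℝ) : 𝒢.dualInner q α β = α (𝒢.sharp q β) := by
  rw [dualInner, inner_sharp]

theorem apply_sharp_comm (q : Q) (α β : A q →L[ℝ] ℝ) : α (𝒢.sharp q β) = β (𝒢.sharp q α) := by
  rw [← dualInner_eq, ← dualInner_eq]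
  exact 𝒢.symm q _ _

/-- The section `♭(X)` of `A*`. -/
def flatSec (X : Sec m n A) : DualSec m n A where
  toFun q := 𝒢.inner q (X q)
  contMDiff_toFun := 𝒢.contMDiff.clm_bundle_apply (F₁ := Fib n) (F₂ := DualFib n) X.contMDiff

/-- The Gram matrix of a family of sections. -/
def gram (X : Fin n → Sec m n A) (q : Q) : Matrix (Fin n) (Fin n) ℝ :=
  Matrix.of fun a b => 𝒢.inner q (X a q) (X b q)

theorem contMDiff_gram (X : Fin n → Sec m n A) (a b : Fin n) :
    ContMDiff (𝓡 m) 𝓘(ℝ, ℝ) ∞ (fun q => 𝒢.gram X q a b) :=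
  contMDiff_section_apply (𝒢.flatSec (X a)) (X b)

/-- Normalize an orthogonal basis of A_q and carry it over by ♭, which is an isometry for the
induced metric. -/
theorem exists_isOrthonormalCoframe (q : Q) : ∃ ε, IsOrthonormalCoframe 𝒢 q ε := by
  have h1 := finrank_fiber (n := n) (A := A) q
  have := h1.1
  let B : LinearMap.BilinForm ℝ (A q) :=
    LinearMap.mk₂ ℝ (fun v w => 𝒢.inner q v w) (by simp) (by simp) (by simp) (by simp)
  obtain ⟨v, hv⟩ := LinearMap.BilinForm.exists_orthogonal_basis (B := B) ⟨fun v w => 𝒢.symm q v w⟩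
  let u : Fin n → A q := fun a => v (finCongr h1.2.symm a)
  have hu : ∀ a b, a ≠ b → 𝒢.inner q (u a) (u b) = 0 := fun a b hab =>
    hv (fun h => hab ((finCongr h1.2.symm).injective h))
  have hp : ∀ a, 0 < 𝒢.inner q (u a) (u a) := fun a => 𝒢.pos q _ (v.ne_zero _)
  refine ⟨fun a => 𝒢.inner q ((√(𝒢.inner q (u a) (u a)))⁻¹ • u a), fun a b => ?_⟩
  rw [dualInner, sharp_inner, sharp_inner]
  split_ifs with h
  · subst h
    have := Real.mul_self_sqrt (hp a).le
    have h2 := (Real.sqrt_pos.2 (hp a)).ne'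
    simp only [map_smul, _root_.smul_apply, smul_eq_mul]
    field_simp
    nlinarith
  · simp [hu a b h]

variable {𝒢}

/-- The values of an element of `Λⁿ A_q` on an orthonormal coframe. -/
theorem abs_apply_flat {q : Q} {ε : Fin n → (A q →L[ℝ] ℝ)} (hε : IsOrthonormalCoframe 𝒢 q ε)
    (Λ : (A q →L[ℝ] ℝ) [⋀^Fin n]→ₗ[ℝ] ℝ) (X : Fin n → Sec m n A) :
    |Λ (fun a => 𝒢.flatSec (X a) q)| = √(𝒢.gram X q).det * |Λ ε| := by
  have hf := finrank_dual_fiber (n := n) (A := A) q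
  have := hf.1
  have hε' : ∀ a b, ε a (𝒢.sharp q (ε b)) = if a = b then 1 else 0 := fun a b => by
    rw [← dualInner_eq]; exact hε a b
  have hd : ∀ a b, evalDual (𝒢.sharp q (ε a)) (ε b) = if a = b then 1 else 0 := fun a b =>
    (hε' b a).trans (by simp [eq_comm])
  have hc : Module.finrank ℝ (A q →L[ℝ] ℝ) = Fintype.card (Fin n) := by rw [hf.2]; simp
  rw [alternatingMap_eq_mul_det (W := A q →L[ℝ] ℝ) hc hd Λ, abs_mul, mul_comm]
  congr 1
  set P : Matrix (Fin n) (Fin n) ℝ := Matrix.of fun j k =>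
    evalDual (𝒢.sharp q (ε k)) (𝒢.flatSec (X j) q) with hP
  -- P holds the components of the ♭X_j in the coframe ε, so |det P| is the square root of the Gram
  -- determinant.
  have hG : 𝒢.gram X q = P * P.transpose := by
    ext a b
    have h1 := eq_sum_smul_of_dual (W := A q →L[ℝ] ℝ) hc hd (𝒢.flatSec (X a) q)
    have h2 : 𝒢.gram X q a b = 𝒢.flatSec (X a) q (X b q) := rfl
    rw [h2, h1, Matrix.mul_apply]
    simp only [_root_.sum_apply, _root_.smul_apply, smul_eq_mul]
    refine Finset.sum_congr rfl fun c _ => congrArg _ ?_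
    have h3 : X b q = 𝒢.sharp q (𝒢.flatSec (X b) q) := (𝒢.sharp_inner q (X b q)).symm
    rw [h3]
    exact 𝒢.apply_sharp_comm q _ _
  rw [hG, Matrix.det_mul, Matrix.det_transpose, Real.sqrt_mul_self_eq_abs]

theorem apply_ne_zero {q : Q} {ε : Fin n → (A q →L[ℝ] ℝ)} (hε : IsOrthonormalCoframe 𝒢 q ε)
    {Λ : (A q →L[ℝ] ℝ) [⋀^Fin n]→ₗ[ℝ] ℝ} (hΛ : Λ ≠ 0) : Λ ε ≠ 0 := by
  have hf := finrank_dual_fiber (n := n) (A := A) q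
  have := hf.1
  have hd : ∀ a b, evalDual (𝒢.sharp q (ε a)) (ε b) = if a = b then 1 else 0 := fun a b =>
    ((𝒢.dualInner_eq q _ _).symm.trans (hε b a)).trans (by simp [eq_comm])
  intro h
  refine hΛ ?_
  ext v
  rw [alternatingMap_eq_mul_det (W := A q →L[ℝ] ℝ) (by rw [hf.2]; simp) hd, h]
  simp

variable (𝒢)

theorem apply_flat_ne_zero {q : Q} {X : Fin n → Sec m n A} {β : Fin n → (A q →L[ℝ] ℝ)}
    (hX : ∀ a b, β a (X b q) = if a = b then 1 else 0)
    {Λ : (A q →L[ℝ] ℝ) [⋀^Fin n]→ₗ[ℝ] ℝ} (hΛ : Λ ≠ 0) :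
    Λ (fun a => 𝒢.flatSec (X a) q) ≠ 0 := by
  have hf := finrank_dual_fiber (n := n) (A := A) q
  have := hf.1
  have hd : ∀ a b, evalDual (𝒢.sharp q (β a)) (𝒢.flatSec (X b) q) = if a = b then 1 else 0 :=
    fun a b => by
      refine (𝒢.apply_sharp_comm q (𝒢.flatSec (X b) q) (β a)).trans ?_
      rw [← hX]
      exact congrArg (β a) (𝒢.sharp_inner q (X b q))
  intro h
  refine hΛ ?_
  ext v
  rw [alternatingMap_eq_mul_det (W := A q →L[ℝ] ℝ) (by rw [hf.2]; simp) hd, h]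
  simp

/-- A nonpositive determinant would have `Real.sqrt` equal to 0, making Λ vanish on the ♭X_a, which
form a basis of A*_q. -/
theorem gram_det_pos {q : Q} {X : Fin n → Sec m n A} {β : Fin n → (A q →L[ℝ] ℝ)}
    (hX : ∀ a b, β a (X b q) = if a = b then 1 else 0)
    {Λ : (A q →L[ℝ] ℝ) [⋀^Fin n]→ₗ[ℝ] ℝ} (hΛ : Λ ≠ 0) : 0 < (𝒢.gram X q).det := by
  obtain ⟨ε, hε⟩ := 𝒢.exists_isOrthonormalCoframe q
  have h := abs_apply_flat hε Λ X
  by_contra hn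
  rw [Real.sqrt_eq_zero_of_nonpos (not_lt.1 hn), zero_mul] at h
  exact 𝒢.apply_flat_ne_zero hX hΛ (abs_eq_zero.1 h)

/-- The chosen orthonormal coframe need not depend continuously on q, but |Λ(ε)|⁻¹ equals √det(gram)
/ |Λ(♭X_1, …, ♭X_n)| for a smooth local frame X, which is smooth. -/
theorem isVolumeSection_volume [T2Space Q] {Λ : MultivectorField (n := n) A}
    (hΛ : IsVolumeSection m Λ) : IsVolumeSection m (𝒢.volume Λ) := by
  have hε : ∀ q, IsOrthonormalCoframe 𝒢 q (Classical.epsilon (IsOrthonormalCoframe 𝒢 q)) :=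
    fun q => Classical.epsilon_spec (𝒢.exists_isOrthonormalCoframe q)
  refine ⟨fun β => ?_, fun q => ?_⟩
  · refine ContMDiff.mul (f := fun q => |Λ q (Classical.epsilon (IsOrthonormalCoframe 𝒢 q))|⁻¹)
      (fun q₀ => ?_) (hΛ.1 β)
    obtain ⟨S⟩ := nonempty_adaptedFrame (m := m) (n := n) (A := A) q₀
    have h0 := 𝒢.apply_flat_ne_zero S.β_X.self_of_nhds (hΛ.2 q₀)
    have h1 := 𝒢.gram_det_pos S.β_X.self_of_nhds (hΛ.2 q₀)
    have h2 := hΛ.1 (fun a => 𝒢.flatSec (S.X a))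
    have h3 := contMDiff_det (𝒢.contMDiff_gram S.X)
    have h4 : ContMDiffAt (𝓡 m) 𝓘(ℝ, ℝ) ∞ (fun q => √(𝒢.gram S.X q).det /
        |Λ q (fun a => 𝒢.flatSec (S.X a) q)|) q₀ := by
      refine ContMDiffAt.div₀ ?_ ?_ (abs_ne_zero.2 h0)
      · exact (Real.contDiffAt_sqrt h1.ne').contMDiffAt.comp q₀ (h3 q₀)
      · exact (contDiffAt_abs h0).contMDiffAt.comp q₀ (h2 q₀)
    refine h4.congr_of_eventuallyEq ?_
    filter_upwards [h2.continuous.continuousAt.eventually_ne h0] with q hq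
    rw [abs_apply_flat (hε q)]
    have h5 := abs_apply_flat (hε q) (Λ q) S.X
    have h6 : √(𝒢.gram S.X q).det ≠ 0 := fun h => by
      rw [h, zero_mul] at h5
      exact hq (abs_eq_zero.1 h5)
    field_simp
  · exact smul_ne_zero (inv_ne_zero (abs_ne_zero.2 (apply_ne_zero (hε q) (hΛ.2 q)))) (hΛ.2 q)

end BundleMetric
end Metric

/-! ### The mechanical hamiltonian and its vector field -/

section Mechanical

variable {m n : ℕ} {Q : Type*} [TopologicalSpace Q] [ChartedSpace (EuclideanSpace ℝ (Fin m)) Q]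
  [IsManifold (𝓡 m) ∞ Q]
  {A : Q → Type*} [TopologicalSpace (TotalSpace (Fib n) A)]
  [∀ q, TopologicalSpace (A q)] [∀ q, AddCommGroup (A q)] [∀ q, Module ℝ (A q)]
  [∀ q, IsTopologicalAddGroup (A q)] [∀ q, ContinuousSMul ℝ (A q)]
  [FiberBundle (Fib n) A] [VectorBundle ℝ (Fib n) A] [ContMDiffVectorBundle ∞ (Fib n) A (𝓡 m)]

namespace BundleMetric

variable (𝒢 : BundleMetric m n A)

/-- The pointwise inverse ♯ is given by the inverse Gram matrix, whose entries are smooth; H thereby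
becomes locally a quadratic polynomial in the momenta, plus V∘τ, with smooth coefficients. -/
theorem sharp_eq_sum {q₀ : Q} (S : AdaptedFrame m n A q₀) {q : Q}
    (hq : ∀ a b, S.β a q (S.X b q) = if a = b then 1 else 0)
    (hG : (𝒢.gram S.X q).det ≠ 0) (β : A q →L[ℝ] ℝ) :
    𝒢.sharp q β = ∑ b, (∑ a, (𝒢.gram S.X q)⁻¹ b a * β (S.X a q)) • S.X b q := by
  rw [← 𝒢.sharp_inner q (∑ b, (∑ a, (𝒢.gram S.X q)⁻¹ b a * β (S.X a q)) • S.X b q)]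
  congr 1
  have hc : ∀ c, β (S.X c q) =
      𝒢.inner q (∑ b, (∑ a, (𝒢.gram S.X q)⁻¹ b a * β (S.X a q)) • S.X b q) (S.X c q) := by
    intro c
    simp only [map_sum, map_smul, _root_.sum_apply, _root_.smul_apply, smul_eq_mul,
      Finset.sum_mul]
    rw [Finset.sum_comm]
    have h : ∀ a, ∑ b, (𝒢.gram S.X q)⁻¹ b a * β (S.X a q) * 𝒢.inner q (S.X b q) (S.X c q) =
        (if c = a then 1 else 0) * β (S.X a q) := by
      intro a
      rw [← Matrix.one_apply, ← Matrix.mul_nonsing_inv _ (isUnit_iff_ne_zero.2 hG),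
        Matrix.mul_apply, Finset.sum_mul]
      refine Finset.sum_congr rfl fun b _ => ?_
      rw [𝒢.symm q (S.X b q) (S.X c q)]
      simp only [gram, Matrix.of_apply]
      ring
    simp [h]
  ext w
  rw [S.eq_sum_sec hq w]
  simp only [map_sum, map_smul] at hc ⊢
  exact Finset.sum_congr rfl fun c _ => congrArg _ (hc c)

theorem dualInner_eq_sum {q₀ : Q} (S : AdaptedFrame m n A q₀) {q : Q}
    (hq : ∀ a b, S.β a q (S.X b q) = if a = b then 1 else 0)
    (hG : (𝒢.gram S.X q).det ≠ 0) (α β : A q →L[ℝ] ℝ) :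
    α (𝒢.sharp q β) =
      ∑ b, ∑ a, (𝒢.gram S.X q)⁻¹ b a * (β (S.X a q) * α (S.X b q)) := by
  rw [𝒢.sharp_eq_sum S hq hG, map_sum]
  refine Finset.sum_congr rfl fun b _ => ?_
  rw [map_smul, smul_eq_mul, Finset.sum_mul]
  simp only [mul_assoc]

/-- The mechanical hamiltonian in an adapted frame. -/
def localHamiltonian {q₀ : Q} (S : AdaptedFrame m n A q₀) (V : Q → ℝ) (γ : DualTotal n A) : ℝ :=
  1 / 2 * (∑ b, ∑ a, (𝒢.gram S.X γ.proj)⁻¹ b a *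
    (linearFun (S.X a) γ * linearFun (S.X b) γ)) + V γ.proj

variable [T2Space Q] {Λ : MultivectorField (n := n) A}

theorem hamiltonian_eventuallyEq {α : DualTotal n A} (S : AdaptedFrame m n A α.proj)
    (hG : (𝒢.gram S.X α.proj).det ≠ 0) (V : Q → ℝ) :
    𝒢.hamiltonian V =ᶠ[𝓝 α] 𝒢.localHamiltonian S V := by
  have hc : Filter.Tendsto (TotalSpace.proj : DualTotal n A → Q) (𝓝 α) (𝓝 α.proj) :=
    (FiberBundle.continuous_proj _ _).tendsto _
  have h := (contMDiff_det (𝒢.contMDiff_gram S.X)).continuous.continuousAt.eventually_ne hG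
  filter_upwards [hc.eventually h, hc.eventually S.β_X] with γ h1 h2
  rw [hamiltonian, 𝒢.dualInner_eq, 𝒢.dualInner_eq_sum S h2 h1]
  rfl

theorem contMDiffAt_gram_inv {q₀ : Q} (S : AdaptedFrame m n A q₀)
    (hG : (𝒢.gram S.X q₀).det ≠ 0) (a b : Fin n) :
    ContMDiffAt (𝓡 m) 𝓘(ℝ, ℝ) ∞ (fun q => (𝒢.gram S.X q)⁻¹ a b) q₀ :=
  contMDiffAt_inv_apply (𝒢.contMDiff_gram S.X) hG a b

theorem contMDiff_hamiltonian (hΛ : ∀ q, Λ q ≠ 0) (V : SmoothFun m Q) :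
    ContMDiff (dualModel m n) 𝓘(ℝ, ℝ) ∞ (𝒢.hamiltonian V) := by
  intro α
  obtain ⟨S⟩ := nonempty_adaptedFrame (m := m) (n := n) (A := A) α.proj
  have hG := (𝒢.gram_det_pos S.β_X.self_of_nhds (hΛ α.proj)).ne'
  refine ContMDiffAt.congr_of_eventuallyEq ?_ (𝒢.hamiltonian_eventuallyEq S hG V)
  refine ContMDiffAt.add (contMDiffAt_const.mul ?_) (contMDiff_comp_proj V.contMDiff α)
  refine contMDiffAt_finsetSum fun b _ => contMDiffAt_finsetSum fun a _ => ?_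
  refine ContMDiffAt.mul ?_ ((contMDiff_linearFun (S.X a) α).mul (contMDiff_linearFun (S.X b) α))
  exact (𝒢.contMDiffAt_gram_inv S hG b a).comp α (contMDiff_proj _ α)

theorem dualDiff_hamiltonian_verticalLift (hΛ : ∀ q, Λ q ≠ 0) (V : SmoothFun m Q)
    (α : DualTotal n A) (β : A α.proj →L[ℝ] ℝ) :
    dualDiff m (𝒢.hamiltonian V) α (verticalLift (DualFib n) α β) = α.2 (𝒢.sharp α.proj β) := by
  have h := differential_verticalLift
    ((𝒢.contMDiff_hamiltonian hΛ V).mdifferentiable (by simp) α) β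
  refine h.unique ?_
  -- On a line in the fibre H is quadratic in t; the coefficient of t is the derivative sought.
  have h1 : ∀ t : ℝ, 𝒢.hamiltonian V ⟨α.proj, α.2 + t • β⟩ =
      1 / 2 * (α.2 (𝒢.sharp α.proj α.2) + 2 * t * α.2 (𝒢.sharp α.proj β) +
        t ^ 2 * β (𝒢.sharp α.proj β)) + V α.proj := by
    intro t
    simp only [hamiltonian, 𝒢.dualInner_eq, map_add, map_smul, _root_.add_apply,
      _root_.smul_apply, smul_eq_mul, 𝒢.apply_sharp_comm α.proj β α.2]
    ring
  simp only [h1]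
  have h2 := ((((hasDerivAt_id (0 : ℝ)).const_mul 2).mul_const (α.2 (𝒢.sharp α.proj β))).const_add
    (α.2 (𝒢.sharp α.proj α.2))).add
      (((hasDerivAt_id (0 : ℝ)).pow 2).mul_const (β (𝒢.sharp α.proj β)))
  convert! (h2.const_mul (1 / 2)).add_const (V α.proj) using 1
  simp

/-- The differential of the mechanical hamiltonian in an adapted frame. -/
theorem dualDiff_hamiltonian {α : DualTotal n A} (S : AdaptedFrame m n A α.proj)
    (hG : (𝒢.gram S.X α.proj).det ≠ 0) (V : SmoothFun m Q) :
    dualDiff m (𝒢.hamiltonian V) α =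
      (1 / 2 : ℝ) • (∑ b, ∑ a,
        ((linearFun (S.X a) α * linearFun (S.X b) α) •
          dualDiff m (fun γ : DualTotal n A => (𝒢.gram S.X γ.proj)⁻¹ b a) α +
        (𝒢.gram S.X α.proj)⁻¹ b a • (linearFun (S.X a) α • dualDiff m (linearFun (S.X b)) α +
          linearFun (S.X b) α • dualDiff m (linearFun (S.X a)) α))) +
      dualDiff m (fun γ => V γ.proj) α := by
  have hy : ∀ a, MDifferentiableAt (dualModel m n) 𝓘(ℝ, ℝ) (linearFun (S.X a)) α := fun a =>
    (contMDiff_linearFun (S.X a)).mdifferentiable (by simp) α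
  have hg : ∀ a b, MDifferentiableAt (dualModel m n) 𝓘(ℝ, ℝ)
      (fun γ : DualTotal n A => (𝒢.gram S.X γ.proj)⁻¹ b a) α := fun a b =>
    ((𝒢.contMDiffAt_gram_inv S hG b a).comp α (contMDiff_proj _ α)).mdifferentiableAt (by simp)
  have hyy : ∀ a b, MDifferentiableAt (dualModel m n) 𝓘(ℝ, ℝ)
      (fun γ => linearFun (S.X a) γ * linearFun (S.X b) γ) α := fun a b =>
    ((hy a).hasMFDerivAt.mul (hy b).hasMFDerivAt).mdifferentiableAt
  have ht : ∀ a b, MDifferentiableAt (dualModel m n) 𝓘(ℝ, ℝ)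
      (fun γ : DualTotal n A => (𝒢.gram S.X γ.proj)⁻¹ b a *
        (linearFun (S.X a) γ * linearFun (S.X b) γ)) α := fun a b =>
    ((hg a b).hasMFDerivAt.mul (hyy a b).hasMFDerivAt).mdifferentiableAt
  have hs := fun b => differential_sum (I := dualModel m n) Finset.univ
    (f := fun a (γ : DualTotal n A) => (𝒢.gram S.X γ.proj)⁻¹ b a *
        (linearFun (S.X a) γ * linearFun (S.X b) γ)) (x := α) fun a _ => ht a b
  have hss := differential_sum (I := dualModel m n) Finset.univ
    (f := fun b (γ : DualTotal n A) => ∑ a, (𝒢.gram S.X γ.proj)⁻¹ b a *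
        (linearFun (S.X a) γ * linearFun (S.X b) γ)) (x := α) fun b _ => (hs b).1
  have hV : MDifferentiableAt (dualModel m n) 𝓘(ℝ, ℝ) (fun γ : DualTotal n A => V γ.proj) α :=
    (contMDiff_comp_proj V.contMDiff).mdifferentiable (by simp) α
  have hmul : ∀ f : DualTotal n A → ℝ, MDifferentiableAt (dualModel m n) 𝓘(ℝ, ℝ) f α →
      MDifferentiableAt (dualModel m n) 𝓘(ℝ, ℝ) (fun γ => 1 / 2 * f γ) α ∧
      differential (dualModel m n) (fun γ => 1 / 2 * f γ) α =
        (1 / 2 : ℝ) • differential (dualModel m n) f α := by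
    intro f hf
    have hc : MDifferentiableAt (dualModel m n) 𝓘(ℝ, ℝ) (fun _ : DualTotal n A => (1 / 2 : ℝ)) α :=
      mdifferentiableAt_const
    refine ⟨(hc.hasMFDerivAt.mul hf.hasMFDerivAt).mdifferentiableAt, ?_⟩
    rw [differential_mul hc hf, differential_const, smul_zero, add_zero]
  unfold dualDiff
  rw [differential_congr (𝒢.hamiltonian_eventuallyEq S hG V)]
  unfold localHamiltonian
  rw [differential_add (hmul _ hss.1).1 hV, (hmul _ hss.1).2, hss.2]
  congr 2
  refine Finset.sum_congr rfl fun b _ => ?_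
  rw [(hs b).2]
  refine Finset.sum_congr rfl fun a _ => ?_
  rw [differential_mul (hg a b) (hyy a b), differential_mul (hy a) (hy b), add_comm]

end BundleMetric

namespace LieAlgebroid

variable (L : LieAlgebroid m n A) [T2Space Q]

theorem linearPoisson_basic_right {g : Q → ℝ} {α : DualTotal n A}
    (hg : MDifferentiableAt (𝓡 m) 𝓘(ℝ, ℝ) g α.proj)
    (φ : Module.Dual ℝ (TangentSpace (dualModel m n) α)) :
    L.linearPoisson α φ (dualDiff m (fun γ : DualTotal n A => g γ.proj) α) =
      -φ (verticalLift (DualFib n) α (L.d g α.proj)) := by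
  rw [(L.isLinearPoissonAt α).skew, L.linearPoisson_basic hg]

/-- On the zero section, the hamiltonian vector field of a linear function is tangent to the
zero section. -/
theorem hamiltonianVectorField_linearFun_zeroSection (X : Sec m n A) (q : Q) :
    L.hamiltonianVectorField (linearFun X) (zeroSection n A q) =
      mfderiv (𝓡 m) (dualModel m n) (zeroSection n A) q (L.anchor q (X q)) := by
  obtain ⟨S⟩ := nonempty_adaptedFrame (m := m) (n := n) (A := A) q
  obtain ⟨D, -, hD⟩ := S.exists_dual_frame (α₀ := zeroSection n A q) rfl
  have hD := hD.self_of_nhds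
  have hz : MDifferentiableAt (𝓡 m) (dualModel m n) (zeroSection n A) q :=
    (Bundle.contMDiff_zeroSection ℝ (fun q => A q →L[ℝ] ℝ)
      (F := DualFib n) (IB := 𝓡 m) (n := ∞)).mdifferentiable (by simp) q
  rw [eq_sum_smul_of_dual (φ := fun k => differential (dualModel m n) (S.coord k)
      (zeroSection n A q)) (AdaptedFrame.finrank_tangentSpace (zeroSection n A q)) hD
      (L.hamiltonianVectorField (linearFun X) (zeroSection n A q)),
    eq_sum_smul_of_dual (φ := fun k => differential (dualModel m n) (S.coord k)
      (zeroSection n A q)) (AdaptedFrame.finrank_tangentSpace (zeroSection n A q)) hD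
      (mfderiv (𝓡 m) (dualModel m n) (zeroSection n A) q (L.anchor q (X q)))]
  refine Finset.sum_congr rfl fun k _ => ?_
  congr 1
  have hc : differential (dualModel m n) (S.coord k) (zeroSection n A q)
      (mfderiv (𝓡 m) (dualModel m n) (zeroSection n A) q (L.anchor q (X q))) =
      differential (𝓡 m) (fun q => S.coord k (zeroSection n A q)) q (L.anchor q (X q)) := by
    have := mfderiv_comp q ((S.contMDiff_coord k).mdifferentiable (by simp)
      (zeroSection n A q)) hz
    exact (congrArg (fun l => l (L.anchor q (X q))) this).symm
  rw [hc]
  refine (L.apply_hamiltonianVectorField (linearFun X) (zeroSection n A q)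
    (dualDiff m (S.coord k) (zeroSection n A q))).trans ?_
  -- On base coordinates both sides give ρ(X)(f_i). On momenta both vanish: the bracket of linear
  -- functions is linear, hence zero on the zero section, where the momenta themselves vanish
  -- identically.
  rcases k with i | a
  · exact (L.isLinearPoissonAt (zeroSection n A q)).basic_linear (S.f i) X
  · refine ((L.isLinearPoissonAt (zeroSection n A q)).linear_linear (S.X a) X).trans ?_
    have h0 : (fun q => S.coord (.inr a) (zeroSection n A q)) = fun _ => 0 := by
      funext q
      rfl
    rw [h0, differential_const]
    exact neg_zero

theorem linearPoisson_linearFun_zeroSection {s : DualTotal n A → ℝ}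
    (hs : ContMDiff (dualModel m n) 𝓘(ℝ, ℝ) ∞ s) (X : Sec m n A) (q : Q) :
    L.linearPoisson (zeroSection n A q) (dualDiff m s (zeroSection n A q))
      (dualDiff m (linearFun X) (zeroSection n A q)) =
      L.d (fun q => s (zeroSection n A q)) q (X q) := by
  have hz : MDifferentiableAt (𝓡 m) (dualModel m n) (zeroSection n A) q :=
    (Bundle.contMDiff_zeroSection ℝ (fun q => A q →L[ℝ] ℝ)
      (F := DualFib n) (IB := 𝓡 m) (n := ∞)).mdifferentiable (by simp) q
  rw [← L.apply_hamiltonianVectorField, L.hamiltonianVectorField_linearFun_zeroSection]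
  have := mfderiv_comp q (hs.mdifferentiable (by simp) (zeroSection n A q)) hz
  exact (congrArg (fun l => l (L.anchor q (X q))) this).symm

/-- The derivative of a function along the mechanical vector field. -/
theorem dualDiff_hamiltonianVectorField_hamiltonian (𝒢 : BundleMetric m n A) (V : SmoothFun m Q)
    {α : DualTotal n A} (S : AdaptedFrame m n A α.proj)
    (hG : (𝒢.gram S.X α.proj).det ≠ 0) (s : DualTotal n A → ℝ) :
    dualDiff m s α (L.hamiltonianVectorField (𝒢.hamiltonian V) α) =
      1 / 2 * (∑ b, ∑ a,
        (-((linearFun (S.X a) α * linearFun (S.X b) α) *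
          dualDiff m s α (verticalLift (DualFib n) α
            (L.d (fun q => (𝒢.gram S.X q)⁻¹ b a) α.proj))) +
        (𝒢.gram S.X α.proj)⁻¹ b a *
          (linearFun (S.X a) α * dualDiff m s α (L.hamiltonianVectorField (linearFun (S.X b)) α) +
          linearFun (S.X b) α * dualDiff m s α (L.hamiltonianVectorField (linearFun (S.X a)) α)))) -
      dualDiff m s α (verticalLift (DualFib n) α (L.d V α.proj)) := by
  have hg : ∀ a b, MDifferentiableAt (𝓡 m) 𝓘(ℝ, ℝ) (fun q => (𝒢.gram S.X q)⁻¹ b a) α.proj :=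
    fun a b => (𝒢.contMDiffAt_gram_inv S hG b a).mdifferentiableAt (by simp)
  simp only [L.apply_hamiltonianVectorField]
  rw [𝒢.dualDiff_hamiltonian S hG V]
  simp only [map_add, map_smul, map_sum, smul_eq_mul]
  rw [L.linearPoisson_basic_right (V.contMDiff.mdifferentiable (by simp) α.proj)]
  simp only [L.linearPoisson_basic_right (hg _ _), mul_neg, sub_eq_add_neg]

end LieAlgebroid
end Mechanical

/-! ### Second derivatives along the fibres and the fibre derivative 𝔽s -/

theorem hasDerivAt_fderiv_line {E : Type*} [NormedAddCommGroup E] [NormedSpace ℝ E] {f : E → ℝ}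
    (hf : ContDiff ℝ ∞ f) (u v : E) :
    HasDerivAt (fun t : ℝ => fderiv ℝ f (t • u) v) (fderiv ℝ (fderiv ℝ f) 0 u v) 0 := by
  have h1 : HasDerivAt (fun t : ℝ => t • u) u 0 := by
    simpa using (hasDerivAt_id (0 : ℝ)).smul_const u
  have h2 : Differentiable ℝ (fderiv ℝ f) :=
    (hf.fderiv_right (m := 1) (by exact WithTop.coe_le_coe.2 le_top)).differentiable (by simp)
  have h3 : HasFDerivAt (fderiv ℝ f) (fderiv ℝ (fderiv ℝ f) 0) ((0 : ℝ) • u) := by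
    rw [zero_smul]
    exact (h2 0).hasFDerivAt
  have h4 : HasDerivAt (fun t : ℝ => fderiv ℝ f (t • u)) (fderiv ℝ (fderiv ℝ f) 0 u) 0 :=
    h3.comp_hasDerivAt 0 h1
  exact (ContinuousLinearMap.apply ℝ ℝ v).hasFDerivAt.comp_hasDerivAt 0 h4

section FiberDerivative

variable {m n : ℕ} {Q : Type*} [TopologicalSpace Q] [ChartedSpace (EuclideanSpace ℝ (Fin m)) Q]
  [IsManifold (𝓡 m) ∞ Q]
  {A : Q → Type*} [TopologicalSpace (TotalSpace (Fib n) A)]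
  [∀ q, TopologicalSpace (A q)] [∀ q, AddCommGroup (A q)] [∀ q, Module ℝ (A q)]
  [∀ q, IsTopologicalAddGroup (A q)] [∀ q, ContinuousSMul ℝ (A q)]
  [FiberBundle (Fib n) A] [VectorBundle ℝ (Fib n) A] [ContMDiffVectorBundle ∞ (Fib n) A (𝓡 m)]

/-- The inclusion of a fibre of a vector bundle is smooth. -/
theorem contMDiff_fiber_inclusion (q : Q) :
    ContMDiff 𝓘(ℝ, DualFib n) (dualModel m n) ∞ (fun p : DualFib n => (⟨q,
      (trivializationAt (DualFib n) (fun q => A q →L[ℝ] ℝ) q).symmL ℝ q p⟩ : DualTotal n A)) := by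
  intro p
  set e := trivializationAt (DualFib n) (fun q => A q →L[ℝ] ℝ) q with he
  have hq : q ∈ e.baseSet := mem_baseSet_trivializationAt _ _ _
  rw [contMDiffAt_totalSpace]
  refine ⟨contMDiffAt_const, ?_⟩
  have h : ∀ p : DualFib n, (e ⟨q, e.symmL ℝ q p⟩).2 = p := by
    intro p
    rw [Trivialization.symmL_apply, e.apply_mk_symm hq]
    exact hq
  exact contMDiffAt_id.congr_of_eventuallyEq (Filter.Eventually.of_forall h)

/-- The restriction of a smooth function to a fibre, in a trivialization. -/
theorem exists_fiber_function {s : DualTotal n A → ℝ}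
    (hs : ContMDiff (dualModel m n) 𝓘(ℝ, ℝ) ∞ s) (q : Q) :
    ∃ (f : DualFib n → ℝ) (K : (A q →L[ℝ] ℝ) →ₗ[ℝ] DualFib n), ContDiff ℝ ∞ f ∧
      ∀ β : A q →L[ℝ] ℝ, s ⟨q, β⟩ = f (K β) := by
  set e := trivializationAt (DualFib n) (fun q => A q →L[ℝ] ℝ) q with he
  have hq : q ∈ e.baseSet := mem_baseSet_trivializationAt _ _ _
  refine ⟨fun p => s ⟨q, e.symmL ℝ q p⟩, (e.continuousLinearMapAt ℝ q).toLinearMap,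
    (hs.comp (contMDiff_fiber_inclusion q)).contDiff, fun β => ?_⟩
  exact congrArg (fun β => s ⟨q, β⟩) (e.symmL_continuousLinearMapAt hq β).symm

theorem hasDerivAt_line {s : DualTotal n A → ℝ} {q : Q} {f : DualFib n → ℝ}
    {K : (A q →L[ℝ] ℝ) →ₗ[ℝ] DualFib n} (hf : ContDiff ℝ ∞ f)
    (hfK : ∀ β : A q →L[ℝ] ℝ, s ⟨q, β⟩ = f (K β)) (α β : A q →L[ℝ] ℝ) :
    HasDerivAt (fun t : ℝ => s ⟨q, α + t • β⟩) (fderiv ℝ f (K α) (K β)) 0 := by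
  simp only [hfK, map_add, map_smul]
  have h1 : HasDerivAt (fun t : ℝ => K α + t • K β) (K β) 0 := by
    simpa using ((hasDerivAt_id (0 : ℝ)).smul_const (K β)).const_add (K α)
  have h2 : HasFDerivAt f (fderiv ℝ f (K α)) (K α + (0 : ℝ) • K β) := by
    rw [zero_smul, add_zero]
    exact (hf.differentiable (by simp) _).hasFDerivAt
  exact h2.comp_hasDerivAt 0 h1

theorem dualDiff_verticalLift {s : DualTotal n A → ℝ}
    (hs : ContMDiff (dualModel m n) 𝓘(ℝ, ℝ) ∞ s) {q : Q} {f : DualFib n → ℝ}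
    {K : (A q →L[ℝ] ℝ) →ₗ[ℝ] DualFib n} (hf : ContDiff ℝ ∞ f)
    (hfK : ∀ β : A q →L[ℝ] ℝ, s ⟨q, β⟩ = f (K β)) (α β : A q →L[ℝ] ℝ) :
    dualDiff m s ⟨q, α⟩ (verticalLift (DualFib n) (⟨q, α⟩ : DualTotal n A) β) =
      fderiv ℝ f (K α) (K β) := by
  have h := differential_verticalLift (F := DualFib n) (W := fun q => A q →L[ℝ] ℝ)
    (hs.mdifferentiable (by simp) (⟨q, α⟩ : DualTotal n A)) β
  exact h.unique (hasDerivAt_line hf hfK α β)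

variable [T2Space Q]

/-- The derivative of s along vertical lifts is a linear form on A*_q, hence, by finite dimension,
evaluation at a vector of A_q; its components in a frame are the ds(β_a^v). -/
theorem fiberDeriv_spec {s : DualTotal n A → ℝ} (hs : ContMDiff (dualModel m n) 𝓘(ℝ, ℝ) ∞ s)
    (α : DualTotal n A) (β : A α.proj →L[ℝ] ℝ) :
    β (fiberDeriv s α).2 = dualDiff m s α (verticalLift (DualFib n) α β) := by
  have hd : ∀ β : A α.proj →L[ℝ] ℝ, deriv (fun t : ℝ => s ⟨α.proj, α.2 + t • β⟩) 0 =
      dualDiff m s α (verticalLift (DualFib n) α β) := fun β =>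
    (differential_verticalLift (hs.mdifferentiable (by simp) α) β).deriv
  rw [← hd]
  refine Classical.epsilon_spec (p := fun a : A α.proj =>
    ∀ β : A α.proj →L[ℝ] ℝ, β a = deriv (fun t : ℝ => s ⟨α.proj, α.2 + t • β⟩) 0) ?_ β
  obtain ⟨S⟩ := nonempty_adaptedFrame (m := m) (n := n) (A := A) α.proj
  obtain ⟨l, hl⟩ := verticalLift_linear (m := m) α
  have hf := finrank_dual_fiber (n := n) (A := A) α.proj
  have := hf.1
  refine ⟨∑ a, dualDiff m s α (l (S.β a α.proj)) • S.X a α.proj, fun β => ?_⟩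
  have hβ := eq_sum_smul_of_dual (W := A α.proj →L[ℝ] ℝ) (by rw [hf.2]; simp)
    (φ := fun a => evalDual (S.X a α.proj)) (d := fun a => S.β a α.proj)
    (fun a b => by simp [evalDual, S.β_X.self_of_nhds, eq_comm]) β
  rw [hd, ← hl]
  conv_rhs => rw [hβ]
  simp only [map_sum, map_smul, smul_eq_mul]
  exact Finset.sum_congr rfl fun a _ => mul_comm _ _

/-- In an adapted frame the components of 𝔽s are the derivatives of s along the momentum coordinate
fields. -/
theorem mdifferentiableAt_fiberDeriv {s : DualTotal n A → ℝ}
    (hs : ContMDiff (dualModel m n) 𝓘(ℝ, ℝ) ∞ s) (α₀ : DualTotal n A) :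
    MDifferentiableAt (dualModel m n) ((𝓡 m).prod 𝓘(ℝ, Fib n)) (fiberDeriv s) α₀ := by
  obtain ⟨S⟩ := nonempty_adaptedFrame (m := m) (n := n) (A := A) α₀.proj
  obtain ⟨D, hDs, hD⟩ := S.exists_dual_frame (α₀ := α₀) rfl
  have hc : Filter.Tendsto (TotalSpace.proj : DualTotal n A → Q) (𝓝 α₀) (𝓝 α₀.proj) :=
    (FiberBundle.continuous_proj _ _).tendsto _
  set e := trivializationAt (Fib n) A α₀.proj with he
  have hb : ∀ᶠ q in 𝓝 α₀.proj, q ∈ e.baseSet :=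
    e.open_baseSet.mem_nhds (mem_baseSet_trivializationAt _ _ _)
  rw [mdifferentiableAt_totalSpace]
  refine ⟨mdifferentiableAt_proj _, ?_⟩
  have hp : (fiberDeriv s α₀).proj = α₀.proj := rfl
  rw [hp, ← he]
  have h : ContMDiffAt (dualModel m n) 𝓘(ℝ, Fib n) ∞ (fun α : DualTotal n A =>
      ∑ a, dualDiff m s α (D (.inr a) α) • EuclideanSpace.single a (1 : ℝ)) α₀ :=
    contMDiffAt_finsetSum fun a _ =>
      (contMDiff_differential_apply hs (hDs _) α₀).smul contMDiffAt_const
  refine (h.mdifferentiableAt (by simp)).congr_of_eventuallyEq ?_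
  filter_upwards [hD, hc.eventually S.β_X, hc.eventually S.X_eq, hc.eventually hb] with α h1 h2 h3 h4
  have h5 : (e (fiberDeriv s α)).2 = e.continuousLinearMapAt ℝ α.proj (fiberDeriv s α).2 := by
    simp [e.coe_linearMapAt_of_mem h4]
    rfl
  rw [h5, S.eq_sum_sec h2 (fiberDeriv s α).2, map_sum]
  refine Finset.sum_congr rfl fun a _ => ?_
  have h6 : e.continuousLinearMapAt ℝ α.proj (S.X a α.proj) = EuclideanSpace.single a 1 :=
    (congrArg _ (h3 a)).trans (e.continuousLinearMapAt_symmL h4 _)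
  rw [map_smul, fiberDeriv_spec hs, S.dual_frame_inr h2 h1, h6]

/-- The tangent map of `𝔽s` at the zero section, on a vertical vector. -/
theorem mfderiv_fiberDeriv_verticalLift {s : DualTotal n A → ℝ}
    (hs : ContMDiff (dualModel m n) 𝓘(ℝ, ℝ) ∞ s) {q : Q} {f : DualFib n → ℝ}
    {K : (A q →L[ℝ] ℝ) →ₗ[ℝ] DualFib n} (hf : ContDiff ℝ ∞ f)
    (hfK : ∀ β : A q →L[ℝ] ℝ, s ⟨q, β⟩ = f (K β)) (w : A q →L[ℝ] ℝ) {u : A q}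
    (hu : ∀ β : A q →L[ℝ] ℝ, fderiv ℝ (fderiv ℝ f) 0 (K w) (K β) = β u) :
    mfderiv (dualModel m n) ((𝓡 m).prod 𝓘(ℝ, Fib n)) (fiberDeriv s) (zeroSection n A q)
      (verticalLift (DualFib n) (zeroSection n A q) w) =
    verticalLift (Fib n) (fiberDeriv s (zeroSection n A q)) u := by
  set e := trivializationAt (Fib n) A q with he
  -- The vertical vector is the velocity of t ↦ tw, whose image under 𝔽s stays in A_q. The velocity
  -- of that image is found by pairing with covectors, which gives second derivatives of s.
  let c : ℝ → A q := fun t => (fiberDeriv s (⟨q, 0 + t • w⟩ : DualTotal n A)).2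
  have hβ : ∀ β : A q →L[ℝ] ℝ, HasDerivAt (fun t => β (c t)) (β u) 0 := by
    intro β
    have h1 : ∀ t, β (c t) = fderiv ℝ f (t • K w) (K β) := by
      intro t
      have := fiberDeriv_spec hs (⟨q, 0 + t • w⟩ : DualTotal n A) β
      refine this.trans ((dualDiff_verticalLift hs hf hfK (0 + t • w) β).trans ?_)
      simp
    simp only [h1, ← hu β]
    exact hasDerivAt_fderiv_line hf (K w) (K β)
  have hc : HasDerivAt (fun t => e.continuousLinearMapAt ℝ q (c t))
      (e.continuousLinearMapAt ℝ q u) 0 := by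
    have hp := (PiLp.hasStrictFDerivAt_toLp (𝕜 := ℝ) 2 (fun i =>
      (e.continuousLinearMapAt ℝ q (c 0)) i)).hasFDerivAt.comp_hasDerivAt 0
      (hasDerivAt_pi.2 fun i => hβ ((EuclideanSpace.proj i).comp (e.continuousLinearMapAt ℝ q)))
    exact hp
  have hcm := hasMFDerivAt_fiber_curve (m := m) hc
  have hl : MDifferentiableAt 𝓘(ℝ, ℝ) (dualModel m n)
      (fun t : ℝ => (⟨q, 0 + t • w⟩ : DualTotal n A)) 0 :=
    mdifferentiableAt_fiber_line (zeroSection n A q) w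
  have h0 : (⟨q, 0 + (0 : ℝ) • w⟩ : DualTotal n A) = zeroSection n A q := by
    simp [zeroSection]
  have hm := mdifferentiableAt_fiberDeriv hs (zeroSection n A q)
  have hg : ∀ b : DualTotal n A, b = zeroSection n A q →
      HasMFDerivAt (dualModel m n) ((𝓡 m).prod 𝓘(ℝ, Fib n)) (fiberDeriv s) b
        (mfderiv (dualModel m n) ((𝓡 m).prod 𝓘(ℝ, Fib n)) (fiberDeriv s) (zeroSection n A q) :
          EuclideanSpace ℝ (Fin m) × DualFib n →L[ℝ] EuclideanSpace ℝ (Fin m) × Fib n) := by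
    rintro b rfl
    exact hm.hasMFDerivAt
  have hcomp := (hg _ h0).comp 0 hl.hasMFDerivAt
  have huniq := hasMFDerivAt_unique hcomp hcm
  refine Eq.trans ?_ (verticalLift_eq_trivialization (fiberDeriv s (zeroSection n A q)) u).symm
  refine Eq.trans ?_ ((congrArg (fun l : ℝ →L[ℝ] EuclideanSpace ℝ (Fin m) × Fib n => l 1)
    huniq).trans (one_smul ℝ _))
  rfl

end FiberDerivative

/-- The slope at 0 is g(t), so continuity of g at 0 is enough and no derivative of g has to be
computed. -/
theorem hasDerivAt_id_mul {g : ℝ → ℝ} (hg : ContinuousAt g 0) :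
    HasDerivAt (fun t => t * g t) (g 0) 0 := by
  rw [hasDerivAt_iff_tendsto_slope]
  refine (hg.tendsto.mono_left nhdsWithin_le_nhds).congr' ?_
  filter_upwards [self_mem_nhdsWithin] with t ht
  have ht : t ≠ 0 := ht
  simp [slope_def_field, ht]

/-! ### The invariance equation near the zero section -/

section Main

variable {m n : ℕ} {Q : Type*} [TopologicalSpace Q] [ChartedSpace (EuclideanSpace ℝ (Fin m)) Q]
  [IsManifold (𝓡 m) ∞ Q]
  {A : Q → Type*} [TopologicalSpace (TotalSpace (Fib n) A)]
  [∀ q, TopologicalSpace (A q)] [∀ q, AddCommGroup (A q)] [∀ q, Module ℝ (A q)]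
  [∀ q, IsTopologicalAddGroup (A q)] [∀ q, ContinuousSMul ℝ (A q)]
  [FiberBundle (Fib n) A] [VectorBundle ℝ (Fib n) A] [ContMDiffVectorBundle ∞ (Fib n) A (𝓡 m)]
  [T2Space Q]

namespace LieAlgebroid

variable (L : LieAlgebroid m n A) (𝒢 : BundleMetric m n A) (V : SmoothFun m Q)

/-- If a multiple `e^s` of a volume form `ν ∧ Λ` with modular section `M` is preserved by the
mechanical vector field, the derivative of `𝔽s(d^A V)` at the zero section is determined by the
restriction of `s` to the zero section and by `M`. -/
theorem hasDerivAt_dualDiff_verticalLift_d {Λ : MultivectorField (n := n) A}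
    (hΛ : ∀ q, Λ q ≠ 0) {M : ∀ q, A q →L[ℝ] ℝ} {s : DualTotal n A → ℝ}
    (hs : ContMDiff (dualModel m n) 𝓘(ℝ, ℝ) ∞ s)
    (hsM : ∀ α, dualDiff m s α (L.hamiltonianVectorField (𝒢.hamiltonian V) α) +
      dualDiff m (𝒢.hamiltonian V) α (verticalLift (DualFib n) α (M α.proj)) = 0)
    (q : Q) (β : A q →L[ℝ] ℝ) :
    HasDerivAt (fun t : ℝ => dualDiff m s (⟨q, 0 + t • β⟩ : DualTotal n A)
        (verticalLift (DualFib n) (⟨q, 0 + t • β⟩ : DualTotal n A) (L.d V q)))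
      ((M q + L.d (fun q => s (zeroSection n A q)) q) (𝒢.sharp q β)) 0 := by
  obtain ⟨S⟩ := nonempty_adaptedFrame (m := m) (n := n) (A := A) q
  obtain ⟨f, K, hf, hfK⟩ := exists_fiber_function hs q
  have hX := S.β_X.self_of_nhds
  have hG := (𝒢.gram_det_pos hX (hΛ q)).ne'
  set θ := L.d (fun q => s (zeroSection n A q)) q with hθ
  -- Along t ↦ tβ, u is the derivative of s in the vertical direction d^A of an inverse Gram entry,
  -- and p_a is {s, X̂_a}. Then g collects the remaining terms of the invariance equation after
  -- division by t; the u terms keep a factor t and disappear at 0.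
  let u : Fin n → Fin n → ℝ → ℝ := fun a b t =>
    fderiv ℝ f (K (0 + t • β)) (K (L.d (fun q => (𝒢.gram S.X q)⁻¹ b a) q))
  let p : Fin n → ℝ → ℝ := fun a t => dualDiff m s (⟨q, 0 + t • β⟩ : DualTotal n A)
    (L.hamiltonianVectorField (linearFun (S.X a)) (⟨q, 0 + t • β⟩ : DualTotal n A))
  let g : ℝ → ℝ := fun t => 1 / 2 * (∑ b, ∑ a,
    (-(t * (β (S.X a q) * β (S.X b q)) * u a b t) +
      (𝒢.gram S.X q)⁻¹ b a * (β (S.X a q) * p b t + β (S.X b q) * p a t))) + M q (𝒢.sharp q β)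
  have hl : ContinuousAt (fun t : ℝ => (⟨q, 0 + t • β⟩ : DualTotal n A)) 0 :=
    (mdifferentiableAt_fiber_line (m := m) (zeroSection n A q) β).continuousAt
  have h0 : (⟨q, 0 + (0 : ℝ) • β⟩ : DualTotal n A) = zeroSection n A q := by
    simp [zeroSection]
  have hu : ∀ a b, ContinuousAt (u a b) 0 := by
    intro a b
    have h1 : Continuous (fderiv ℝ f) := hf.continuous_fderiv (by simp)
    simp only [u, map_smul, zero_add]
    exact ((h1.comp (continuous_id.smul continuous_const)).clm_apply continuous_const).continuousAt
  have hp : ∀ a, ContinuousAt (p a) 0 := by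
    intro a
    have h1 := (contMDiff_differential_apply hs (L.isSmoothVectorField_hamiltonianVectorField
      (contMDiff_linearFun (S.X a)))).continuous
    exact h1.continuousAt.comp_of_eq hl rfl
  have hp0 : ∀ a, p a 0 = θ (S.X a q) := by
    intro a
    have h : ∀ γ : DualTotal n A, γ = zeroSection n A q →
        dualDiff m s γ (L.hamiltonianVectorField (linearFun (S.X a)) γ) = θ (S.X a q) := by
      rintro γ rfl
      rw [L.apply_hamiltonianVectorField, L.linearPoisson_linearFun_zeroSection hs]
    exact h _ h0
  have hg : ContinuousAt g 0 := by
    refine ContinuousAt.add (continuousAt_const.mul ?_) continuousAt_const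
    refine tendsto_finsetSum _ fun b _ => tendsto_finsetSum _ fun a _ => ?_
    exact ((continuousAt_id.mul continuousAt_const).mul (hu a b)).neg.add
      (continuousAt_const.mul ((continuousAt_const.mul (hp b)).add (continuousAt_const.mul (hp a))))
  -- At t = 0 the p terms are θ(X_a); the two halves of the symmetric Gram sum both give θ(♯β),
  -- which absorbs the factor 1/2.
  have hg0 : g 0 = (M q + θ) (𝒢.sharp q β) := by
    have h1 := 𝒢.dualInner_eq_sum S hX hG θ β
    have h2 := 𝒢.dualInner_eq_sum S hX hG β θ
    rw [𝒢.apply_sharp_comm] at h2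
    simp only [g, hp0, zero_mul, neg_zero, mul_add, Finset.sum_add_distrib,
      Finset.sum_const_zero,
      _root_.add_apply]
    simp only [mul_comm (θ _)] at h2
    rw [← h1, ← h2]
    ring
  -- The invariance equation at tβ, solved for the potential term: the momenta there are tβ(X_a), so
  -- every other term contains t.
  have key : ∀ t : ℝ, dualDiff m s (⟨q, 0 + t • β⟩ : DualTotal n A)
      (verticalLift (DualFib n) (⟨q, 0 + t • β⟩ : DualTotal n A) (L.d V q)) = t * g t := by
    intro t
    have h1 := hsM (⟨q, 0 + t • β⟩ : DualTotal n A)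
    rw [L.dualDiff_hamiltonianVectorField_hamiltonian 𝒢 V (α := ⟨q, 0 + t • β⟩) S hG s,
      𝒢.dualDiff_hamiltonian_verticalLift hΛ V] at h1
    have h2 : ∀ a, linearFun (S.X a) (⟨q, 0 + t • β⟩ : DualTotal n A) = t * β (S.X a q) := by
      intro a
      simp [linearFun]
    have h3 : ∀ a b, dualDiff m s (⟨q, 0 + t • β⟩ : DualTotal n A)
        (verticalLift (DualFib n) (⟨q, 0 + t • β⟩ : DualTotal n A)
          (L.d (fun q => (𝒢.gram S.X q)⁻¹ b a) q)) = u a b t := fun a b =>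
      dualDiff_verticalLift hs hf hfK _ _
    have h4 : (0 + t • β) (𝒢.sharp q (M q)) = t * M q (𝒢.sharp q β) := by
      rw [𝒢.apply_sharp_comm q (M q) β]
      simp
    simp only [h2, h3] at h1
    erw [h4] at h1
    have h5 : t * g t = 1 / 2 * (∑ b, ∑ a,
        (-(t * β (S.X a q) * (t * β (S.X b q)) * u a b t) +
        (𝒢.gram S.X q)⁻¹ b a * (t * β (S.X a q) * p b t + t * β (S.X b q) * p a t))) +
        t * M q (𝒢.sharp q β) := by
      simp only [g]
      rw [mul_add, mul_left_comm, Finset.mul_sum]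
      congr 2
      refine Finset.sum_congr rfl fun b _ => ?_
      rw [Finset.mul_sum]
      exact Finset.sum_congr rfl fun a _ => by ring
    rw [h5]
    linarith
  simp only [key]
  rw [← hg0]
  exact hasDerivAt_id_mul hg

end LieAlgebroid
end Main
end LieAlgebroidMech
end

/-! ### The theorem -/

open LieAlgebroidMech
theorem theorem4p1 {m n : ℕ} {Q : Type*} [TopologicalSpace Q] [T2Space Q] [SigmaCompactSpace Q]
    [ChartedSpace (EuclideanSpace ℝ (Fin m)) Q] [IsManifold (𝓡 m) ∞ Q]
    {A : Q → Type*} [TopologicalSpace (TotalSpace (Fib n) A)]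
    [∀ q, TopologicalSpace (A q)] [∀ q, AddCommGroup (A q)] [∀ q, Module ℝ (A q)]
    [∀ q, IsTopologicalAddGroup (A q)] [∀ q, ContinuousSMul ℝ (A q)]
    [FiberBundle (Fib n) A] [VectorBundle ℝ (Fib n) A] [ContMDiffVectorBundle ∞ (Fib n) A (𝓡 m)]
    (L : LieAlgebroid m n A) (𝒢 : BundleMetric m n A) (V : SmoothFun m Q)
    (ν : FormField (𝓡 m) (M := Q) (Fin m)) (hν : IsVolumeForm (𝓡 m) ν)
    (Λ₀ : MultivectorField (n := n) A) (hΛ₀ : IsVolumeSection m Λ₀) :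
    let H : DualTotal n A → ℝ := BundleMetric.hamiltonian 𝒢 V
    let Λ : MultivectorField (n := n) A := BundleMetric.volume 𝒢 Λ₀
    (L.IsUnimodular → ∃ μ : SmoothFun m Q,
      IsVolumeForm (dualModel m n) (expSMul (dualModel m n) (fun α => μ α.proj) (wedge ν Λ)) ∧
      Preserves (dualModel m n) (L.hamiltonianVectorField H)
        (expSMul (dualModel m n) (fun α => μ α.proj) (wedge ν Λ))) ∧
    (∀ σ : SmoothFun m Q, (L.modularSection ν Λ = fun q => -L.d σ q) →
      Preserves (dualModel m n) (L.hamiltonianVectorField H)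
        (expSMul (dualModel m n) (fun α => σ α.proj) (wedge ν Λ))) ∧
    (∀ σt : DualSmoothFun m n A,
      Preserves (dualModel m n) (L.hamiltonianVectorField H)
        (expSMul (dualModel m n) σt (wedge ν Λ)) →
      ∀ q : Q,
        mfderiv (dualModel m n) ((𝓡 m).prod 𝓘(ℝ, Fib n)) (fiberDeriv σt) (zeroSection n A q)
            (verticalLift (DualFib n) (zeroSection n A q) (L.d V q))
          = verticalLift (Fib n) (fiberDeriv σt (zeroSection n A q))
              (BundleMetric.sharp 𝒢 q
                (L.modularSection
                  (expSMul (𝓡 m) (fun q' => σt (zeroSection n A q')) ν) Λ q))) := by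
  intro H Λ
  have hΛ : IsVolumeSection m Λ := 𝒢.isVolumeSection_volume hΛ₀
  have hH : ContMDiff (dualModel m n) 𝓘(ℝ, ℝ) ∞ H := 𝒢.contMDiff_hamiltonian hΛ.2 V
  have hbasic : ∀ σ : SmoothFun m Q, (L.modularSection ν Λ = fun q => -L.d σ q) →
      Preserves (dualModel m n) (L.hamiltonianVectorField H)
        (expSMul (dualModel m n) (fun α => σ α.proj) (wedge ν Λ)) := by
    intro σ hσ
    refine (L.preserves_expSMul_iff hν hΛ hH (contMDiff_comp_proj σ.contMDiff)).2 fun α => ?_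
    obtain ⟨l, hl⟩ := verticalLift_linear (m := m) α
    have h1 := L.differential_comp_proj_hamiltonianVectorField (α := α)
      (σ.contMDiff.mdifferentiable (by simp) α.proj) H
    rw [← hl] at h1 ⊢
    rw [hσ, map_neg, map_neg]
    exact add_neg_eq_zero.2 h1
  refine ⟨?_, hbasic, ?_⟩
  -- Unimodularity is witnessed by an arbitrary pair (ν', Λ'). Its modular section differs from the
  -- one of (ν, Λ) by d^A s, so σ' + s serves as exponent.
  · rintro ⟨ν', Λ', hν', hΛ', σ', hσ'⟩
    obtain ⟨s, hs⟩ := L.exists_modularSection_eq_add_d hν hΛ hν' hΛ'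
    refine ⟨σ' + s, (isVolumeForm_wedge hν hΛ).expSMul
      (contMDiff_comp_proj (σ' + s).contMDiff), hbasic _ ?_⟩
    funext q
    have h1 : -L.d σ' q = L.modularSection ν Λ q + L.d s q := by rw [← hs q, hσ']
    have h2 : L.d (σ' + s) q = L.d σ' q + L.d s q := by
      ext w
      exact LinearMap.congr_fun (differential_add
        (σ'.contMDiff.mdifferentiable (by simp) q) (s.contMDiff.mdifferentiable (by simp) q))
        (L.anchor q w)
    have h3 : L.d (⇑(σ' + s)) q = L.d (σ' + s) q := rfl
    rw [h3, h2, neg_add, h1]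
    abel
  · intro σt hσt q
    have hM := (L.preserves_expSMul_iff hν hΛ hH σt.contMDiff).1 hσt
    obtain ⟨f, K, hf, hfK⟩ := exists_fiber_function σt.contMDiff q
    have hz : ContMDiff (𝓡 m) 𝓘(ℝ, ℝ) ∞ (fun q => σt (zeroSection n A q)) :=
      σt.contMDiff.comp (Bundle.contMDiff_zeroSection ℝ (fun q => A q →L[ℝ] ℝ))
    refine mfderiv_fiberDeriv_verticalLift σt.contMDiff hf hfK (L.d V q) fun β => ?_
    have h1 := L.hasDerivAt_dualDiff_verticalLift_d 𝒢 V hΛ.2 σt.contMDiff hM q β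
    have h2 : ∀ t : ℝ, dualDiff m σt (⟨q, 0 + t • β⟩ : DualTotal n A)
        (verticalLift (DualFib n) (⟨q, 0 + t • β⟩ : DualTotal n A) (L.d V q)) =
        fderiv ℝ f (t • K β) (K (L.d V q)) := fun t => by
      refine (dualDiff_verticalLift σt.contMDiff hf hfK (0 + t • β) (L.d V q)).trans ?_
      simp
    simp only [h2] at h1
    -- This is the fibre Hessian on (β, d^A V), whereas T𝔽s along d^A V needs it on (d^A V, β);
    -- symmetry of second derivatives exchanges the two.
    have h3 := (hasDerivAt_fderiv_line hf (K β) (K (L.d V q))).unique h1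
    have h4 : IsSymmSndFDerivAt ℝ f 0 :=
      hf.contDiffAt.isSymmSndFDerivAt (by
        rw [minSmoothness_of_isRCLikeNormedField]
        exact WithTop.coe_le_coe.2 le_top)
    rw [h4, h3, L.modularSection_expSMul hν hΛ hz q]
    exact 𝒢.apply_sharp_comm q _ _
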